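/- A finite set $P\subset\mathbb R^2$ is in general position if no three of its points are collinear and no four are cocircular. A triangulation of $P$ consists of nondegenerate triangles with vertices in $P$ that cover the convex hull of $P$, meet face to face, and together use every point of $P$ as a vertex. It is order-$k$ Delaunay if the circumcircle of each of its triangles contains at most $k$ points of $P$ in its interior; first-order Delaunay means $k=1$, and the (order-$0$) Delaunay triangulation of $P$ is the case $k=0$. An edge of the Delaunay triangulation is $1$-fixed if it is an edge of every first-order Delaunay triangulation of $P$. A flippable quadrilateral is a convex quadrilateral face of the subdivision formed by the $1$-fixed edges such that each of its two diagonals is an edge of some first-order Delaunay triangulation of $P$. Every set $P$ of $n\ge 3$ points in general position has at most $2^{n-3}$ first-order Delaunay triangulations. The bound is tight: for every positive multiple $n$ of $4$ there is a set of $n$ points in general position with exactly $2^{n-3}$ first-order Delaunay triangulations. In fact, let $n=4m$ with $m\ge 1$, let $0<r_1<\dots<r_m$, and consider the $n$ vertices $(\pm r_i,\pm r_i)$ of $m$ concentric squares. There is a $\delta>0$ such that every set of $n$ distinct points in general position obtained by moving each of these vertices by less than $\delta$ has exactly $n-3$ flippable quadrilaterals and exactly $2^{n-3}$ first-order Delaunay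 triangulations; and for every $\varepsilon>0$ there is a set of $n$ distinct points in general position obtained by moving each of these vertices by less than $\varepsilon$. -/

import Mathlib

namespace DelaunayOrder

/-- The Euclidean plane. -/
abbrev Plane : Type := EuclideanSpace ℝ (Fin 2)

/-- General position: no three points are collinear and no four points are cocircular. -/
structure GeneralPosition (P : Finset Plane) : Prop where
  not_collinear : ∀ s ⊆ P, s.card = 3 → ¬ Collinear ℝ (s : Set Plane)
  not_cocircular : ∀ s ⊆ P, s.card = 4 → ¬ EuclideanGeometry.Cospherical (s : Set Plane)

/-- A triangulation of the point set `P`, given by the vertex sets of its triangles: the triangles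
are nondegenerate, have their vertices in `P`, cover the convex hull of `P`, meet face to face, and
every point of `P` is a vertex of one of them. -/
structure IsTriangulation (P : Finset Plane) (T : Finset (Finset Plane)) : Prop where
  subset : ∀ t ∈ T, t ⊆ P
  card_eq_three : ∀ t ∈ T, t.card = 3
  affineIndependent : ∀ t ∈ T, AffineIndependent ℝ ((↑) : t → Plane)
  cover : ⋃ t ∈ T, convexHull ℝ (t : Set Plane) = convexHull ℝ (P : Set Plane)
  inter_eq : ∀ s ∈ T, ∀ t ∈ T,
    convexHull ℝ (s : Set Plane) ∩ convexHull ℝ (t : Set Plane) =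
      convexHull ℝ ((s : Set Plane) ∩ (t : Set Plane))
  exists_mem : ∀ p ∈ P, ∃ t ∈ T, p ∈ t

/-- The triangle with vertex set `t` is order-`k` Delaunay with respect to `P`: its circumcircle has
at most `k` points of `P` in its interior. (For a nondegenerate triangle the circle through
its vertices exists and is unique.) -/
def IsOrderTriangle (k : ℕ) (P t : Finset Plane) : Prop :=
  ∃ S : EuclideanGeometry.Sphere Plane, (∀ v ∈ t, v ∈ S) ∧
    {p : Plane | p ∈ P ∧ dist p S.center < S.radius}.encard ≤ k

/-- `T` is an order-`k` Delaunay triangulation of `P`; for `k = 0` this is the Delaunay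
triangulation, and for `k = 1` a first-order Delaunay triangulation. -/
structure IsOrderDelaunay (k : ℕ) (P : Finset Plane) (T : Finset (Finset Plane)) : Prop where
  isTriangulation : IsTriangulation P T
  isOrderTriangle : ∀ t ∈ T, IsOrderTriangle k P t

/-- The set of all order-`k` Delaunay triangulations of `P`. -/
def orderDelaunay (k : ℕ) (P : Finset Plane) : Set (Finset (Finset Plane)) :=
  {T | IsOrderDelaunay k P T}

/-- The segment `uv` is an edge of (some triangle of) `T`. -/
def IsEdge (T : Finset (Finset Plane)) (u v : Plane) : Prop :=
  u ≠ v ∧ ∃ t ∈ T, u ∈ t ∧ v ∈ t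

/-- `uv` is a useful order-`k` Delaunay edge: an edge of some order-`k` Delaunay triangulation. -/
def IsUsefulEdge (k : ℕ) (P : Finset Plane) (u v : Plane) : Prop :=
  ∃ T ∈ orderDelaunay k P, IsEdge T u v

/-- `uv` is `k`-fixed: it is an edge of the Delaunay triangulation and of every order-`k` Delaunay
triangulation of `P`. -/
def IsFixedEdge (k : ℕ) (P : Finset Plane) (u v : Plane) : Prop :=
  (∃ T ∈ orderDelaunay 0 P, IsEdge T u v) ∧ ∀ T ∈ orderDelaunay k P, IsEdge T u v

/-- The vertex set `Q` of a flippable quadrilateral of `P`: a convex quadrilateral `abcd` (its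
diagonals cross) that is a face of the subdivision formed by the `1`-fixed edges (its sides are
`1`-fixed, and no point of `P` and no `1`-fixed edge meets its interior), and both of whose diagonals
occur in first-order Delaunay triangulations of `P`. -/
def IsFlippableQuadrilateral (P Q : Finset Plane) : Prop :=
  ∃ a b c d : Plane, (Q : Set Plane) = {a, b, c, d} ∧
    (openSegment ℝ a c ∩ openSegment ℝ b d).Nonempty ∧
    (IsFixedEdge 1 P a b ∧ IsFixedEdge 1 P b c ∧ IsFixedEdge 1 P c d ∧ IsFixedEdge 1 P d a) ∧
    (∀ p ∈ P, p ∉ interior (convexHull ℝ (Q : Set Plane))) ∧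
    (∀ u v : Plane, IsFixedEdge 1 P u v →
      Disjoint (segment ℝ u v) (interior (convexHull ℝ (Q : Set Plane)))) ∧
    IsUsefulEdge 1 P a c ∧ IsUsefulEdge 1 P b d

/-- The set of all flippable quadrilaterals of `P`. -/
def flippableQuadrilaterals (P : Finset Plane) : Set (Finset Plane) :=
  {Q | IsFlippableQuadrilateral P Q}

/-- The vertices of the axis-parallel square of side `2 * r` centred at the origin. -/
noncomputable def squareVertex (r : ℝ) : Fin 4 → Plane :=
  ![!₂[r, r], !₂[-r, r], !₂[-r, -r], !₂[r, -r]]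

/-- `P` arises from the `4 * m` vertices of the `m` concentric squares of half side lengths
`r 0, …, r (m - 1)` by moving each vertex by less than `ε`, keeping the points distinct. -/
def IsPerturbedSquares {m : ℕ} (r : Fin m → ℝ) (ε : ℝ) (P : Finset Plane) : Prop :=
  ∃ p : Fin m × Fin 4 → Plane, Function.Injective p ∧ Set.range p = (P : Set Plane) ∧
    ∀ i j, dist (p (i, j)) (squareVertex (r i) j) < ε

end DelaunayOrder

/-!
Let `P` be in general position. For a triple `t` of points, `pow t` is the power with respect to its
circle and `inner P t` the set of points of `P` inside the circle. Two facts about powers carry the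
geometry: the difference of two of them is an affine function (`pow_sub_pow_combo`), and the circles
through two points form a pencil (`pow_sub_pow_mul`). The first one shows that triangles with empty
circle meet face to face (`GeneralPosition.emptyTriangle_face`); the triangle around a given point
whose circle gives that point the largest power is empty, so the empty triangles also cover the hull
(`GeneralPosition.isTriangulation_emptyTriangles`) and form the Delaunay triangulation.

A triangle `t` of a first-order Delaunay triangulation that is not empty has exactly one point `p`
inside its circle. Walking from `t` towards `p` decreases the power of `p`, and this forces the
neighbour of `t` to have the vertex `p`: the two triangles form a convex quadrilateral whose other
diagonal is a Delaunay edge, and each of them has just the opposite vertex inside its circle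
(`FlipQuad`, `exists_flipQuad`). Every empty triangle belongs to at most one such quadrilateral
(`FlipQuad.quad_eq`), so their diagonals can be flipped independently of each other. Hence the
first-order Delaunay triangulations correspond to the subsets of the set `flipQuads P`, and there
are exactly `2 ^ (flipQuads P).card` of them (`GeneralPosition.encard_orderDelaunay_one`). These
quadrilaterals are also the faces of the subdivision formed by the fixed edges both of whose
diagonals are useful (`GeneralPosition.flippableQuadrilaterals_eq`).

It remains to count. There are at most `2 * n - 5` empty triangles, because each is determined by
its middle vertex in a generic direction and a side (`GeneralPosition.card_emptyTriangles_le`). Each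
quadrilateral uses up two of them, which leaves room for at most `n - 3` quadrilaterals. For `m`
concentric squares, the innermost square and the four trapezoids between consecutive squares are
`4 * m - 3` cells, each inscribed in a circle with all other vertices strictly outside. Whichever way
a small perturbation into general position breaks the cocircularity of a cell, it makes the cell a
member of `flipQuads` (`eventually_cell`, `NearlyCocircular.quad_mem`), so the bound is attained.
Such perturbations exist because a point in general position only has to avoid finitely many points,
lines and circles (`exists_generalPosition`).
-/

namespace DelaunayOrder

open EuclideanGeometry
open scoped Classical

/-! ### Orientation, circles and triangles in coordinates -/

/-- Twice the signed area of the triangle `abc`; positive when `abc` turns counterclockwise. -/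
def orient (a b c : Plane) : ℝ :=
  (b 0 - a 0) * (c 1 - a 1) - (b 1 - a 1) * (c 0 - a 0)

/-- The in-circle determinant of four points: `orient a b c` times the power of `x` with respect to
the circle `abc`. -/
def incirc (a b c x : Plane) : ℝ :=
  (x 0 ^ 2 + x 1 ^ 2) * orient a b c - (a 0 ^ 2 + a 1 ^ 2) * orient x b c
    - (b 0 ^ 2 + b 1 ^ 2) * orient a x c - (c 0 ^ 2 + c 1 ^ 2) * orient a b x

/-- A circle through the points of `t`; it exists and is unique for three non-collinear points,
and is arbitrary when there is none. -/
noncomputable def circ (t : Finset Plane) : Sphere Plane :=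
  Classical.epsilon fun S => ∀ v ∈ t, v ∈ S

/-- The power of `x` with respect to the circle through `t`. -/
noncomputable def pow (t : Finset Plane) (x : Plane) : ℝ := (circ t).power x

theorem plane_ext {x y : Plane} (h0 : x 0 = y 0) (h1 : x 1 = y 1) : x = y := by
  ext i; fin_cases i <;> assumption

theorem orient_rotate (a b c : Plane) : orient b c a = orient a b c := by
  unfold orient; ring

theorem orient_swap (a b c : Plane) : orient b a c = -orient a b c := by
  unfold orient; ring

theorem orient_swap_right (a b c : Plane) : orient a c b = -orient a b c := by
  unfold orient; ring

theorem orient_self_left (a b : Plane) : orient a a b = 0 := by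
  unfold orient; ring

theorem orient_self_right (a b : Plane) : orient a b b = 0 := by
  unfold orient; ring

theorem orient_self_mid (a b : Plane) : orient a b a = 0 := by
  unfold orient; ring

theorem power_eq (S : Sphere Plane) (x : Plane) :
    S.power x = (x 0 - S.center 0) ^ 2 + (x 1 - S.center 1) ^ 2 - S.radius ^ 2 := by
  rw [Sphere.power, EuclideanSpace.dist_eq, Real.sq_sqrt (by positivity)]
  simp [Fin.sum_univ_two, Real.dist_eq, sq_abs]

theorem power_eq_zero {S : Sphere Plane} {x : Plane} (h : x ∈ S) : S.power x = 0 := by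
  rw [Sphere.power, mem_sphere.1 h, sub_self]

theorem orient_mul_power (S : Sphere Plane) (a b c x : Plane) :
    orient a b c * S.power x = incirc a b c x + S.power a * orient x b c
      + S.power b * orient a x c + S.power c * orient a b x := by
  simp only [power_eq, incirc, orient]; ring

theorem orient_eq_zero_of_collinear {a b c : Plane} (h : Collinear ℝ {a, b, c}) :
    orient a b c = 0 := by
  obtain ⟨p, v, hv⟩ := (collinear_iff_exists_forall_eq_smul_vadd _).1 h
  obtain ⟨r, rfl⟩ := hv a (by simp)
  obtain ⟨s, rfl⟩ := hv b (by simp)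
  obtain ⟨t, rfl⟩ := hv c (by simp)
  simp [orient]; ring

theorem collinear_of_orient_eq_zero {a b c : Plane} (h : orient a b c = 0) :
    Collinear ℝ {a, b, c} := by
  by_cases hab : a = b
  · subst hab; simpa using collinear_pair ℝ a c
  have hpos : (b 0 - a 0) ^ 2 + (b 1 - a 1) ^ 2 ≠ 0 := by
    intro h0
    apply hab
    apply plane_ext <;> nlinarith [sq_nonneg (b 0 - a 0), sq_nonneg (b 1 - a 1)]
  rw [collinear_iff_of_mem (p₀ := a) (by simp)]
  refine ⟨b - a, ?_⟩
  simp only [Set.mem_insert_iff, Set.mem_singleton_iff, forall_eq_or_imp, forall_eq, vadd_eq_add]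
  refine ⟨⟨0, by simp⟩, ⟨1, by simp⟩, ⟨((b 0 - a 0) * (c 0 - a 0) + (b 1 - a 1) * (c 1 - a 1)) /
    ((b 0 - a 0) ^ 2 + (b 1 - a 1) ^ 2), ?_⟩⟩
  unfold orient at h
  apply plane_ext
  · simp only [PiLp.add_apply, PiLp.smul_apply, PiLp.sub_apply, smul_eq_mul]
    field_simp
    linear_combination (-(b 1 - a 1)) * h
  · simp only [PiLp.add_apply, PiLp.smul_apply, PiLp.sub_apply, smul_eq_mul]
    field_simp
    linear_combination (b 0 - a 0) * h

theorem affineIndependent_of_orient {a b c : Plane} (h : orient a b c ≠ 0) :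
    AffineIndependent ℝ ![a, b, c] :=
  affineIndependent_iff_not_collinear_set.2 fun hc => h (orient_eq_zero_of_collinear hc)

theorem exists_sphere {a b c : Plane} (h : orient a b c ≠ 0) :
    ∃ S : Sphere Plane, ∀ v ∈ ({a, b, c} : Finset Plane), v ∈ S := by
  let s : Affine.Simplex ℝ Plane 2 := ⟨![a, b, c], affineIndependent_of_orient h⟩
  refine ⟨s.circumsphere, ?_⟩
  simp only [Finset.mem_insert, Finset.mem_singleton, forall_eq_or_imp, forall_eq]
  exact ⟨s.mem_circumsphere 0, s.mem_circumsphere 1, s.mem_circumsphere 2⟩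

theorem mem_circ {a b c : Plane} (h : orient a b c ≠ 0) {v : Plane}
    (hv : v ∈ ({a, b, c} : Finset Plane)) : v ∈ circ {a, b, c} :=
  Classical.epsilon_spec (p := fun S : Sphere Plane => ∀ v ∈ ({a, b, c} : Finset Plane), v ∈ S)
    (exists_sphere h) v hv

theorem orient_mul_pow {a b c : Plane} (h : orient a b c ≠ 0) (x : Plane) :
    orient a b c * pow {a, b, c} x = incirc a b c x := by
  rw [pow, orient_mul_power, power_eq_zero (mem_circ h (by simp)),
    power_eq_zero (mem_circ h (by simp)), power_eq_zero (mem_circ h (by simp))]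
  ring

theorem power_eq_pow {a b c : Plane} (h : orient a b c ≠ 0) {S : Sphere Plane}
    (hS : ∀ v ∈ ({a, b, c} : Finset Plane), v ∈ S) (x : Plane) :
    S.power x = pow {a, b, c} x := by
  apply mul_left_cancel₀ h
  rw [orient_mul_pow h, orient_mul_power, power_eq_zero (hS a (by simp)),
    power_eq_zero (hS b (by simp)), power_eq_zero (hS c (by simp))]
  ring

theorem tri_rotate (a b c : Plane) : ({b, c, a} : Finset Plane) = {a, b, c} := by
  ext; simp; tauto

theorem tri_swap (a b c : Plane) : ({b, a, c} : Finset Plane) = {a, b, c} := by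
  ext; simp; tauto

theorem tri_swap_right (a b c : Plane) : ({a, c, b} : Finset Plane) = {a, b, c} := by
  ext; simp; tauto

/-- Exchanging the last vertex with the test point reverses the sign of the in-circle
determinant. -/
theorem orient_mul_pow_swap {u v x y : Plane} (hx : orient u v x ≠ 0) (hy : orient u v y ≠ 0) :
    orient u v x * pow {u, v, x} y = -(orient u v y * pow {u, v, y} x) := by
  rw [orient_mul_pow hx, orient_mul_pow hy]; unfold incirc orient; ring

theorem pow_neg_iff_of_opposite {u v x y : Plane} (h : orient u v x * orient u v y < 0) :
    pow {u, v, x} y < 0 ↔ pow {u, v, y} x < 0 := by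
  have hx : orient u v x ≠ 0 := by rintro h0; simp [h0] at h
  have hy : orient u v y ≠ 0 := by rintro h0; simp [h0] at h
  have key := orient_mul_pow_swap hx hy
  rcases lt_or_gt_of_ne hx with h1 | h1
  · have h2 : 0 < orient u v y := by nlinarith
    constructor <;> intro h3 <;> nlinarith [mul_pos_of_neg_of_neg h1 h1]
  · have h2 : orient u v y < 0 := by nlinarith
    constructor <;> intro h3 <;> nlinarith

theorem pow_neg_iff_of_same {u v x y : Plane} (h : 0 < orient u v x * orient u v y) :
    pow {u, v, x} y < 0 ↔ 0 < pow {u, v, y} x := by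
  have hx : orient u v x ≠ 0 := by rintro h0; simp [h0] at h
  have hy : orient u v y ≠ 0 := by rintro h0; simp [h0] at h
  have key := orient_mul_pow_swap hx hy
  rcases lt_or_gt_of_ne hx with h1 | h1
  · have h2 : orient u v y < 0 := by nlinarith
    constructor <;> intro h3 <;> nlinarith
  · have h2 : 0 < orient u v y := by nlinarith
    constructor <;> intro h3 <;> nlinarith

/-- The circles through `u` and `v` form a pencil: the difference of two powers is an affine
function that vanishes on the line `uv`. -/
theorem pow_sub_pow_mul {u v x y : Plane} (hx : orient u v x ≠ 0) (hy : orient u v y ≠ 0)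
    (z : Plane) :
    (pow {u, v, y} z - pow {u, v, x} z) * orient u v y = -pow {u, v, x} y * orient u v z := by
  have h1 := orient_mul_pow hx z
  have h2 := orient_mul_pow hy z
  have h3 := orient_mul_pow hx y
  apply mul_left_cancel₀ hx
  have : orient u v x * incirc u v y z - orient u v y * incirc u v x z
      + incirc u v x y * orient u v z = 0 := by
    unfold incirc orient; ring
  linear_combination (orient u v x) * h2 - orient u v y * h1 + orient u v z * h3 + this

theorem mem_triangle_iff {a b c x : Plane} :
    x ∈ convexHull ℝ ({a, b, c} : Set Plane) ↔ ∃ α β γ : ℝ, 0 ≤ α ∧ 0 ≤ β ∧ 0 ≤ γ ∧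
      α + β + γ = 1 ∧ x = α • a + β • b + γ • c := by
  constructor
  · intro h
    rw [convexHull_insert (by simp), convexHull_pair, mem_convexJoin] at h
    obtain ⟨a', ha', y, ⟨s, t, hs, ht, hst, rfl⟩, ⟨u, v, hu, hv, huv, rfl⟩⟩ := h
    rw [Set.mem_singleton_iff] at ha'
    subst ha'
    refine ⟨u, v * s, v * t, hu, by positivity, by positivity, ?_, ?_⟩
    · rw [add_assoc, ← mul_add, hst, mul_one, huv]
    · rw [smul_add, smul_smul, smul_smul, add_assoc]
  · rintro ⟨α, β, γ, h1, h2, h3, h, rfl⟩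
    have := mem_convexHull_of_exists_fintype (s := ({a, b, c} : Set Plane))
      (x := α • a + β • b + γ • c) ![α, β, γ] ![a, b, c]
      (by intro i; fin_cases i <;> simpa) (by simp [Fin.sum_univ_three, h])
      (by intro i; fin_cases i <;> simp) (by simp [Fin.sum_univ_three])
    exact this

theorem orient_combo (u v a b c : Plane) {α β γ : ℝ} (h : α + β + γ = 1) :
    orient u v (α • a + β • b + γ • c) =
      α * orient u v a + β * orient u v b + γ * orient u v c := by
  obtain rfl : α = 1 - β - γ := by linarith
  simp [orient]; ring

theorem barycentric {a b c : Plane} (h : orient a b c ≠ 0) (x : Plane) :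
    x = (orient b c x / orient a b c) • a + (orient c a x / orient a b c) • b
      + (orient a b x / orient a b c) • c := by
  apply plane_ext
  · simp; field_simp; unfold orient; ring
  · simp; field_simp; unfold orient; ring

theorem barycentric_sum {a b c : Plane} (h : orient a b c ≠ 0) (x : Plane) :
    orient b c x / orient a b c + orient c a x / orient a b c +
      orient a b x / orient a b c = 1 := by
  field_simp; unfold orient; ring

theorem mem_triangle_iff_orient {a b c x : Plane} (h : 0 < orient a b c) :
    x ∈ convexHull ℝ ({a, b, c} : Set Plane) ↔
      0 ≤ orient a b x ∧ 0 ≤ orient b c x ∧ 0 ≤ orient c a x := by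
  constructor
  · rw [mem_triangle_iff]
    rintro ⟨α, β, γ, h1, h2, h3, hs, rfl⟩
    simp only [orient_combo _ _ _ _ _ hs, orient_self_mid, orient_self_right, orient_rotate]
    refine ⟨by positivity, by positivity, by positivity⟩
  · rintro ⟨h1, h2, h3⟩
    rw [mem_triangle_iff]
    exact ⟨_, _, _, by positivity, by positivity, by positivity, barycentric_sum h.ne' x,
      barycentric h.ne' x⟩

theorem orient_eq_zero_of_mem_segment {a b x : Plane}
    (hx : x ∈ convexHull ℝ ({a, b} : Set Plane)) : orient a b x = 0 := by
  have : x ∈ convexHull ℝ ({a, a, b} : Set Plane) := by simpa using hx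
  obtain ⟨α, β, γ, -, -, -, hs, rfl⟩ := mem_triangle_iff.1 this
  simp [orient_combo _ _ _ _ _ hs, orient_self_mid, orient_self_right]

/-! ### Triangles of a point set in general position -/

section

/-- The points of `P` strictly inside the circle through `t`. -/
noncomputable def inner (P t : Finset Plane) : Finset Plane := P.filter fun p => pow t p < 0

/-- The order-`0` triangles: triples of points of `P` with empty circumcircle. -/
noncomputable def emptyTriangles (P : Finset Plane) : Finset (Finset Plane) :=
  (P.powersetCard 3).filter fun t => inner P t = ∅

variable {P s t : Finset Plane} {a b c x p : Plane}
theorem mem_inner : p ∈ inner P t ↔ p ∈ P ∧ pow t p < 0 := by simp [inner]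

theorem mem_emptyTriangles :
    t ∈ emptyTriangles P ↔ (t ⊆ P ∧ t.card = 3) ∧ inner P t = ∅ := by
  simp [emptyTriangles, Finset.mem_powersetCard]

theorem GeneralPosition.orient_ne (hP : GeneralPosition P) (ha : a ∈ P) (hb : b ∈ P) (hc : c ∈ P)
    (hab : a ≠ b) (hac : a ≠ c) (hbc : b ≠ c) : orient a b c ≠ 0 := by
  intro h
  refine hP.not_collinear {a, b, c} ?_ (Finset.card_eq_three.2 ⟨a, b, c, hab, hac, hbc, rfl⟩) ?_
  · simp [Finset.insert_subset_iff, ha, hb, hc]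
  · simpa using collinear_of_orient_eq_zero h

theorem ne_of_orient_ne (h : orient a b c ≠ 0) : a ≠ b ∧ a ≠ c ∧ b ≠ c := by
  refine ⟨?_, ?_, ?_⟩ <;> rintro rfl
  · exact h (orient_self_left _ _)
  · exact h (orient_self_mid _ _)
  · exact h (orient_self_right _ _)

theorem card_triple (h : orient a b c ≠ 0) : ({a, b, c} : Finset Plane).card = 3 := by
  obtain ⟨h1, h2, h3⟩ := ne_of_orient_ne h
  exact Finset.card_eq_three.2 ⟨a, b, c, h1, h2, h3, rfl⟩

theorem triple_subset (ha : a ∈ P) (hb : b ∈ P) (hc : c ∈ P) : ({a, b, c} : Finset Plane) ⊆ P := by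
  simp [Finset.insert_subset_iff, ha, hb, hc]

theorem GeneralPosition.exists_ccw (hP : GeneralPosition P) (ht : t ⊆ P) (h3 : t.card = 3) :
    ∃ a b c, t = {a, b, c} ∧ a ∈ P ∧ b ∈ P ∧ c ∈ P ∧ 0 < orient a b c := by
  obtain ⟨a, b, c, hab, hac, hbc, rfl⟩ := Finset.card_eq_three.1 h3
  have ha : a ∈ P := ht (by simp)
  have hb : b ∈ P := ht (by simp)
  have hc : c ∈ P := ht (by simp)
  rcases lt_or_gt_of_ne (hP.orient_ne ha hb hc hab hac hbc) with h | h
  · refine ⟨b, a, c, (tri_swap a b c).symm, hb, ha, hc, ?_⟩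
    rw [orient_swap]; linarith
  · exact ⟨a, b, c, rfl, ha, hb, hc, h⟩

theorem GeneralPosition.mem_circ (hP : GeneralPosition P) (ht : t ⊆ P) (h3 : t.card = 3)
    {v : Plane} (hv : v ∈ t) : v ∈ circ t := by
  obtain ⟨a, b, c, rfl, -, -, -, h⟩ := hP.exists_ccw ht h3
  exact DelaunayOrder.mem_circ h.ne' hv

theorem GeneralPosition.pow_self (hP : GeneralPosition P) (ht : t ⊆ P) (h3 : t.card = 3)
    {v : Plane} (hv : v ∈ t) : pow t v = 0 :=
  power_eq_zero (hP.mem_circ ht h3 hv)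

theorem GeneralPosition.radius_nonneg (hP : GeneralPosition P) (ht : t ⊆ P) (h3 : t.card = 3) :
    0 ≤ (circ t).radius := by
  obtain ⟨a, b, c, rfl, -, -, -, h⟩ := hP.exists_ccw ht h3
  exact (circ {a, b, c}).radius_nonneg_of_mem (DelaunayOrder.mem_circ h.ne' (v := a) (by simp))

theorem GeneralPosition.pow_ne_zero (hP : GeneralPosition P) (ht : t ⊆ P) (h3 : t.card = 3)
    (hp : p ∈ P) (hpt : p ∉ t) : pow t p ≠ 0 := by
  intro h
  refine hP.not_cocircular (insert p t) (Finset.insert_subset hp ht) (by simp [hpt, h3])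
    ⟨(circ t).center, (circ t).radius, ?_⟩
  intro q hq
  rcases Finset.mem_insert.1 (Finset.mem_coe.1 hq) with rfl | hq
  · rw [pow, Sphere.power, sub_eq_zero] at h
    exact (pow_left_inj₀ dist_nonneg (hP.radius_nonneg ht h3) two_ne_zero).1 h
  · exact mem_sphere.1 (hP.mem_circ ht h3 hq)

theorem GeneralPosition.pow_pos (hP : GeneralPosition P) (ht : t ⊆ P) (h3 : t.card = 3)
    (hp : p ∈ P) (hpt : p ∉ t) (hi : p ∉ inner P t) : 0 < pow t p :=
  lt_of_le_of_ne (not_lt.1 fun h => hi (mem_inner.2 ⟨hp, h⟩)) (hP.pow_ne_zero ht h3 hp hpt).symm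

theorem GeneralPosition.notMem_of_mem_inner (hP : GeneralPosition P) (ht : t ⊆ P)
    (h3 : t.card = 3) (hi : p ∈ inner P t) : p ∉ t := fun h => by
  have := (mem_inner.1 hi).2
  rw [hP.pow_self ht h3 h] at this
  exact lt_irrefl _ this

theorem GeneralPosition.isOrderTriangle_iff (hP : GeneralPosition P) (ht : t ⊆ P)
    (h3 : t.card = 3) (k : ℕ) : IsOrderTriangle k P t ↔ (inner P t).card ≤ k := by
  have key : ∀ S : Sphere Plane, (∀ v ∈ t, v ∈ S) →
      {p : Plane | p ∈ P ∧ dist p S.center < S.radius} = (inner P t : Set Plane) := by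
    intro S hS
    obtain ⟨a, b, c, rfl, -, -, -, h⟩ := hP.exists_ccw ht h3
    have hr : 0 ≤ S.radius := S.radius_nonneg_of_mem (hS a (by simp))
    ext q
    simp only [Set.mem_ofPred_eq, Finset.mem_coe, mem_inner]
    rw [← power_eq_pow h.ne' hS, Sphere.power, sub_neg, pow_lt_pow_iff_left₀ dist_nonneg hr
      two_ne_zero]
  constructor
  · rintro ⟨S, hS, h⟩
    rw [key S hS, Set.encard_coe_eq_coe_finsetCard] at h
    exact_mod_cast h
  · intro h
    refine ⟨circ t, fun v hv => hP.mem_circ ht h3 hv, ?_⟩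
    rw [key _ fun v hv => hP.mem_circ ht h3 hv, Set.encard_coe_eq_coe_finsetCard]
    exact_mod_cast h

/-- The difference of the powers with respect to two circles is an affine function. -/
theorem pow_sub_pow_combo (s t A : Finset Plane) {w : Plane → ℝ} (hw : ∑ v ∈ A, w v = 1)
    (hx : ∑ v ∈ A, w v • v = x) :
    pow s x - pow t x = ∑ v ∈ A, w v * (pow s v - pow t v) := by
  obtain ⟨α, β, γ, h⟩ : ∃ α β γ : ℝ, ∀ z, pow s z - pow t z = α * z 0 + β * z 1 + γ := by
    refine ⟨2 * ((circ t).center 0 - (circ s).center 0),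
      2 * ((circ t).center 1 - (circ s).center 1),
      (circ s).center 0 ^ 2 + (circ s).center 1 ^ 2 - (circ s).radius ^ 2 -
      ((circ t).center 0 ^ 2 + (circ t).center 1 ^ 2 - (circ t).radius ^ 2), fun z => ?_⟩
    simp only [pow, power_eq]; ring
  simp only [h]
  have h0 : x 0 = ∑ v ∈ A, w v * v 0 := by rw [← hx]; simp
  have h1 : x 1 = ∑ v ∈ A, w v * v 1 := by rw [← hx]; simp
  have hγ : γ = ∑ v ∈ A, γ * w v := by rw [← Finset.mul_sum, hw, mul_one]
  conv_lhs => rw [h0, h1, hγ, Finset.mul_sum, Finset.mul_sum, ← Finset.sum_add_distrib,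
    ← Finset.sum_add_distrib]
  exact Finset.sum_congr rfl fun v _ => by ring

theorem GeneralPosition.pow_nonpos_of_mem (hP : GeneralPosition P) (ht : t ⊆ P) (h3 : t.card = 3)
    (hx : x ∈ convexHull ℝ (t : Set Plane)) : pow t x ≤ 0 := by
  have h : x ∈ Metric.closedBall (circ t).center (circ t).radius :=
    convexHull_min (fun v hv => (mem_sphere.1 (hP.mem_circ ht h3 hv)).le)
      (convex_closedBall _ _) hx
  rw [pow, Sphere.power, sub_nonpos]
  exact pow_le_pow_left₀ dist_nonneg h 2

theorem GeneralPosition.mem_of_mem_emptyTriangle (hP : GeneralPosition P)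
    (ht : t ∈ emptyTriangles P) (hp : p ∈ P) (hpt : p ∈ convexHull ℝ (t : Set Plane)) : p ∈ t := by
  obtain ⟨⟨h1, h3⟩, h0⟩ := mem_emptyTriangles.1 ht
  by_contra h
  have := hP.pow_pos h1 h3 hp h (by simp [h0])
  linarith [hP.pow_nonpos_of_mem h1 h3 hpt]

/-- Empty triangles meet face to face. At a common point the powers with respect to both circles
agree, so only common vertices can carry weight. -/
theorem GeneralPosition.emptyTriangle_face (hP : GeneralPosition P) (hs : s ∈ emptyTriangles P)
    (ht : t ∈ emptyTriangles P) {A : Finset Plane} (hA : A ⊆ s)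
    (hxA : x ∈ convexHull ℝ (A : Set Plane)) (hxt : x ∈ convexHull ℝ (t : Set Plane)) :
    x ∈ convexHull ℝ ((A ∩ t : Finset Plane) : Set Plane) := by
  obtain ⟨⟨s1, s3⟩, s0⟩ := mem_emptyTriangles.1 hs
  obtain ⟨⟨t1, t3⟩, t0⟩ := mem_emptyTriangles.1 ht
  obtain ⟨w, hw0, hw1, hwx⟩ := Finset.mem_convexHull'.1 hxA
  obtain ⟨u, hu0, hu1, hux⟩ := Finset.mem_convexHull'.1 hxt
  have out : ∀ r : Finset Plane, inner P r = ∅ → ∀ v ∈ P, 0 ≤ pow r v := fun r hr v hv =>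
    not_lt.1 fun h => by
      have : v ∈ inner P r := mem_inner.2 ⟨hv, h⟩
      simp [hr] at this
  have e1 : pow t x - pow s x = ∑ v ∈ A, w v * pow t v := by
    rw [pow_sub_pow_combo t s A hw1 hwx]
    exact Finset.sum_congr rfl fun v hv => by rw [hP.pow_self s1 s3 (hA hv), sub_zero]
  have e2 : pow s x - pow t x = ∑ v ∈ t, u v * pow s v := by
    rw [pow_sub_pow_combo s t t hu1 hux]
    exact Finset.sum_congr rfl fun v hv => by rw [hP.pow_self t1 t3 hv, sub_zero]
  have n1 : ∀ v ∈ A, 0 ≤ w v * pow t v := fun v hv =>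
    mul_nonneg (hw0 v hv) (out t t0 v (s1 (hA hv)))
  have n2 : 0 ≤ ∑ v ∈ t, u v * pow s v :=
    Finset.sum_nonneg fun v hv => mul_nonneg (hu0 v hv) (out s s0 v (t1 hv))
  have z : ∑ v ∈ A, w v * pow t v = 0 :=
    le_antisymm (by linarith) (Finset.sum_nonneg n1)
  have wz : ∀ v ∈ A, v ∉ A ∩ t → w v = 0 := by
    intro v hv hvt
    have hvt' : v ∉ t := fun h => hvt (Finset.mem_inter.2 ⟨hv, h⟩)
    have := (Finset.sum_eq_zero_iff_of_nonneg n1).1 z v hv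
    exact (mul_eq_zero.1 this).resolve_right (hP.pow_ne_zero t1 t3 (s1 (hA hv)) hvt')
  refine Finset.mem_convexHull'.2 ⟨w, fun v hv => hw0 v (Finset.mem_inter.1 hv).1, ?_, ?_⟩
  · rw [Finset.sum_subset Finset.inter_subset_left wz, hw1]
  · rw [Finset.sum_subset Finset.inter_subset_left fun v hv hvt => by rw [wz v hv hvt, zero_smul],
      hwx]

/-- A face of a triangle that contains a point of its interior is the whole triangle. -/
theorem subset_of_mem_convexHull_inter (h1 : orient a b x ≠ 0) (h2 : orient b c x ≠ 0)
    (h3 : orient c a x ≠ 0)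
    (hx : x ∈ convexHull ℝ ((({a, b, c} ∩ t : Finset Plane)) : Set Plane)) :
    ({a, b, c} : Finset Plane) ⊆ t := by
  have aux : ∀ u v : Plane, orient u v x ≠ 0 → ¬ ({a, b, c} ∩ t : Finset Plane) ⊆ {u, v} := by
    intro u v huv hsub
    refine huv (orient_eq_zero_of_mem_segment (convexHull_mono (fun v hv => ?_) hx))
    simpa using hsub hv
  by_contra hnot
  simp only [Finset.insert_subset_iff, Finset.singleton_subset_iff, not_and_or] at hnot
  rcases hnot with h | h | h
  · refine aux b c h2 fun v hv => ?_
    simp only [Finset.mem_inter, Finset.mem_insert, Finset.mem_singleton] at hv ⊢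
    rcases hv with ⟨rfl | h' | h', h''⟩
    · exact absurd h'' h
    all_goals simp [h']
  · refine aux c a h3 fun v hv => ?_
    simp only [Finset.mem_inter, Finset.mem_insert, Finset.mem_singleton] at hv ⊢
    rcases hv with ⟨h' | rfl | h', h''⟩
    · simp [h']
    · exact absurd h'' h
    · simp [h']
  · refine aux a b h1 fun v hv => ?_
    simp only [Finset.mem_inter, Finset.mem_insert, Finset.mem_singleton] at hv ⊢
    rcases hv with ⟨h' | h' | rfl, h''⟩
    · simp [h']
    · simp [h']
    · exact absurd h'' h

/-- Two empty triangles that overlap at an interior point of the first coincide. -/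
theorem GeneralPosition.emptyTriangle_eq (hP : GeneralPosition P)
    (hs : {a, b, c} ∈ emptyTriangles P)
    (ht : t ∈ emptyTriangles P) (h1 : 0 < orient a b x) (h2 : 0 < orient b c x)
    (h3 : 0 < orient c a x) (habc : 0 < orient a b c) (hxt : x ∈ convexHull ℝ (t : Set Plane)) :
    t = {a, b, c} := by
  have hx : x ∈ convexHull ℝ ((({a, b, c} : Finset Plane)) : Set Plane) := by
    simpa using (mem_triangle_iff_orient habc).2 ⟨h1.le, h2.le, h3.le⟩
  have := subset_of_mem_convexHull_inter h1.ne' h2.ne' h3.ne'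
    (hP.emptyTriangle_face hs ht subset_rfl hx hxt)
  exact (Finset.eq_of_subset_of_card_le this
    (by rw [(mem_emptyTriangles.1 ht).1.2, card_triple habc.ne'])).symm

end

/-! ### Flippable quadrilaterals -/

section

variable {P t : Finset Plane} {a b c d x y p u v a' b' c' d' : Plane}
/-- A convex quadrilateral `abcd` of points of `P`, in counterclockwise order, whose Delaunay
diagonal is `ac` and whose other diagonal `bd` cuts it into two triangles `abd` and `bcd` of order
exactly `1`: the circle of each contains only the fourth vertex. -/
structure FlipQuad (P : Finset Plane) (a b c d : Plane) : Prop where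
  mem_a : a ∈ P
  mem_b : b ∈ P
  mem_c : c ∈ P
  mem_d : d ∈ P
  abc : 0 < orient a b c
  bcd : 0 < orient b c d
  cda : 0 < orient c d a
  dab : 0 < orient d a b
  neg : pow {a, b, d} c < 0
  inner_abd : inner P {a, b, d} ⊆ {c}
  inner_bcd : inner P {b, c, d} ⊆ {a}

/-- The cone opposite to a triangle at a vertex lies outside the circumcircle. -/
theorem pow_nonneg_of_wedge (h : 0 < orient a b c) (h1 : orient a b x ≤ 0)
    (h2 : orient b c x ≤ 0) : 0 ≤ pow {a, b, c} x := by
  have key := orient_mul_pow h.ne' x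
  have e : orient a b c * incirc a b c x =
      -orient b c x * orient a b c * ((a 0 - b 0) ^ 2 + (a 1 - b 1) ^ 2)
      + -orient a b x * orient a b c * ((c 0 - b 0) ^ 2 + (c 1 - b 1) ^ 2)
      + (orient b c x * (a 0 - b 0) + orient a b x * (c 0 - b 0)) ^ 2
      + (orient b c x * (a 1 - b 1) + orient a b x * (c 1 - b 1)) ^ 2 := by
    unfold incirc orient; ring
  have h3 : 0 ≤ orient a b c * incirc a b c x := by
    rw [e]
    have := neg_nonneg.2 h1
    have := neg_nonneg.2 h2
    positivity
  rw [← key] at h3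
  exact nonneg_of_mul_nonneg_right (nonneg_of_mul_nonneg_right h3 h) h

theorem pow_neg_opposite (bcd : 0 < orient b c d) (dab : 0 < orient d a b)
    (neg : pow {a, b, d} c < 0) : pow {b, c, d} a < 0 := by
  have dbc : orient b d c < 0 := by rw [orient_swap_right]; linarith
  have dba : 0 < orient b d a := by rw [orient_rotate, orient_rotate d a b]; exact dab
  have := (pow_neg_iff_of_opposite (u := b) (v := d) (x := a) (y := c) (by nlinarith)).1
    (by rwa [tri_rotate a b d])
  rwa [tri_swap_right] at this

/-- In a convex quadrilateral `abcd` with `c` inside the circle `abd`, the disc of `abc` is covered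
by the discs of `abd` and `bcd`. -/
theorem pow_neg_of_convex_quad (abc : 0 < orient a b c) (bcd : 0 < orient b c d)
    (dab : 0 < orient d a b) (neg : pow {a, b, d} c < 0)
    (hx : pow {a, b, c} x < 0) : pow {a, b, d} x < 0 ∨ pow {b, c, d} x < 0 := by
  have abd : 0 < orient a b d := by rwa [orient_rotate d a b]
  have bca : 0 < orient b c a := by rwa [orient_rotate]
  have neg' := pow_neg_opposite bcd dab neg
  rcases le_or_gt 0 (orient a b x) with h1 | h1
  · left
    have := pow_sub_pow_mul abd.ne' abc.ne' x
    have h2 : 0 ≤ -pow {a, b, d} c * orient a b x := mul_nonneg (by linarith) h1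
    rw [← this] at h2
    linarith [nonneg_of_mul_nonneg_left h2 abc]
  rcases le_or_gt 0 (orient b c x) with h3 | h3
  · right
    have := pow_sub_pow_mul bcd.ne' bca.ne' x
    have h2 : 0 ≤ -pow {b, c, d} a * orient b c x := mul_nonneg (by linarith) h3
    rw [← this, tri_rotate a b c] at h2
    linarith [nonneg_of_mul_nonneg_left h2 bca]
  · linarith [pow_nonneg_of_wedge abc h1.le h3.le]

namespace FlipQuad

theorem neg' (h : FlipQuad P a b c d) : pow {b, c, d} a < 0 :=
  pow_neg_opposite h.bcd h.dab h.neg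

theorem rotate (h : FlipQuad P a b c d) : FlipQuad P c d a b where
  mem_a := h.mem_c
  mem_b := h.mem_d
  mem_c := h.mem_a
  mem_d := h.mem_b
  abc := h.cda
  bcd := h.dab
  cda := h.abc
  dab := h.bcd
  neg := by rw [tri_rotate b c d]; exact h.neg'
  inner_abd := by rw [tri_rotate b c d]; exact h.inner_bcd
  inner_bcd := by rw [← tri_rotate d a b]; exact h.inner_abd

theorem inner_abd_eq (h : FlipQuad P a b c d) : inner P {a, b, d} = {c} :=
  Finset.Subset.antisymm h.inner_abd (by simpa [mem_inner] using ⟨h.mem_c, h.neg⟩)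

theorem inner_bcd_eq (h : FlipQuad P a b c d) : inner P {b, c, d} = {a} :=
  Finset.Subset.antisymm h.inner_bcd (by simpa [mem_inner] using ⟨h.mem_a, h.neg'⟩)

theorem abd (h : FlipQuad P a b c d) : 0 < orient a b d := by
  rw [orient_rotate d a b]; exact h.dab

theorem acd (h : FlipQuad P a b c d) : 0 < orient a c d := by
  rw [← orient_rotate a c d]; exact h.cda

theorem abc_mem (hP : GeneralPosition P) (h : FlipQuad P a b c d) :
    {a, b, c} ∈ emptyTriangles P := by
  refine mem_emptyTriangles.2 ⟨⟨triple_subset h.mem_a h.mem_b h.mem_c, card_triple h.abc.ne'⟩, ?_⟩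
  refine Finset.eq_empty_of_forall_notMem fun q hq => ?_
  have hn := hP.notMem_of_mem_inner (triple_subset h.mem_a h.mem_b h.mem_c)
    (card_triple h.abc.ne') hq
  obtain ⟨hqP, hq⟩ := mem_inner.1 hq
  simp only [Finset.mem_insert, Finset.mem_singleton, not_or] at hn
  rcases pow_neg_of_convex_quad h.abc h.bcd h.dab h.neg hq with h1 | h1
  · exact hn.2.2 (by simpa using h.inner_abd (mem_inner.2 ⟨hqP, h1⟩))
  · exact hn.1 (by simpa using h.inner_bcd (mem_inner.2 ⟨hqP, h1⟩))

theorem acd_mem (hP : GeneralPosition P) (h : FlipQuad P a b c d) :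
    {a, c, d} ∈ emptyTriangles P := by
  rw [← tri_rotate a c d]; exact h.rotate.abc_mem hP

theorem subset (h : FlipQuad P a b c d) : ({a, b, c, d} : Finset Plane) ⊆ P := by
  simp [Finset.insert_subset_iff, h.mem_a, h.mem_b, h.mem_c, h.mem_d]

theorem card_eq (h : FlipQuad P a b c d) : ({a, b, c, d} : Finset Plane).card = 4 := by
  obtain ⟨h1, h2, h3⟩ := ne_of_orient_ne h.abc.ne'
  obtain ⟨h4, h5, h6⟩ := ne_of_orient_ne h.bcd.ne'
  obtain ⟨h7, h8, h9⟩ := ne_of_orient_ne h.dab.ne'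
  rw [Finset.card_insert_of_notMem (by simp [h1, h2, h7.symm]), card_triple h.bcd.ne']

end FlipQuad

theorem triple_of_subset_quad (ht : t ⊆ ({a, b, c, d} : Finset Plane)) (h3 : t.card = 3)
    (h4 : ({a, b, c, d} : Finset Plane).card = 4) :
    t = {a, b, c} ∨ t = {a, b, d} ∨ t = {a, c, d} ∨ t = {b, c, d} := by
  have key : ∀ w x y z : Plane, ({a, b, c, d} : Finset Plane) = {w, x, y, z} → w ∉ t →
      t = {x, y, z} := by
    intro w x y z h hw
    refine Finset.eq_of_subset_of_card_le (fun v hv => ?_) (h3 ▸ Finset.card_le_three)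
    have := ht hv
    rw [h, Finset.mem_insert] at this
    exact this.resolve_left fun e => hw (e ▸ hv)
  have : ¬ ({a, b, c, d} : Finset Plane) ⊆ t := fun h => by
    have := Finset.card_le_card h
    omega
  simp only [Finset.insert_subset_iff, Finset.singleton_subset_iff, not_and_or] at this
  rcases this with h | h | h | h
  · exact Or.inr (Or.inr (Or.inr (key a b c d rfl h)))
  · exact Or.inr (Or.inr (Or.inl (key b a c d (by ext; simp; tauto) h)))
  · exact Or.inr (Or.inl (key c a b d (by ext; simp; tauto) h))
  · exact Or.inl (key d a b c (by ext; simp; tauto) h)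

namespace FlipQuad

theorem eq_of_inner_eq_empty (h : FlipQuad P a b c d) (ht : t ⊆ {a, b, c, d}) (h3 : t.card = 3)
    (h0 : inner P t = ∅) : t = {a, b, c} ∨ t = {a, c, d} := by
  rcases triple_of_subset_quad ht h3 h.card_eq with rfl | rfl | rfl | rfl
  · exact Or.inl rfl
  · simp [h.inner_abd_eq] at h0
  · exact Or.inr rfl
  · simp [h.inner_bcd_eq] at h0

theorem eq_of_inner_ne_empty (hP : GeneralPosition P) (h : FlipQuad P a b c d)
    (ht : t ⊆ {a, b, c, d}) (h3 : t.card = 3) (h0 : inner P t ≠ ∅) :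
    t = {a, b, d} ∨ t = {b, c, d} := by
  rcases triple_of_subset_quad ht h3 h.card_eq with rfl | rfl | rfl | rfl
  · exact absurd (mem_emptyTriangles.1 (h.abc_mem hP)).2 h0
  · exact Or.inl rfl
  · exact absurd (mem_emptyTriangles.1 (h.acd_mem hP)).2 h0
  · exact Or.inr rfl

end FlipQuad

/-- Among two triangles on the same side of a common edge, one has the apex of the other inside its
circle. -/
theorem GeneralPosition.eq_or_mem_inner (hP : GeneralPosition P) (hu : u ∈ P) (hv : v ∈ P)
    (hx : x ∈ P) (hy : y ∈ P) (h : 0 < orient u v x * orient u v y) :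
    x = y ∨ y ∈ inner P {u, v, x} ∨ x ∈ inner P {u, v, y} := by
  by_contra! hcon
  obtain ⟨hxy, h1, h2⟩ := hcon
  have hx0 : orient u v x ≠ 0 := by rintro h0; simp [h0] at h
  have hy0 : orient u v y ≠ 0 := by rintro h0; simp [h0] at h
  obtain ⟨-, hux, hvx⟩ := ne_of_orient_ne hx0
  obtain ⟨-, huy, hvy⟩ := ne_of_orient_ne hy0
  have p1 := hP.pow_pos (triple_subset hu hv hx) (card_triple hx0) hy
    (by simp [huy.symm, hvy.symm, hxy.symm]) h1
  have p2 := hP.pow_pos (triple_subset hu hv hy) (card_triple hy0) hx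
    (by simp [hux.symm, hvx.symm, hxy]) h2
  linarith [(pow_neg_iff_of_same h).2 p2]

/-- Two flippable quadrilaterals that contain the empty triangle `abc` have the same side of it as
their Delaunay diagonal. Otherwise the first-order triangles `abd` and `abd'` lie on the same side
of `ab`, and only `c` is inside their circles, so `d = d'`; but then `acd` would be both empty and
not. -/
theorem FlipQuad.not_rotated (hP : GeneralPosition P) (h : FlipQuad P a b c d)
    (h' : FlipQuad P c a b d') : False := by
  rcases hP.eq_or_mem_inner h.mem_a h.mem_b h.mem_d h'.mem_d (mul_pos h.abd h'.bcd)
    with rfl | h1 | h1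
  · have h1 := (mem_emptyTriangles.1 (h.acd_mem hP)).2
    rw [← tri_swap, h'.inner_abd_eq] at h1
    simp at h1
  · have h2 := Finset.mem_singleton.1 (h.inner_abd h1)
    exact (ne_of_orient_ne h'.dab.ne').1 h2
  · have h2 := Finset.mem_singleton.1 (h'.inner_bcd h1)
    exact (ne_of_orient_ne h.cda.ne').1 h2.symm

theorem FlipQuad.quad_eq_of_abc (hP : GeneralPosition P) (h : FlipQuad P a b c d)
    (h' : FlipQuad P a' b' c' d') (he : ({a, b, c} : Finset Plane) = {a', b', c'}) :
    ({a, b, c, d} : Finset Plane) = {a', b', c', d'} := by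
  obtain ⟨hab, hac, hbc⟩ := ne_of_orient_ne h'.abc.ne'
  have ha : a' = a ∨ a' = b ∨ a' = c := by
    simpa using (he ▸ (by simp) : a' ∈ ({a, b, c} : Finset Plane))
  have hb : b' = a ∨ b' = b ∨ b' = c := by
    simpa using (he ▸ (by simp) : b' ∈ ({a, b, c} : Finset Plane))
  have hc : c' = a ∨ c' = b ∨ c' = c := by
    simpa using (he ▸ (by simp) : c' ∈ ({a, b, c} : Finset Plane))
  have o := h.abc
  have o' := h'.abc
  have odd : ∀ {x y z : Plane}, 0 < orient x y z → 0 < orient y x z → False := by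
    intro x y z h1 h2
    rw [orient_swap] at h2
    linarith
  rcases ha with rfl | rfl | rfl <;> rcases hb with rfl | rfl | rfl <;>
    rcases hc with rfl | rfl | rfl <;> first
      | exact absurd rfl hab
      | exact absurd rfl hac
      | exact absurd rfl hbc
      | skip
  · rcases hP.eq_or_mem_inner h.mem_a h.mem_c h.mem_d h'.mem_d (mul_pos h.acd h'.acd)
      with rfl | h1 | h1
    · rfl
    · simp [(mem_emptyTriangles.1 (h.acd_mem hP)).2] at h1
    · simp [(mem_emptyTriangles.1 (h'.acd_mem hP)).2] at h1
  · exact (odd o (by rwa [orient_rotate b' c' a', orient_rotate a' b' c'])).elim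
  · exact (odd o o').elim
  · exact (h'.not_rotated hP h).elim
  · exact (h.not_rotated hP h').elim
  · exact (odd o (by rwa [orient_rotate a' b' c'])).elim

/-- A triangle with empty circumcircle lies in at most one flippable quadrilateral. -/
theorem FlipQuad.quad_eq (hP : GeneralPosition P) (h : FlipQuad P a b c d)
    (h' : FlipQuad P a' b' c' d') (ht : t ∈ emptyTriangles P) (h1 : t ⊆ {a, b, c, d})
    (h2 : t ⊆ {a', b', c', d'}) : ({a, b, c, d} : Finset Plane) = {a', b', c', d'} := by
  obtain ⟨⟨-, h3⟩, h0⟩ := mem_emptyTriangles.1 ht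
  have rot : ∀ a b c d : Plane, ({c, d, a, b} : Finset Plane) = {a, b, c, d} := by
    intro a b c d; ext; simp; tauto
  rcases h.eq_of_inner_eq_empty h1 h3 h0 with rfl | rfl <;>
    rcases h'.eq_of_inner_eq_empty h2 h3 h0 with e | e
  · exact h.quad_eq_of_abc hP h' e
  · rw [← rot a' b' c' d']
    exact h.quad_eq_of_abc hP h'.rotate (by rw [e, ← tri_rotate])
  · rw [← rot a b c d]
    exact h.rotate.quad_eq_of_abc hP h' (by rw [← e, tri_rotate])
  · rw [← rot a b c d, ← rot a' b' c' d']
    exact h.rotate.quad_eq_of_abc hP h'.rotate (by rw [tri_rotate, e, ← tri_rotate])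

/-- A point inside the circumcircle of a triangle but outside the triangle forms a convex
quadrilateral with it. -/
theorem GeneralPosition.exists_convex_quad (hP : GeneralPosition P) (ht : t ⊆ P)
    (h3 : t.card = 3) (hp : p ∈ inner P t) (hpt : p ∉ convexHull ℝ (t : Set Plane)) :
    ∃ a b d, t = {a, b, d} ∧ a ∈ P ∧ b ∈ P ∧ d ∈ P ∧ 0 < orient a b p ∧ 0 < orient b p d ∧
      0 < orient p d a ∧ 0 < orient d a b := by
  have hn := hP.notMem_of_mem_inner ht h3 hp
  obtain ⟨hpP, hneg⟩ := mem_inner.1 hp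
  obtain ⟨x, y, z, rfl, hx, hy, hz, h⟩ := hP.exists_ccw ht h3
  simp only [Finset.mem_insert, Finset.mem_singleton, not_or] at hn
  obtain ⟨h1, h2, h3⟩ := ne_of_orient_ne h.ne'
  have hyzx : 0 < orient y z x := by rwa [orient_rotate]
  have hzxy : 0 < orient z x y := by rwa [orient_rotate]
  have o1 := hP.orient_ne hx hy hpP h1 (Ne.symm hn.1) (Ne.symm hn.2.1)
  have o2 := hP.orient_ne hy hz hpP h3 (Ne.symm hn.2.1) (Ne.symm hn.2.2)
  have o3 := hP.orient_ne hz hx hpP h2.symm (Ne.symm hn.2.2) (Ne.symm hn.1)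
  have w1 : ¬ (orient x y p ≤ 0 ∧ orient y z p ≤ 0) := fun hw =>
    absurd (pow_nonneg_of_wedge h hw.1 hw.2) (not_le.2 hneg)
  have w2 : ¬ (orient y z p ≤ 0 ∧ orient z x p ≤ 0) := fun hw =>
    absurd (pow_nonneg_of_wedge hyzx hw.1 hw.2) (not_le.2 (by rwa [tri_rotate]))
  have w3 : ¬ (orient z x p ≤ 0 ∧ orient x y p ≤ 0) := fun hw =>
    absurd (pow_nonneg_of_wedge hzxy hw.1 hw.2) (not_le.2 (by rwa [tri_rotate, tri_rotate]))
  have hin : ¬ (0 ≤ orient x y p ∧ 0 ≤ orient y z p ∧ 0 ≤ orient z x p) := fun hin =>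
    hpt (by simpa using (mem_triangle_iff_orient h).2 hin)
  have aux : ∀ u v : Plane, orient u p v = -orient u v p := fun u v => orient_swap_right _ _ _
  have aux2 : ∀ u v : Plane, orient p u v = orient u v p := fun u v => (orient_rotate _ _ _).symm
  rcases lt_or_gt_of_ne o1 with i1 | i1
  · have i2 : 0 < orient y z p := by by_contra hc; exact w1 ⟨i1.le, not_lt.1 hc⟩
    have i3 : 0 < orient z x p := by by_contra hc; exact w3 ⟨not_lt.1 hc, i1.le⟩
    exact ⟨z, x, y, by rw [tri_rotate, tri_rotate], hz, hx, hy, i3, by rw [aux]; linarith,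
      by rwa [aux2], hyzx⟩
  rcases lt_or_gt_of_ne o2 with i2 | i2
  · have i3 : 0 < orient z x p := by by_contra hc; exact w2 ⟨i2.le, not_lt.1 hc⟩
    exact ⟨x, y, z, rfl, hx, hy, hz, i1, by rw [aux]; linarith, by rwa [aux2], hzxy⟩
  · have i3 : orient z x p < 0 := by by_contra hc; exact hin ⟨i1.le, i2.le, not_lt.1 hc⟩
    exact ⟨y, z, x, (tri_rotate x y z).symm, hy, hz, hx, i2, by rw [aux]; linarith,
      by rwa [aux2], h⟩

end

/-! ### Triangulations and first-order triangles -/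

section

variable {P s t A B : Finset Plane} {T : Finset (Finset Plane)} {a b d x y p q u v : Plane}
theorem convexHull_inter_of_subset {t₁ t₂ : Finset Plane}
    (hs : AffineIndependent ℝ ((↑) : s → Plane)) (h1 : t₁ ⊆ s) (h2 : t₂ ⊆ s) :
    convexHull ℝ (t₁ : Set Plane) ∩ convexHull ℝ (t₂ : Set Plane) =
      convexHull ℝ ((t₁ ∩ t₂ : Finset Plane) : Set Plane) := by
  rw [Finset.coe_inter]
  exact (hs.convexHull_inter h1 h2).symm

/-- Faces of the triangles of a triangulation, not only the triangles, meet face to face. -/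
theorem IsTriangulation.face (hT : IsTriangulation P T) (hs : s ∈ T) (ht : t ∈ T) (hA : A ⊆ s)
    (hB : B ⊆ t) (hxA : x ∈ convexHull ℝ (A : Set Plane))
    (hxB : x ∈ convexHull ℝ (B : Set Plane)) :
    x ∈ convexHull ℝ ((A ∩ B : Finset Plane) : Set Plane) := by
  have h1 : x ∈ convexHull ℝ ((s ∩ t : Finset Plane) : Set Plane) := by
    rw [Finset.coe_inter, ← hT.inter_eq s hs t ht]
    exact ⟨convexHull_mono (by exact_mod_cast hA) hxA, convexHull_mono (by exact_mod_cast hB) hxB⟩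
  have h2 : x ∈ convexHull ℝ ((A ∩ (s ∩ t) : Finset Plane) : Set Plane) := by
    rw [← convexHull_inter_of_subset (hT.affineIndependent s hs) hA Finset.inter_subset_left]
    exact ⟨hxA, h1⟩
  have h3 : x ∈ convexHull ℝ (((A ∩ (s ∩ t)) ∩ B : Finset Plane) : Set Plane) := by
    rw [← convexHull_inter_of_subset (hT.affineIndependent t ht) (fun v hv => by
      simp only [Finset.mem_inter] at hv; exact hv.2.2) hB]
    exact ⟨h2, hxB⟩
  refine convexHull_mono (fun v hv => ?_) h3
  simp only [Finset.coe_inter, Set.mem_inter_iff, Finset.mem_coe] at hv ⊢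
  exact ⟨hv.1.1, hv.2⟩

theorem IsTriangulation.mem_of_mem_convexHull (hT : IsTriangulation P T) (hp : p ∈ P)
    (ht : t ∈ T) (hpt : p ∈ convexHull ℝ (t : Set Plane)) : p ∈ t := by
  obtain ⟨s, hs, hps⟩ := hT.exists_mem p hp
  have := hT.face hs ht (A := {p}) (B := t) (by simpa using hps) subset_rfl (by simp) hpt
  by_contra h
  rw [Finset.singleton_inter_of_notMem h] at this
  simp at this

/-- In a triangulation there is at most one triangle on each side of an edge. -/
theorem IsTriangulation.eq_of_same_side (hT : IsTriangulation P T) (hx : {u, v, x} ∈ T)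
    (hy : {u, v, y} ∈ T) (h : 0 < orient u v x * orient u v y) : x = y := by
  have hx0 : orient u v x ≠ 0 := by rintro h0; simp [h0] at h
  have hy0 : orient u v y ≠ 0 := by rintro h0; simp [h0] at h
  obtain ⟨-, hux, hvx⟩ := ne_of_orient_ne hx0
  by_contra hxy
  obtain ⟨α, β, γ, hs, hγ, hyc⟩ : ∃ α β γ : ℝ, α + β + γ = 1 ∧ 0 < γ ∧
      y = α • u + β • v + γ • x := by
    refine ⟨_, _, _, barycentric_sum hx0 y, ?_, barycentric hx0 y⟩
    rw [div_eq_mul_inv, ← mul_pos_iff_of_pos_left (sq_pos_of_ne_zero hx0)]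
    field_simp
    exact h
  -- a point of the triangle `uvy` so close to the middle of `uv` that it also lies in `uvx`
  set ε : ℝ := 1 / (1 + 2 * |α| + 2 * |β|) with hε
  have hε0 : 0 < ε := by positivity
  have hε1 : ε * (1 + 2 * |α| + 2 * |β|) = 1 := by rw [hε]; field_simp
  have hεα : -(ε * |α|) ≤ ε * α := by nlinarith [neg_abs_le α]
  have hεβ : -(ε * |β|) ≤ ε * β := by nlinarith [neg_abs_le β]
  have pα : 0 ≤ ε * |α| := by positivity
  have pβ : 0 ≤ ε * |β| := by positivity
  have pγ : 0 ≤ ε * γ := by positivity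
  set z : Plane := ((1 - ε) / 2) • u + ((1 - ε) / 2) • v + ε • y with hz
  have zy : z ∈ convexHull ℝ (({u, v, y} : Finset Plane) : Set Plane) := by
    rw [Finset.coe_insert, Finset.coe_insert, Finset.coe_singleton, mem_triangle_iff]
    exact ⟨_, _, _, by linarith, by linarith, hε0.le, by ring, hz⟩
  have zx : z ∈ convexHull ℝ (({u, v, x} : Finset Plane) : Set Plane) := by
    rw [Finset.coe_insert, Finset.coe_insert, Finset.coe_singleton, mem_triangle_iff]
    refine ⟨(1 - ε) / 2 + ε * α, (1 - ε) / 2 + ε * β, ε * γ, by linarith, by linarith,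
      pγ, by linear_combination ε * hs, ?_⟩
    rw [hz, hyc]
    module
  have hmem := hT.face hx hy subset_rfl subset_rfl zx zy
  have h0 : orient u v z = 0 := by
    refine orient_eq_zero_of_mem_segment (convexHull_mono (fun w hw => ?_) hmem)
    simp only [Finset.coe_inter, Finset.coe_insert, Finset.coe_singleton, Set.mem_inter_iff,
      Set.mem_insert_iff, Set.mem_singleton_iff] at hw ⊢
    rcases hw with ⟨h1 | h1 | h1, h2 | h2 | h2⟩
    all_goals first | exact Or.inl h1 | exact Or.inr h1 | exact Or.inl h2 | exact Or.inr h2 | skip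
    exact absurd (h1.symm.trans h2) hxy
  rw [hz, orient_combo _ _ _ _ _ (by ring), orient_self_mid, orient_self_right] at h0
  have : ε * orient u v y ≠ 0 := mul_ne_zero hε0.ne' hy0
  exact this (by linarith)

/-- An edge of a triangulation has a triangle on each side on which there are points of `P`. -/
theorem IsTriangulation.exists_neighbour (hT : IsTriangulation P T) (ht : t ∈ T) (hu : u ∈ t)
    (hv : v ∈ t) (hp : p ∈ P) (hop : orient u v p ≠ 0) :
    ∃ q, {u, v, q} ∈ T ∧ 0 < orient u v p * orient u v q := by
  obtain ⟨huv, -, -⟩ := ne_of_orient_ne hop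
  set m : Plane := (1 / 2 : ℝ) • u + (1 / 2 : ℝ) • v with hm
  have mP : m ∈ convexHull ℝ (P : Set Plane) :=
    convex_convexHull ℝ _ (subset_convexHull ℝ _ (hT.subset t ht hu))
      (subset_convexHull ℝ _ (hT.subset t ht hv)) (by norm_num) (by norm_num) (by norm_num)
  have huv' : m ∈ convexHull ℝ (({u, v} : Finset Plane) : Set Plane) := by
    rw [Finset.coe_insert, Finset.coe_singleton, convexHull_pair]
    exact ⟨1 / 2, 1 / 2, by norm_num, by norm_num, by norm_num, rfl⟩
  -- close to `m`, only the triangles through `m` are met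
  set U : Set Plane := (⋃ s ∈ T.filter fun s : Finset Plane => m ∉ convexHull ℝ (s : Set Plane),
    convexHull ℝ ((s : Finset Plane) : Set Plane))ᶜ with hU
  have Uo : IsOpen U := by
    rw [hU, isOpen_compl_iff]
    exact isClosed_biUnion_finset fun s _ => s.finite_toSet.isClosed_convexHull ℝ
  have mU : m ∈ U := by simp [hU]
  have hcont : Continuous fun ε : ℝ => (1 - ε) • m + ε • p := by fun_prop
  obtain ⟨δ, hδ, hball⟩ := Metric.isOpen_iff.1 (Uo.preimage hcont) 0 (by simpa using mU)
  set ε : ℝ := min (δ / 2) 1 with hε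
  have hε0 : 0 < ε := by positivity
  have hε1 : ε ≤ 1 := min_le_right _ _
  have hzU : (1 - ε) • m + ε • p ∈ U := by
    apply hball
    rw [Metric.mem_ball, Real.dist_eq, sub_zero, abs_of_pos hε0]
    exact (min_le_left _ _).trans_lt (by linarith)
  set z : Plane := (1 - ε) • m + ε • p with hz
  have zP : z ∈ ⋃ s ∈ T, convexHull ℝ ((s : Finset Plane) : Set Plane) := by
    rw [hT.cover]
    exact convex_convexHull ℝ _ mP (subset_convexHull ℝ _ hp) (by linarith) hε0.le (by ring)
  simp only [Set.mem_iUnion, exists_prop] at zP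
  obtain ⟨s, hs, hzs⟩ := zP
  have hms : m ∈ convexHull ℝ (s : Set Plane) := by
    by_contra h
    apply hzU
    simp only [Set.mem_iUnion, exists_prop]
    exact ⟨s, Finset.mem_filter.2 ⟨hs, h⟩, hzs⟩
  have hface := hT.face ht hs (A := {u, v}) (B := s)
    (by simp [Finset.insert_subset_iff, hu, hv]) subset_rfl huv' hms
  have hmid : ∀ w : Plane, w ∈ ({u, v} : Finset Plane) → m ≠ w := by
    intro w hw hmw
    have e : (1 / 2 : ℝ) • (u - v) = 0 := by
      simp only [Finset.mem_insert, Finset.mem_singleton] at hw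
      rcases hw with rfl | rfl
      · rw [← sub_eq_zero, hm] at hmw
        rw [← neg_eq_zero, ← hmw]; module
      · rw [← sub_eq_zero, hm] at hmw
        rw [← hmw]; module
    rw [smul_eq_zero_iff_right (by norm_num), sub_eq_zero] at e
    exact huv e
  have hmem : u ∈ s ∧ v ∈ s := by
    by_contra hcon
    have : ∃ w ∈ ({u, v} : Finset Plane), ({u, v} ∩ s : Finset Plane) ⊆ {w} := by
      rw [not_and_or] at hcon
      rcases hcon with h | h
      · refine ⟨v, by simp, fun w hw => ?_⟩
        simp only [Finset.mem_inter, Finset.mem_insert, Finset.mem_singleton] at hw ⊢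
        exact hw.1.resolve_left fun e => h (e ▸ hw.2)
      · refine ⟨u, by simp, fun w hw => ?_⟩
        simp only [Finset.mem_inter, Finset.mem_insert, Finset.mem_singleton] at hw ⊢
        exact hw.1.resolve_right fun e => h (e ▸ hw.2)
    obtain ⟨w, hw, hsub⟩ := this
    have h1 : m ∈ convexHull ℝ (({w} : Finset Plane) : Set Plane) :=
      convexHull_mono (by exact_mod_cast hsub) hface
    rw [Finset.coe_singleton, convexHull_singleton] at h1
    exact hmid w hw h1
  obtain ⟨q, hq⟩ : ∃ q, s = {u, v, q} := by
    have hc : (s \ {u, v}).card = 1 := by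
      rw [Finset.card_sdiff_of_subset (by simp [Finset.insert_subset_iff, hmem.1, hmem.2]),
        hT.card_eq_three s hs, Finset.card_pair huv]
    obtain ⟨q, hq⟩ := Finset.card_eq_one.1 hc
    refine ⟨q, ?_⟩
    ext w
    have := Finset.ext_iff.1 hq w
    simp only [Finset.mem_sdiff, Finset.mem_insert, Finset.mem_singleton] at this ⊢
    constructor
    · intro hw; tauto
    · rintro (rfl | rfl | h)
      · exact hmem.1
      · exact hmem.2
      · exact (this.2 h).1
  subst hq
  refine ⟨q, hs, ?_⟩
  rw [Finset.coe_insert, Finset.coe_insert, Finset.coe_singleton, mem_triangle_iff] at hzs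
  obtain ⟨α, β, γ, -, -, hγ, hsum, hzc⟩ := hzs
  have e1 : orient u v z = γ * orient u v q := by
    rw [hzc, orient_combo _ _ _ _ _ hsum, orient_self_mid, orient_self_right]; ring
  have e2 : orient u v z = ε * orient u v p := by
    have : z = ((1 - ε) / 2) • u + ((1 - ε) / 2) • v + ε • p := by rw [hz, hm]; module
    rw [this, orient_combo _ _ _ _ _ (by ring), orient_self_mid, orient_self_right]; ring
  have e3 : 0 < γ * (orient u v p * orient u v q) := by
    have : γ * (orient u v p * orient u v q) = ε * (orient u v p) ^ 2 := by
      linear_combination orient u v p * (e2 - e1)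
    rw [this]; positivity
  exact (pos_and_pos_or_neg_and_neg_of_mul_pos e3).elim And.right fun h => absurd h.1 hγ.not_gt

/-- In a first-order Delaunay triangulation, a triangle with a point `p` inside its circle forms a
flippable quadrilateral with `p`, both of whose non-Delaunay halves belong to the triangulation.
The power of `p` decreases strictly from a triangle to its neighbour towards `p`. If that neighbour
`bdq` does not have the vertex `p` but satisfies the claim, then the triangle `bpd` has an empty
circle, whereas the third vertex of the original triangle lies inside it. -/
theorem exists_flipQuad (hP : GeneralPosition P) (hT : IsOrderDelaunay 1 P T) (ht : t ∈ T)
    (hp : p ∈ inner P t) :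
    ∃ a b d, FlipQuad P a b p d ∧ t = {a, b, d} ∧ {b, p, d} ∈ T := by
  have hT' := hT.isTriangulation
  have one : ∀ r ∈ T, ∀ v ∈ inner P r, inner P r ⊆ {v} := by
    intro r hr v hv w hw
    have h1 := (hP.isOrderTriangle_iff (hT'.subset r hr) (hT'.card_eq_three r hr) 1).1
      (hT.isOrderTriangle r hr)
    exact Finset.mem_singleton.2 (Finset.card_le_one.1 h1 w hw v hv)
  by_contra hcon
  obtain ⟨t, htbad, hmin⟩ := Finset.exists_min_image
    (T.filter fun t => p ∈ inner P t ∧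
      ¬ ∃ a b d, FlipQuad P a b p d ∧ t = {a, b, d} ∧ {b, p, d} ∈ T)
    (fun t => pow t p) ⟨t, Finset.mem_filter.2 ⟨ht, hp, hcon⟩⟩
  obtain ⟨ht, hp, hbad⟩ := Finset.mem_filter.1 htbad
  have htP := hT'.subset t ht
  have ht3 := hT'.card_eq_three t ht
  have hpP := (mem_inner.1 hp).1
  obtain ⟨a, b, d, rfl, ha, hb, hd, o1, o2, o3, o4⟩ := hP.exists_convex_quad htP ht3 hp
    fun h => hP.notMem_of_mem_inner htP ht3 hp (hT'.mem_of_mem_convexHull hpP ht h)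
  have hneg := (mem_inner.1 hp).2
  have hneg' := pow_neg_opposite o2 o4 hneg
  have obdp : orient b d p < 0 := by rw [orient_swap_right]; linarith
  have obda : 0 < orient b d a := by rw [orient_rotate, orient_rotate d a b]; exact o4
  have haP : a ∈ inner P {b, p, d} := mem_inner.2 ⟨ha, hneg'⟩
  obtain ⟨q, hq, hqs⟩ := hT'.exists_neighbour ht (u := b) (v := d) (by simp) (by simp) hpP
    obdp.ne
  by_cases hqp : q = p
  · subst hqp
    rw [tri_swap_right] at hq
    exact hbad ⟨a, b, d, ⟨ha, hb, hpP, hd, o1, o2, o3, o4, hneg, one _ ht q hp, one _ hq a haP⟩,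
      rfl, hq⟩
  have obdq : orient b d q < 0 := by nlinarith
  obtain ⟨hbd, hbq, hdq⟩ := ne_of_orient_ne obdq.ne
  have hqa : q ≠ a := by rintro rfl; linarith
  have hqP : q ∈ P := hT'.subset _ hq (by simp)
  have hqpos : 0 < pow {b, d, a} q := by
    rw [tri_rotate]
    exact hP.pow_pos htP ht3 hqP (by simp [hqa, hbq.symm, hdq.symm])
      fun h => hqp (Finset.mem_singleton.1 (one _ ht p hp h))
  have hlt : pow {b, d, q} p < pow {b, d, a} p := by
    have := pow_sub_pow_mul obda.ne' obdq.ne p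
    have h2 : 0 < -pow {b, d, a} q * orient b d p := by nlinarith
    rw [← this] at h2
    nlinarith
  rw [tri_rotate a b d] at hlt
  have hpr : p ∈ inner P {b, d, q} := mem_inner.2 ⟨hpP, hlt.trans hneg⟩
  have hgood : ∃ a' b' d', FlipQuad P a' b' p d' ∧ ({b, d, q} : Finset Plane) = {a', b', d'} ∧
      {b', p, d'} ∈ T := by
    by_contra hg
    exact absurd (hmin _ (Finset.mem_filter.2 ⟨hq, hpr, hg⟩)) (not_le.2 hlt)
  obtain ⟨a', b', d', hF, he, -⟩ := hgood
  have hempty : {b, p, d} ∈ emptyTriangles P := by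
    have m1 : b = a' ∨ b = b' ∨ b = d' := by
      simpa using (he ▸ (by simp) : b ∈ ({a', b', d'} : Finset Plane))
    have m2 : d = a' ∨ d = b' ∨ d = d' := by
      simpa using (he ▸ (by simp) : d ∈ ({a', b', d'} : Finset Plane))
    have m3 : q = a' ∨ q = b' ∨ q = d' := by
      simpa using (he ▸ (by simp) : q ∈ ({a', b', d'} : Finset Plane))
    have e1 := hF.abc_mem hP
    have e2 := hF.acd_mem hP
    have f1 := hF.dab
    rcases m1 with rfl | rfl | rfl <;> rcases m2 with rfl | rfl | rfl <;>
      first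
      | exact absurd rfl hbd
      | skip
    · rwa [tri_swap_right]
    · exact e2
    · convert e1 using 1; ext; simp; tauto
    · have : q = a' := by
        rcases m3 with h | h | h
        · exact h
        · exact absurd h.symm hbq
        · exact absurd h.symm hdq
      subst this
      rw [orient_rotate, orient_rotate d q b] at obdq
      linarith
    · convert e2 using 1; ext; simp; tauto
    · have : q = a' := by
        rcases m3 with h | h | h
        · exact h
        · exact absurd h.symm hdq
        · exact absurd h.symm hbq
      subst this
      have := hF.bcd
      rw [orient_rotate b d p] at this
      linarith
  simp [(mem_emptyTriangles.1 hempty).2] at haP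

end

/-! ### The Delaunay triangulation -/

section

variable {P t : Finset Plane} {a b c x p q : Plane}
theorem continuous_orient (a b : Plane) : Continuous (orient a b) := by
  unfold orient; fun_prop

theorem mem_interior_triangle (h : 0 < orient a b c) (h1 : 0 < orient a b x)
    (h2 : 0 < orient b c x) (h3 : 0 < orient c a x) :
    x ∈ interior (convexHull ℝ ({a, b, c} : Set Plane)) := by
  rw [mem_interior]
  refine ⟨{x | 0 < orient a b x} ∩ {x | 0 < orient b c x} ∩ {x | 0 < orient c a x}, ?_, ?_,
    ⟨h1, h2⟩, h3⟩
  · rintro y ⟨⟨y1, y2⟩, y3⟩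
    exact (mem_triangle_iff_orient h).2 ⟨le_of_lt y1, le_of_lt y2, le_of_lt y3⟩
  · exact ((isOpen_lt continuous_const (continuous_orient _ _)).inter
      (isOpen_lt continuous_const (continuous_orient _ _))).inter
      (isOpen_lt continuous_const (continuous_orient _ _))

theorem ae_orient_ne_zero (h : p ≠ q) :
    ∀ᵐ x ∂(MeasureTheory.volume : MeasureTheory.Measure Plane), orient p q x ≠ 0 := by
  have hne : line[ℝ, p, q] ≠ ⊤ := by
    intro htop
    have hmem : (!₂[p 0 - (q 1 - p 1), p 1 + (q 0 - p 0)] : Plane) ∈ line[ℝ, p, q] := by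
      rw [htop]; exact AffineSubspace.mem_top _ _ _
    have h0 := orient_eq_zero_of_collinear (collinear_insert_of_mem_affineSpan_pair hmem)
    have h1 : (q 0 - p 0) ^ 2 + (q 1 - p 1) ^ 2 = 0 := by
      rw [← h0]; simp [orient]; ring
    apply h
    apply plane_ext <;> nlinarith [sq_nonneg (q 0 - p 0), sq_nonneg (q 1 - p 1)]
  have hnull := MeasureTheory.Measure.addHaar_affineSubspace
    (MeasureTheory.volume : MeasureTheory.Measure Plane) _ hne
  refine MeasureTheory.measure_mono_null (fun x hx => ?_) hnull
  have hx0 : orient p q x = 0 := by simpa using hx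
  exact (collinear_of_orient_eq_zero hx0).mem_affineSpan_of_mem_of_ne
    (by simp) (by simp) (by simp) h

/-- Replacing the vertex `c` of a triangle around `x` by a point `q` inside its circle keeps `x` in
the triangle, when `c` is the vertex whose weight vanishes first, and raises the power of `x`. -/
theorem exchange_vertex (h : 0 < orient a b c) (ha : 0 < orient b c x) (hb : 0 < orient c a x)
    (hc : 0 < orient a b x) (hneg : pow {a, b, c} q < 0)
    (h1 : orient b c q / orient b c x ≤ orient a b q / orient a b x)
    (h2 : orient c a q / orient c a x ≤ orient a b q / orient a b x) :
    0 < orient a b q ∧ x ∈ convexHull ℝ ({a, b, q} : Set Plane) ∧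
      pow {a, b, c} x < pow {a, b, q} x := by
  rw [div_le_div_iff₀ (by assumption) (by assumption)] at h1 h2
  have hq : 0 < orient a b q := by
    by_contra hn
    have hsum : orient b c q + orient c a q + orient a b q = orient a b c := by
      unfold orient; ring
    have i1 : orient b c q ≤ 0 := by nlinarith
    have i2 : orient c a q ≤ 0 := by nlinarith
    linarith
  refine ⟨hq, (mem_triangle_iff_orient hq).2 ⟨hc.le, ?_, ?_⟩, ?_⟩
  · have : orient b q x * orient a b c =
        orient a b q * orient b c x - orient b c q * orient a b x := by
      unfold orient; ring
    exact nonneg_of_mul_nonneg_left (by rw [this]; linarith) h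
  · have : orient q a x * orient a b c =
        orient a b q * orient c a x - orient c a q * orient a b x := by
      unfold orient; ring
    exact nonneg_of_mul_nonneg_left (by rw [this]; linarith) h
  · have := pow_sub_pow_mul h.ne' hq.ne' x
    have h3 : 0 < -pow {a, b, c} q * orient a b x := by nlinarith
    rw [← this] at h3
    linarith [(pos_iff_pos_of_mul_pos h3).2 hq]

/-- A point of the convex hull off the lines through two points of `P` lies in an empty triangle,
namely in the triangle around it whose circle gives it the largest power. -/
theorem GeneralPosition.exists_emptyTriangle (hP : GeneralPosition P) (h3 : 3 ≤ P.card)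
    (hx : x ∈ convexHull ℝ (P : Set Plane))
    (hgen : ∀ p ∈ P, ∀ q ∈ P, p ≠ q → orient p q x ≠ 0) :
    ∃ t ∈ emptyTriangles P, x ∈ convexHull ℝ (t : Set Plane) := by
  obtain ⟨t₀, ht₀⟩ : ((P.powersetCard 3).filter fun t : Finset Plane =>
      x ∈ convexHull ℝ (t : Set Plane)).Nonempty := by
    rw [convexHull_eq_union] at hx
    simp only [Set.mem_iUnion, exists_prop] at hx
    obtain ⟨s, hsP, hind, hxs⟩ := hx
    have hcard : s.card ≤ 3 := by
      have := hind.card_le_finrank_succ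
      rw [Fintype.card_coe] at this
      refine this.trans (Nat.succ_le_succ ((Submodule.finrank_le _).trans ?_))
      simp
    obtain ⟨t, hst, htP, ht⟩ := Finset.exists_subsuperset_card_eq
      (by exact_mod_cast hsP : s ⊆ P) hcard h3
    exact ⟨t, Finset.mem_filter.2 ⟨Finset.mem_powersetCard.2 ⟨htP, ht⟩,
      convexHull_mono (by exact_mod_cast hst) hxs⟩⟩
  obtain ⟨t, ht, hmax⟩ := Finset.exists_max_image _ (fun t => pow t x) ⟨t₀, ht₀⟩
  obtain ⟨ht, hxt⟩ := Finset.mem_filter.1 ht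
  obtain ⟨htP, ht3⟩ := Finset.mem_powersetCard.1 ht
  refine ⟨t, mem_emptyTriangles.2 ⟨⟨htP, ht3⟩, ?_⟩, hxt⟩
  refine Finset.eq_empty_of_forall_notMem fun q hq => ?_
  have hn := hP.notMem_of_mem_inner htP ht3 hq
  obtain ⟨hqP, hneg⟩ := mem_inner.1 hq
  obtain ⟨a, b, c, rfl, ha, hb, hc, h⟩ := hP.exists_ccw htP ht3
  obtain ⟨hab, hac, hbc⟩ := ne_of_orient_ne h.ne'
  rw [Finset.coe_insert, Finset.coe_insert, Finset.coe_singleton, mem_triangle_iff_orient h] at hxt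
  have oc := lt_of_le_of_ne hxt.1 (hgen a ha b hb hab).symm
  have oa := lt_of_le_of_ne hxt.2.1 (hgen b hb c hc hbc).symm
  have ob := lt_of_le_of_ne hxt.2.2 (hgen c hc a ha hac.symm).symm
  -- a triangle around `x` with vertex `q` cannot give `x` a larger power
  have fin : ∀ u ∈ P, ∀ v ∈ P, 0 < orient u v q → x ∈ convexHull ℝ ({u, v, q} : Set Plane) →
      pow {a, b, c} x < pow {u, v, q} x → False := by
    intro u hu v hv ho hm hlt
    refine absurd (hmax {u, v, q} (Finset.mem_filter.2 ⟨Finset.mem_powersetCard.2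
      ⟨triple_subset hu hv hqP, card_triple ho.ne'⟩, by simpa using hm⟩)) (not_le.2 hlt)
  -- `q` replaces the vertex whose weight ratio is the largest; by symmetry, let it be `c`
  have caseC : ∀ a b c : Plane, a ∈ P → b ∈ P → 0 < orient a b c → 0 < orient b c x →
      0 < orient c a x → 0 < orient a b x → pow {a, b, c} q < 0 →
      orient b c q / orient b c x ≤ orient a b q / orient a b x →
      orient c a q / orient c a x ≤ orient a b q / orient a b x →
      (∀ u ∈ P, ∀ v ∈ P, 0 < orient u v q → x ∈ convexHull ℝ ({u, v, q} : Set Plane) →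
        pow {a, b, c} x < pow {u, v, q} x → False) → False := by
    intro a b c ha hb h oa ob oc hneg h1 h2 fin
    obtain ⟨e1, e2, e3⟩ := exchange_vertex h oa ob oc hneg h1 h2
    exact fin a ha b hb e1 e2 e3
  have hb' : 0 < orient b c a := by rwa [orient_rotate]
  have hc' : 0 < orient c a b := by rwa [orient_rotate, orient_rotate]
  have t1 : ({b, c, a} : Finset Plane) = {a, b, c} := tri_rotate a b c
  have t2 : ({c, a, b} : Finset Plane) = {a, b, c} := by rw [tri_rotate, tri_rotate]
  rcases le_total (orient b c q / orient b c x) (orient a b q / orient a b x) with l1 | l1 <;>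
  rcases le_total (orient c a q / orient c a x) (orient a b q / orient a b x) with l2 | l2 <;>
  rcases le_total (orient b c q / orient b c x) (orient c a q / orient c a x) with l3 | l3
  · exact caseC a b c ha hb h oa ob oc hneg l1 l2 fin
  · exact caseC a b c ha hb h oa ob oc hneg l1 l2 fin
  · exact caseC c a b hc ha hc' oc oa ob (t2 ▸ hneg) l2 l3 (t2 ▸ fin)
  · exact caseC c a b hc ha hc' oc oa ob (t2 ▸ hneg) l2 (l1.trans l2) (t2 ▸ fin)
  · exact caseC b c a hb hc hb' ob oc oa (t1 ▸ hneg) (l2.trans l1) l1 (t1 ▸ fin)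
  · exact caseC b c a hb hc hb' ob oc oa (t1 ▸ hneg) (l2.trans l1) l1 (t1 ▸ fin)
  · exact caseC c a b hc ha hc' oc oa ob (t2 ▸ hneg) l2 l3 (t2 ▸ fin)
  · exact caseC b c a hb hc hb' ob oc oa (t1 ▸ hneg) l3 l1 (t1 ▸ fin)

theorem interior_convexHull_nonempty (hP : GeneralPosition P) (h3 : 3 ≤ P.card) :
    (interior (convexHull ℝ (P : Set Plane))).Nonempty := by
  obtain ⟨t, htP, ht3⟩ := Finset.exists_subset_card_eq h3
  obtain ⟨a, b, c, rfl, -, -, -, h⟩ := hP.exists_ccw htP ht3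
  have hs : (1 / 3 : ℝ) + 1 / 3 + 1 / 3 = 1 := by norm_num
  refine ⟨(1 / 3 : ℝ) • a + (1 / 3 : ℝ) • b + (1 / 3 : ℝ) • c,
    interior_mono (convexHull_mono (by exact_mod_cast htP)) ?_⟩
  rw [Finset.coe_insert, Finset.coe_insert, Finset.coe_singleton]
  refine mem_interior_triangle h ?_ ?_ ?_ <;>
    simp only [orient_combo _ _ _ _ _ hs, orient_self_mid, orient_self_right, orient_rotate] <;>
    linarith

theorem GeneralPosition.affineIndependent (hP : GeneralPosition P) (ht : t ⊆ P)
    (h3 : t.card = 3) : AffineIndependent ℝ ((↑) : t → Plane) := by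
  obtain ⟨a, b, c, rfl, -, -, -, h⟩ := hP.exists_ccw ht h3
  have := (affineIndependent_of_orient h.ne').range
  have he : Set.range ![a, b, c] = (({a, b, c} : Finset Plane) : Set Plane) := by
    ext v
    simp only [Set.mem_range, Fin.exists_fin_succ, Finset.coe_insert, Finset.coe_singleton,
      Set.mem_insert_iff, Set.mem_singleton_iff]
    simp [eq_comm]
  rw [he] at this
  exact this

/-- The triangles with empty circumcircle form a triangulation. -/
theorem GeneralPosition.isTriangulation_emptyTriangles (hP : GeneralPosition P)
    (h3 : 3 ≤ P.card) : IsTriangulation P (emptyTriangles P) := by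
  have hcover : ⋃ t ∈ emptyTriangles P, convexHull ℝ ((t : Finset Plane) : Set Plane) =
      convexHull ℝ (P : Set Plane) := by
    apply Set.Subset.antisymm
    · refine Set.iUnion₂_subset fun t ht => convexHull_mono ?_
      exact_mod_cast (mem_emptyTriangles.1 ht).1.1
    set V := ⋃ t ∈ emptyTriangles P, convexHull ℝ ((t : Finset Plane) : Set Plane) with hV
    have hVc : IsClosed V :=
      isClosed_biUnion_finset fun s _ => s.finite_toSet.isClosed_convexHull ℝ
    have hae : ∀ᵐ x ∂(MeasureTheory.volume : MeasureTheory.Measure Plane),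
        ∀ p ∈ P, ∀ q ∈ P, p ≠ q → orient p q x ≠ 0 := by
      rw [Filter.eventually_all_finset]
      intro p _
      rw [Filter.eventually_all_finset]
      intro q _
      by_cases hpq : p = q
      · simp [hpq]
      · filter_upwards [ae_orient_ne_zero hpq] with x hx _ using hx
    have hdense := MeasureTheory.Measure.dense_of_ae hae
    calc convexHull ℝ (P : Set Plane) ⊆ closure (convexHull ℝ (P : Set Plane)) := subset_closure
      _ = closure (interior (convexHull ℝ (P : Set Plane))) :=
        ((convex_convexHull ℝ _).closure_interior_eq_closure_of_nonempty_interior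
          (interior_convexHull_nonempty hP h3)).symm
      _ ⊆ closure V := by
        refine closure_minimal ?_ isClosed_closure
        refine (hdense.open_subset_closure_inter isOpen_interior).trans (closure_mono ?_)
        rintro x ⟨hx, hg⟩
        obtain ⟨t, ht, hxt⟩ := hP.exists_emptyTriangle h3 (interior_subset hx) hg
        exact Set.mem_iUnion₂.2 ⟨t, ht, hxt⟩
      _ = V := hVc.closure_eq
  refine ⟨fun t ht => (mem_emptyTriangles.1 ht).1.1, fun t ht => (mem_emptyTriangles.1 ht).1.2,
    fun t ht => ?_, hcover, fun s hs t ht => ?_, fun p hp => ?_⟩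
  · obtain ⟨⟨h1, h2⟩, -⟩ := mem_emptyTriangles.1 ht
    exact hP.affineIndependent h1 h2
  · refine Set.Subset.antisymm (fun x hx => ?_) (Set.subset_inter
      (convexHull_mono Set.inter_subset_left) (convexHull_mono Set.inter_subset_right))
    rw [← Finset.coe_inter]
    exact hP.emptyTriangle_face hs ht subset_rfl hx.1 hx.2
  · have : p ∈ ⋃ t ∈ emptyTriangles P, convexHull ℝ ((t : Finset Plane) : Set Plane) := by
      rw [hcover]; exact subset_convexHull ℝ _ hp
    obtain ⟨t, ht, hpt⟩ := Set.mem_iUnion₂.1 this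
    exact ⟨t, ht, hP.mem_of_mem_emptyTriangle ht hp hpt⟩

end

/-! ### Flips -/

section

variable {P s : Finset Plane} {T : Finset (Finset Plane)} {a b c d x : Plane}
/-- One half of a convex quadrilateral is covered by the two halves cut off by the other
diagonal. -/
theorem half_quad_subset (abc : 0 < orient a b c) (bcd : 0 < orient b c d)
    (cda : 0 < orient c d a) (dab : 0 < orient d a b)
    (hx : x ∈ convexHull ℝ (({a, b, d} : Finset Plane) : Set Plane)) :
    x ∈ convexHull ℝ (({a, b, c} : Finset Plane) : Set Plane) ∨
      x ∈ convexHull ℝ (({a, c, d} : Finset Plane) : Set Plane) := by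
  have abd : 0 < orient a b d := by rwa [orient_rotate d a b]
  have acd : 0 < orient a c d := by rwa [← orient_rotate a c d]
  have bca : 0 < orient b c a := by rwa [orient_rotate]
  simp only [Finset.coe_insert, Finset.coe_singleton] at hx ⊢
  rw [mem_triangle_iff_orient abc, mem_triangle_iff_orient acd]
  obtain ⟨i1, i2, i3⟩ := (mem_triangle_iff_orient abd).1 hx
  obtain ⟨α, β, γ, h1, h2, h3, hs, rfl⟩ := mem_triangle_iff.1 hx
  have j1 : 0 ≤ orient b c (α • a + β • b + γ • d) := by
    rw [orient_combo _ _ _ _ _ hs, orient_self_mid]; positivity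
  have j2 : 0 ≤ orient c d (α • a + β • b + γ • d) := by
    have : 0 < orient c d b := by rwa [orient_rotate]
    rw [orient_combo _ _ _ _ _ hs, orient_self_right]; positivity
  rcases le_total 0 (orient c a (α • a + β • b + γ • d)) with h | h
  · exact Or.inl ⟨i1, j1, h⟩
  · refine Or.inr ⟨?_, j2, i3⟩
    rw [orient_swap] at h
    linarith

/-- A point of the overlap of an old triangle `abc` and a new triangle `abd` meets any other
triangle `s` in a face of `abd`. A common face containing `c` would be on the line `bc`, which meets
`abd` only in `b`. -/
theorem IsTriangulation.flip_face_aux (hT : IsTriangulation P T) (hs : s ∈ T) (ht : {a, b, c} ∈ T)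
    (hac : ¬ (a ∈ s ∧ c ∈ s)) (h : 0 < orient b c a * orient b c d)
    (hxs : x ∈ convexHull ℝ (s : Set Plane))
    (hx1 : x ∈ convexHull ℝ (({a, b, c} : Finset Plane) : Set Plane))
    (hx2 : x ∈ convexHull ℝ (({a, b, d} : Finset Plane) : Set Plane)) :
    x ∈ convexHull ℝ ((s ∩ {a, b, d} : Finset Plane) : Set Plane) := by
  have hx := hT.face hs ht subset_rfl subset_rfl hxs hx1
  by_cases hc : c ∈ s
  · have ha : a ∉ s := fun ha => hac ⟨ha, hc⟩
    have h0 : orient b c x = 0 := by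
      refine orient_eq_zero_of_mem_segment (convexHull_mono (fun w hw => ?_) hx)
      simp only [Finset.coe_inter, Finset.coe_insert, Finset.coe_singleton, Set.mem_inter_iff,
        Set.mem_insert_iff, Set.mem_singleton_iff, Finset.mem_coe] at hw ⊢
      exact hw.2.resolve_left fun e => ha (e ▸ hw.1)
    simp only [Finset.coe_insert, Finset.coe_singleton] at hx2
    obtain ⟨α, β, γ, h1, h2, h3, hsum, rfl⟩ := mem_triangle_iff.1 hx2
    rw [orient_combo _ _ _ _ _ hsum, orient_self_mid] at h0
    have n1 : 0 ≤ α * orient b c a ^ 2 := by positivity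
    have n2 : 0 ≤ γ * (orient b c a * orient b c d) := by positivity
    have e : α * orient b c a ^ 2 + γ * (orient b c a * orient b c d) = 0 := by
      linear_combination orient b c a * h0
    have hne : orient b c a ≠ 0 := by rintro h'; simp [h'] at h
    have hα : α = 0 := by
      have : α * orient b c a ^ 2 = 0 := by linarith
      simpa [hne] using this
    have hγ : γ = 0 := by
      have : γ * (orient b c a * orient b c d) = 0 := by linarith
      exact (mul_eq_zero.1 this).resolve_right h.ne'
    obtain rfl : β = 1 := by linarith
    subst hα hγ
    simp only [zero_smul, one_smul, zero_add, add_zero] at hxs ⊢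
    have hb := hT.mem_of_mem_convexHull (hT.subset _ ht (by simp)) hs hxs
    exact subset_convexHull ℝ _ (by simp [hb])
  · refine convexHull_mono (fun w hw => ?_) hx
    simp only [Finset.coe_inter, Finset.coe_insert, Finset.coe_singleton, Set.mem_inter_iff,
      Set.mem_insert_iff, Set.mem_singleton_iff, Finset.mem_coe] at hw ⊢
    refine ⟨hw.1, ?_⟩
    rcases hw.2 with h' | h' | h'
    · exact Or.inl h'
    · exact Or.inr (Or.inl h')
    · exact absurd (h' ▸ hw.1) hc

/-- Exchanging the diagonal of a convex quadrilateral that consists of two triangles of a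
triangulation yields a triangulation. -/
theorem IsTriangulation.flip (hT : IsTriangulation P T) (hP : GeneralPosition P)
    (abc : 0 < orient a b c) (bcd : 0 < orient b c d) (cda : 0 < orient c d a)
    (dab : 0 < orient d a b) (h1 : {a, b, c} ∈ T) (h2 : {a, c, d} ∈ T) :
    IsTriangulation P (T \ {{a, b, c}, {a, c, d}} ∪ {{a, b, d}, {b, c, d}}) := by
  have abd : 0 < orient a b d := by rwa [orient_rotate d a b]
  have acd : 0 < orient a c d := by rwa [← orient_rotate a c d]
  have bca : 0 < orient b c a := by rwa [orient_rotate]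
  have cdb : 0 < orient c d b := by rwa [orient_rotate]
  have ha : a ∈ P := hT.subset _ h1 (by simp)
  have hb : b ∈ P := hT.subset _ h1 (by simp)
  have hc : c ∈ P := hT.subset _ h1 (by simp)
  have hd : d ∈ P := hT.subset _ h2 (by simp)
  have hmem : ∀ t, t ∈ T \ {{a, b, c}, {a, c, d}} ∪ {{a, b, d}, {b, c, d}} ↔
      (t ∈ T ∧ t ≠ {a, b, c} ∧ t ≠ {a, c, d}) ∨ t = {a, b, d} ∨ t = {b, c, d} := by
    intro t
    simp only [Finset.mem_union, Finset.mem_sdiff, Finset.mem_insert, Finset.mem_singleton, not_or]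
  have hbasic : ∀ t ∈ T \ {{a, b, c}, {a, c, d}} ∪ {{a, b, d}, {b, c, d}},
      t ⊆ P ∧ t.card = 3 := by
    intro t ht
    rcases (hmem t).1 ht with h | rfl | rfl
    · exact ⟨hT.subset _ h.1, hT.card_eq_three _ h.1⟩
    · exact ⟨triple_subset ha hb hd, card_triple abd.ne'⟩
    · exact ⟨triple_subset hb hc hd, card_triple bcd.ne'⟩
  -- the old pair of triangles and the new pair cover the same points
  have halves : ∀ x, (x ∈ convexHull ℝ (({a, b, d} : Finset Plane) : Set Plane) →
        x ∈ convexHull ℝ (({a, b, c} : Finset Plane) : Set Plane) ∨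
        x ∈ convexHull ℝ (({a, c, d} : Finset Plane) : Set Plane)) ∧
      (x ∈ convexHull ℝ (({b, c, d} : Finset Plane) : Set Plane) →
        x ∈ convexHull ℝ (({a, b, c} : Finset Plane) : Set Plane) ∨
        x ∈ convexHull ℝ (({a, c, d} : Finset Plane) : Set Plane)) ∧
      (x ∈ convexHull ℝ (({a, b, c} : Finset Plane) : Set Plane) →
        x ∈ convexHull ℝ (({a, b, d} : Finset Plane) : Set Plane) ∨
        x ∈ convexHull ℝ (({b, c, d} : Finset Plane) : Set Plane)) ∧
      (x ∈ convexHull ℝ (({a, c, d} : Finset Plane) : Set Plane) →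
        x ∈ convexHull ℝ (({a, b, d} : Finset Plane) : Set Plane) ∨
        x ∈ convexHull ℝ (({b, c, d} : Finset Plane) : Set Plane)) := by
    intro x
    refine ⟨half_quad_subset abc bcd cda dab, fun h => ?_, fun h => ?_, fun h => ?_⟩
    · rw [← tri_rotate b c d] at h
      have := half_quad_subset cda dab abc bcd h
      rw [tri_rotate a c d, ← tri_rotate c a b] at this
      exact this.symm
    · rw [← tri_rotate a b c] at h
      have := half_quad_subset bcd cda dab abc h
      rw [tri_rotate a b d] at this
      exact this.symm
    · rw [tri_rotate d a c] at h
      have := half_quad_subset dab abc bcd cda h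
      rw [← tri_rotate d a b, ← tri_rotate d b c] at this
      exact this
  -- the old diagonal is not a side of any remaining triangle
  have hdiag : ∀ s ∈ T, s ≠ {a, b, c} → s ≠ {a, c, d} → ¬ (a ∈ s ∧ c ∈ s) := by
    rintro s hs hs1 hs2 ⟨has, hcs⟩
    have hac : a ≠ c := (ne_of_orient_ne abc.ne').2.1
    obtain ⟨r, hr⟩ : ∃ r, s = {a, c, r} := by
      have hc : (s \ {a, c}).card = 1 := by
        rw [Finset.card_sdiff_of_subset (by simp [Finset.insert_subset_iff, has, hcs]),
          hT.card_eq_three s hs, Finset.card_pair hac]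
      obtain ⟨r, hr⟩ := Finset.card_eq_one.1 hc
      refine ⟨r, ?_⟩
      ext w
      have := Finset.ext_iff.1 hr w
      simp only [Finset.mem_sdiff, Finset.mem_insert, Finset.mem_singleton] at this ⊢
      constructor
      · intro hw; tauto
      · rintro (rfl | rfl | h)
        · exact has
        · exact hcs
        · exact (this.2 h).1
    subst hr
    have h3 := hT.card_eq_three _ hs
    have har : a ≠ r := by
      rintro rfl
      have : ({a, c, a} : Finset Plane).card ≤ 2 := by
        rw [Finset.pair_comm, Finset.insert_eq_of_mem (by simp)]; exact Finset.card_le_two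
      omega
    have hcr : c ≠ r := by
      rintro rfl
      have : ({a, c, c} : Finset Plane).card ≤ 2 := by
        rw [Finset.pair_eq_singleton]; exact Finset.card_le_two
      omega
    have acb : orient a c b < 0 := by rw [orient_swap_right]; linarith
    rcases lt_or_gt_of_ne (hP.orient_ne ha hc (hT.subset _ hs (by simp)) hac har hcr) with h | h
    · have := hT.eq_of_same_side hs (by rwa [tri_swap_right]) (mul_pos_of_neg_of_neg h acb)
      subst this
      exact hs1 (tri_swap_right _ _ _)
    · have := hT.eq_of_same_side hs h2 (mul_pos h acd)
      subst this
      exact hs2 rfl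
  have old_new : ∀ s ∈ T, s ≠ {a, b, c} → s ≠ {a, c, d} → ∀ x,
      x ∈ convexHull ℝ (s : Set Plane) →
      (x ∈ convexHull ℝ (({a, b, d} : Finset Plane) : Set Plane) →
        x ∈ convexHull ℝ ((s ∩ {a, b, d} : Finset Plane) : Set Plane)) ∧
      (x ∈ convexHull ℝ (({b, c, d} : Finset Plane) : Set Plane) →
        x ∈ convexHull ℝ ((s ∩ {b, c, d} : Finset Plane) : Set Plane)) := by
    intro s hs hs1 hs2 x hxs
    have hac := hdiag s hs hs1 hs2
    have hca : ¬ (c ∈ s ∧ a ∈ s) := fun h => hac h.symm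
    have r1 : 0 < orient b c a * orient b c d := mul_pos bca bcd
    have r2 : 0 < orient d c a * orient d c b := by
      rw [orient_swap c d a, orient_swap c d b]; nlinarith
    have r3 : 0 < orient d a c * orient d a b :=
      mul_pos (by rwa [orient_rotate c d a]) dab
    have r4 : 0 < orient b a c * orient b a d := by
      rw [orient_swap a b c, orient_swap a b d]; nlinarith
    constructor
    · intro hx
      rcases (halves x).1 hx with h | h
      · exact hT.flip_face_aux hs h1 hac r1 hxs h hx
      · rw [tri_swap_right a d b] at hx ⊢
        rw [tri_swap_right a d c] at h h2
        exact hT.flip_face_aux hs h2 hac r2 hxs h hx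
    · intro hx
      have e1 : ({b, c, d} : Finset Plane) = {c, d, b} := (tri_rotate b c d).symm
      have e2 : ({b, c, d} : Finset Plane) = {c, b, d} := tri_swap c b d
      have e3 : ({a, b, c} : Finset Plane) = {c, b, a} := by ext; simp; tauto
      have e4 : ({a, c, d} : Finset Plane) = {c, d, a} := (tri_rotate a c d).symm
      rcases (halves x).2.1 hx with h | h
      · rw [e2] at hx ⊢
        rw [e3] at h h1
        exact hT.flip_face_aux hs h1 hca r4 hxs h hx
      · rw [e1] at hx ⊢
        rw [e4] at h h2
        exact hT.flip_face_aux hs h2 hca r3 hxs h hx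
  have new_new : ∀ x, x ∈ convexHull ℝ (({a, b, d} : Finset Plane) : Set Plane) →
      x ∈ convexHull ℝ (({b, c, d} : Finset Plane) : Set Plane) →
      x ∈ convexHull ℝ (({a, b, d} ∩ {b, c, d} : Finset Plane) : Set Plane) := by
    intro x hx1 hx2
    simp only [Finset.coe_insert, Finset.coe_singleton] at hx1 hx2
    have i1 := ((mem_triangle_iff_orient bcd).1 hx2).2.2
    obtain ⟨α, β, γ, p1, p2, p3, hsum, rfl⟩ := mem_triangle_iff.1 hx1
    rw [orient_combo _ _ _ _ _ hsum, orient_self_mid, orient_self_right] at i1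
    have dba : orient d b a < 0 := by rw [orient_swap_right]; linarith
    have hα : α = 0 := by nlinarith
    subst hα
    have hm : (0 : ℝ) • a + β • b + γ • d ∈ convexHull ℝ (({b, d} : Finset Plane) : Set Plane) := by
      rw [Finset.coe_insert, Finset.coe_singleton, convexHull_pair]
      exact ⟨β, γ, p2, p3, by linarith, by simp⟩
    refine convexHull_mono (fun w hw => ?_) hm
    simp only [Finset.coe_inter, Finset.coe_insert, Finset.coe_singleton, Set.mem_inter_iff,
      Set.mem_insert_iff, Set.mem_singleton_iff] at hw ⊢
    tauto
  refine ⟨fun t ht => (hbasic t ht).1, fun t ht => (hbasic t ht).2,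
    fun t ht => hP.affineIndependent (hbasic t ht).1 (hbasic t ht).2, ?_, ?_, ?_⟩
  · apply Set.Subset.antisymm
    · exact Set.iUnion₂_subset fun t ht => convexHull_mono (by exact_mod_cast (hbasic t ht).1)
    · rw [← hT.cover]
      refine Set.iUnion₂_subset fun t ht x hx => ?_
      simp only [Set.mem_iUnion, exists_prop]
      by_cases e1 : t = {a, b, c}
      · subst e1
        rcases (halves x).2.2.1 hx with h | h
        · exact ⟨_, (hmem _).2 (Or.inr (Or.inl rfl)), h⟩
        · exact ⟨_, (hmem _).2 (Or.inr (Or.inr rfl)), h⟩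
      by_cases e2 : t = {a, c, d}
      · subst e2
        rcases (halves x).2.2.2 hx with h | h
        · exact ⟨_, (hmem _).2 (Or.inr (Or.inl rfl)), h⟩
        · exact ⟨_, (hmem _).2 (Or.inr (Or.inr rfl)), h⟩
      · exact ⟨t, (hmem _).2 (Or.inl ⟨ht, e1, e2⟩), hx⟩
  · intro s hs t ht
    refine Set.Subset.antisymm ?_ (Set.subset_inter
      (convexHull_mono Set.inter_subset_left) (convexHull_mono Set.inter_subset_right))
    rintro x ⟨hxs, hxt⟩
    rw [← Finset.coe_inter]
    rcases (hmem s).1 hs with ⟨s0, s1, s2⟩ | rfl | rfl <;>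
      rcases (hmem t).1 ht with ⟨t0, t1, t2⟩ | rfl | rfl
    · exact hT.face s0 t0 subset_rfl subset_rfl hxs hxt
    · exact (old_new s s0 s1 s2 x hxs).1 hxt
    · exact (old_new s s0 s1 s2 x hxs).2 hxt
    · rw [Finset.inter_comm]; exact (old_new t t0 t1 t2 x hxt).1 hxs
    · rwa [Finset.inter_self]
    · exact new_new x hxs hxt
    · rw [Finset.inter_comm]; exact (old_new t t0 t1 t2 x hxt).2 hxs
    · rw [Finset.inter_comm]; exact new_new x hxt hxs
    · rwa [Finset.inter_self]
  · intro p hp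
    obtain ⟨t, ht, hpt⟩ := hT.exists_mem p hp
    by_cases e1 : t = {a, b, c}
    · subst e1
      by_cases hpc : p = c
      · exact ⟨_, (hmem _).2 (Or.inr (Or.inr rfl)), by simp [hpc]⟩
      · refine ⟨_, (hmem _).2 (Or.inr (Or.inl rfl)), ?_⟩
        simp only [Finset.mem_insert, Finset.mem_singleton] at hpt ⊢
        tauto
    by_cases e2 : t = {a, c, d}
    · subst e2
      by_cases hpc : p = c
      · exact ⟨_, (hmem _).2 (Or.inr (Or.inr rfl)), by simp [hpc]⟩
      · refine ⟨_, (hmem _).2 (Or.inr (Or.inl rfl)), ?_⟩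
        simp only [Finset.mem_insert, Finset.mem_singleton] at hpt ⊢
        tauto
    · exact ⟨t, (hmem _).2 (Or.inl ⟨ht, e1, e2⟩), hpt⟩

end

/-! ### First-order Delaunay triangulations as sets of flips -/

section

variable {P Q t : Finset Plane} {T F : Finset (Finset Plane)} {a b c d : Plane}
/-- The vertex sets of the flippable quadrilaterals of `P`, in the sense of `FlipQuad`. -/
noncomputable def flipQuads (P : Finset Plane) : Finset (Finset Plane) :=
  P.powerset.filter fun Q => ∃ a b c d, FlipQuad P a b c d ∧ Q = {a, b, c, d}

/-- The Delaunay triangulation with the quadrilaterals in `F` flipped: it keeps the empty triangles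
that are not part of a quadrilateral in `F`, and adds the non-empty ones that are. -/
noncomputable def flipped (P : Finset Plane) (F : Finset (Finset Plane)) : Finset (Finset Plane) :=
  (P.powersetCard 3).filter fun t =>
    (inner P t = ∅ ∧ ∀ Q ∈ F, ¬ t ⊆ Q) ∨ (inner P t ≠ ∅ ∧ ∃ Q ∈ F, t ⊆ Q)

theorem mem_flipQuads : Q ∈ flipQuads P ↔ ∃ a b c d, FlipQuad P a b c d ∧ Q = {a, b, c, d} := by
  simp only [flipQuads, Finset.mem_filter, Finset.mem_powerset, and_iff_right_iff_imp]
  rintro ⟨a, b, c, d, h, rfl⟩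
  exact h.subset

theorem mem_flipped : t ∈ flipped P F ↔ (t ⊆ P ∧ t.card = 3) ∧
    ((inner P t = ∅ ∧ ∀ Q ∈ F, ¬ t ⊆ Q) ∨ (inner P t ≠ ∅ ∧ ∃ Q ∈ F, t ⊆ Q)) := by
  simp [flipped, Finset.mem_powersetCard]

theorem flipped_empty (P : Finset Plane) : flipped P ∅ = emptyTriangles P := by
  ext t; simp [mem_flipped, mem_emptyTriangles]

namespace FlipQuad

theorem abd_subset (h : FlipQuad P a b c d) :
    ({a, b, d} : Finset Plane) ⊆ P ∧ ({a, b, d} : Finset Plane).card = 3 :=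
  ⟨triple_subset h.mem_a h.mem_b h.mem_d, card_triple h.abd.ne'⟩

theorem bcd_subset (h : FlipQuad P a b c d) :
    ({b, c, d} : Finset Plane) ⊆ P ∧ ({b, c, d} : Finset Plane).card = 3 :=
  ⟨triple_subset h.mem_b h.mem_c h.mem_d, card_triple h.bcd.ne'⟩

theorem abc_sub : ({a, b, c} : Finset Plane) ⊆ {a, b, c, d} := by
  intro v; simp; tauto

theorem abd_sub : ({a, b, d} : Finset Plane) ⊆ {a, b, c, d} := by
  intro v; simp; tauto

theorem acd_sub : ({a, c, d} : Finset Plane) ⊆ {a, b, c, d} := by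
  intro v; simp; tauto

theorem bcd_sub : ({b, c, d} : Finset Plane) ⊆ {a, b, c, d} := by
  intro v; simp; tauto

/-- A flippable quadrilateral is determined by each of its two first-order triangles. -/
theorem eq_union_inner (hP : GeneralPosition P) (h : FlipQuad P a b c d) (ht : t ⊆ {a, b, c, d})
    (h3 : t.card = 3) (h0 : inner P t ≠ ∅) : ({a, b, c, d} : Finset Plane) = t ∪ inner P t := by
  rcases h.eq_of_inner_ne_empty hP ht h3 h0 with rfl | rfl
  · rw [h.inner_abd_eq]; ext; simp; tauto
  · rw [h.inner_bcd_eq]; ext; simp; tauto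

end FlipQuad

theorem eq_union_of_mem_flipQuads (hP : GeneralPosition P) (hQ : Q ∈ flipQuads P) (ht : t ⊆ Q)
    (h3 : t.card = 3) (h0 : inner P t ≠ ∅) : Q = t ∪ inner P t := by
  obtain ⟨a, b, c, d, h, rfl⟩ := mem_flipQuads.1 hQ
  exact h.eq_union_inner hP ht h3 h0

theorem eq_of_mem_flipQuads (hP : GeneralPosition P) {Q Q' : Finset Plane} (hQ : Q ∈ flipQuads P)
    (hQ' : Q' ∈ flipQuads P) (ht : t ∈ emptyTriangles P) (h1 : t ⊆ Q) (h2 : t ⊆ Q') : Q = Q' := by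
  obtain ⟨a, b, c, d, h, rfl⟩ := mem_flipQuads.1 hQ
  obtain ⟨a', b', c', d', h', rfl⟩ := mem_flipQuads.1 hQ'
  exact h.quad_eq hP h' ht h1 h2

theorem FlipQuad.mem_flipped_of_notMem (hP : GeneralPosition P) (h : FlipQuad P a b c d)
    (hF : F ⊆ flipQuads P) (hQ : {a, b, c, d} ∉ F) (ht : t ∈ emptyTriangles P)
    (hsub : t ⊆ {a, b, c, d}) : t ∈ flipped P F := by
  refine mem_flipped.2 ⟨(mem_emptyTriangles.1 ht).1, Or.inl ⟨(mem_emptyTriangles.1 ht).2, ?_⟩⟩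
  intro Q' hQ' hsub'
  have := eq_of_mem_flipQuads hP (mem_flipQuads.2 ⟨a, b, c, d, h, rfl⟩) (hF hQ') ht hsub hsub'
  exact hQ (this ▸ hQ')

theorem FlipQuad.flipped_insert (hP : GeneralPosition P) (h : FlipQuad P a b c d) :
    flipped P (insert {a, b, c, d} F) =
      flipped P F \ {{a, b, c}, {a, c, d}} ∪ {{a, b, d}, {b, c, d}} := by
  have e1 := (mem_emptyTriangles.1 (h.abc_mem hP)).2
  have e2 := (mem_emptyTriangles.1 (h.acd_mem hP)).2
  have e3 : inner P {a, b, d} ≠ ∅ := by simp [h.inner_abd_eq]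
  have e4 : inner P {b, c, d} ≠ ∅ := by simp [h.inner_bcd_eq]
  ext t
  simp only [Finset.mem_union, Finset.mem_sdiff, Finset.mem_insert, Finset.mem_singleton,
    mem_flipped, not_or, forall_eq_or_imp, exists_eq_or_imp]
  constructor
  · rintro ⟨ht, ⟨h0, hQ, hF⟩ | ⟨h0, hQ | hF⟩⟩
    · refine Or.inl ⟨⟨ht, Or.inl ⟨h0, hF⟩⟩, ?_, ?_⟩
      · rintro rfl; exact hQ FlipQuad.abc_sub
      · rintro rfl; exact hQ FlipQuad.acd_sub
    · exact Or.inr (h.eq_of_inner_ne_empty hP hQ ht.2 h0)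
    · refine Or.inl ⟨⟨ht, Or.inr ⟨h0, hF⟩⟩, ?_, ?_⟩
      · rintro rfl; exact h0 e1
      · rintro rfl; exact h0 e2
  · rintro (⟨⟨ht, ⟨h0, hF⟩ | ⟨h0, hF⟩⟩, n1, n2⟩ | rfl | rfl)
    · refine ⟨ht, Or.inl ⟨h0, fun hQ => ?_, hF⟩⟩
      rcases h.eq_of_inner_eq_empty hQ ht.2 h0 with e | e
      · exact n1 e
      · exact n2 e
    · exact ⟨ht, Or.inr ⟨h0, Or.inr hF⟩⟩
    · exact ⟨h.abd_subset, Or.inr ⟨e3, Or.inl FlipQuad.abd_sub⟩⟩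
    · exact ⟨h.bcd_subset, Or.inr ⟨e4, Or.inl FlipQuad.bcd_sub⟩⟩

/-- All flips can be performed independently of each other. -/
theorem GeneralPosition.isOrderDelaunay_flipped (hP : GeneralPosition P) (hn : 3 ≤ P.card)
    (hF : F ⊆ flipQuads P) : IsOrderDelaunay 1 P (flipped P F) := by
  refine ⟨?_, ?_⟩
  · induction F using Finset.induction_on with
    | empty => rw [flipped_empty]; exact hP.isTriangulation_emptyTriangles hn
    | insert Q F hQ ih =>
      have hF' : F ⊆ flipQuads P := fun q hq => hF (Finset.mem_insert_of_mem hq)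
      obtain ⟨a, b, c, d, h, rfl⟩ := mem_flipQuads.1 (hF (Finset.mem_insert_self _ _))
      rw [h.flipped_insert hP]
      exact (ih hF').flip hP h.abc h.bcd h.cda h.dab
        (h.mem_flipped_of_notMem hP hF' hQ (h.abc_mem hP) FlipQuad.abc_sub)
        (h.mem_flipped_of_notMem hP hF' hQ (h.acd_mem hP) FlipQuad.acd_sub)
  · intro t ht
    obtain ⟨⟨h1, h3⟩, h | ⟨h0, Q, hQ, hsub⟩⟩ := mem_flipped.1 ht
    · rw [hP.isOrderTriangle_iff h1 h3, h.1]; simp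
    · obtain ⟨a, b, c, d, h, rfl⟩ := mem_flipQuads.1 (hF hQ)
      rw [hP.isOrderTriangle_iff h1 h3]
      rcases h.eq_of_inner_ne_empty hP hsub h3 h0 with rfl | rfl
      · simp [h.inner_abd_eq]
      · simp [h.inner_bcd_eq]

/-- Every first-order Delaunay triangulation arises from the Delaunay triangulation by flips. -/
theorem GeneralPosition.eq_flipped (hP : GeneralPosition P)
    (hT : IsOrderDelaunay 1 P T) :
    T = flipped P ((flipQuads P).filter fun Q => ∃ t ∈ T, inner P t ≠ ∅ ∧ t ⊆ Q) := by
  have hT' := hT.isTriangulation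
  have hbasic : ∀ t ∈ T, t ⊆ P ∧ t.card = 3 := fun t ht =>
    ⟨hT'.subset t ht, hT'.card_eq_three t ht⟩
  have hquad : ∀ t ∈ T, inner P t ≠ ∅ →
      ∃ a b c d, FlipQuad P a b c d ∧ t = {a, b, d} ∧ {b, c, d} ∈ T := by
    intro t ht h0
    obtain ⟨p, hp⟩ := Finset.nonempty_iff_ne_empty.2 h0
    obtain ⟨a, b, d, h, e, h'⟩ := exists_flipQuad hP hT ht hp
    exact ⟨a, b, p, d, h, e, h'⟩
  ext t
  simp only [mem_flipped, Finset.mem_filter]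
  constructor
  · intro ht
    refine ⟨hbasic t ht, ?_⟩
    by_cases h0 : inner P t = ∅
    · refine Or.inl ⟨h0, ?_⟩
      rintro Q ⟨hQ, s, hs, hs0, hsQ⟩ htQ
      obtain ⟨a, b, c, d, h, rfl⟩ := mem_flipQuads.1 hQ
      have hdb : 0 < orient c d b := by rw [orient_rotate]; exact h.bcd
      rcases h.eq_of_inner_eq_empty htQ (hbasic t ht).2 h0 with rfl | rfl <;>
        rcases h.eq_of_inner_ne_empty hP hsQ (hbasic s hs).2 hs0 with rfl | rfl
      · have := hT'.eq_of_same_side ht hs (mul_pos h.abc h.abd)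
        exact (ne_of_orient_ne h.bcd.ne').2.2 this
      · rw [← tri_rotate a b c] at ht
        have := hT'.eq_of_same_side ht hs
          (mul_pos (by rw [orient_rotate]; exact h.abc) h.bcd)
        exact (ne_of_orient_ne h.abd.ne').2.1 this
      · rw [tri_rotate d a c] at ht
        rw [tri_rotate d a b] at hs
        have := hT'.eq_of_same_side ht hs
          (mul_pos (by rw [orient_rotate c d a]; exact h.cda) h.dab)
        exact (ne_of_orient_ne h.abc.ne').2.2 this.symm
      · rw [← tri_rotate a c d] at ht
        rw [← tri_rotate b c d] at hs
        have := hT'.eq_of_same_side ht hs (mul_pos h.cda hdb)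
        exact (ne_of_orient_ne h.abc.ne').1 this
    · refine Or.inr ⟨h0, ?_⟩
      obtain ⟨a, b, c, d, h, rfl, -⟩ := hquad t ht h0
      exact ⟨{a, b, c, d}, ⟨mem_flipQuads.2 ⟨a, b, c, d, h, rfl⟩, _, ht, h0, FlipQuad.abd_sub⟩,
        FlipQuad.abd_sub⟩
  · rintro ⟨⟨htP, ht3⟩, ⟨h0, hF⟩ | ⟨h0, Q, ⟨hQ, s, hs, hs0, hsQ⟩, htQ⟩⟩
    · -- The centroid of `t` is covered by a triangle `s` of `T`. If `s` were not empty, then `t`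
      -- would be one of the empty halves of the quadrilateral of `s`, which has been flipped.
      have hmem : t ∈ emptyTriangles P := mem_emptyTriangles.2 ⟨⟨htP, ht3⟩, h0⟩
      obtain ⟨a, b, c, rfl, -, -, -, ho⟩ := hP.exists_ccw htP ht3
      have hsum : (1 / 3 : ℝ) + 1 / 3 + 1 / 3 = 1 := by norm_num
      set x : Plane := (1 / 3 : ℝ) • a + (1 / 3 : ℝ) • b + (1 / 3 : ℝ) • c with hx
      have i1 : 0 < orient a b x := by
        simp only [hx, orient_combo _ _ _ _ _ hsum, orient_self_mid, orient_self_right]; linarith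
      have i2 : 0 < orient b c x := by
        simp only [hx, orient_combo _ _ _ _ _ hsum, orient_self_mid, orient_self_right,
          orient_rotate]; linarith
      have i3 : 0 < orient c a x := by
        simp only [hx, orient_combo _ _ _ _ _ hsum, orient_self_mid, orient_self_right,
          orient_rotate]; linarith
      have huniq : ∀ s ∈ emptyTriangles P, x ∈ convexHull ℝ (s : Set Plane) → s = {a, b, c} :=
        fun s hs hxs => hP.emptyTriangle_eq hmem hs i1 i2 i3 ho hxs
      have hxt : x ∈ convexHull ℝ (({a, b, c} : Finset Plane) : Set Plane) := by
        simpa using (mem_triangle_iff_orient ho).2 ⟨i1.le, i2.le, i3.le⟩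
      have hxP : x ∈ ⋃ s ∈ T, convexHull ℝ ((s : Finset Plane) : Set Plane) := by
        rw [hT'.cover]; exact convexHull_mono (by exact_mod_cast htP) hxt
      obtain ⟨s, hs, hxs⟩ := Set.mem_iUnion₂.1 hxP
      by_cases hs0 : inner P s = ∅
      · have := huniq s (mem_emptyTriangles.2 ⟨hbasic s hs, hs0⟩) hxs
        exact this ▸ hs
      · exfalso
        obtain ⟨a', b', c', d', h, rfl, -⟩ := hquad s hs hs0
        have hQ : {a', b', c', d'} ∈ flipQuads P := mem_flipQuads.2 ⟨_, _, _, _, h, rfl⟩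
        refine hF {a', b', c', d'} ⟨hQ, _, hs, hs0, FlipQuad.abd_sub⟩ ?_
        rcases half_quad_subset h.abc h.bcd h.cda h.dab hxs with hx' | hx'
        · rw [← huniq _ (h.abc_mem hP) hx']; exact FlipQuad.abc_sub
        · rw [← huniq _ (h.acd_mem hP) hx']; exact FlipQuad.acd_sub
    · obtain ⟨a, b, c, d, h, rfl, h'⟩ := hquad s hs hs0
      have e : Q = {a, b, c, d} := by
        rw [eq_union_of_mem_flipQuads hP hQ hsQ (hbasic _ hs).2 hs0, h.inner_abd_eq]
        ext; simp; tauto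
      rw [e] at htQ
      rcases h.eq_of_inner_ne_empty hP htQ ht3 h0 with rfl | rfl
      · exact hs
      · exact h'

/-- The first-order Delaunay triangulations correspond to the sets of flippable quadrilaterals. -/
theorem GeneralPosition.encard_orderDelaunay_one (hP : GeneralPosition P) (hn : 3 ≤ P.card) :
    (orderDelaunay 1 P).encard = 2 ^ (flipQuads P).card := by
  have himage : orderDelaunay 1 P = flipped P '' ((flipQuads P).powerset : Set _) := by
    ext T
    constructor
    · intro hT
      exact ⟨_, Finset.mem_coe.2 (Finset.mem_powerset.2 (Finset.filter_subset _ _)),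
        (hP.eq_flipped hT).symm⟩
    · rintro ⟨F, hF, rfl⟩
      exact hP.isOrderDelaunay_flipped hn (by simpa using hF)
  have hsub : ∀ F ∈ (flipQuads P).powerset, ∀ F' ∈ (flipQuads P).powerset,
      flipped P F = flipped P F' → F ⊆ F' := by
    intro F hF F' hF' he Q hQ
    have hQ' := Finset.mem_powerset.1 hF hQ
    obtain ⟨a, b, c, d, h, hQe⟩ := mem_flipQuads.1 hQ'
    have h0 : inner P {a, b, d} ≠ ∅ := by simp [h.inner_abd_eq]
    have hsubQ : ({a, b, d} : Finset Plane) ⊆ Q := hQe ▸ FlipQuad.abd_sub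
    have hm : {a, b, d} ∈ flipped P F := mem_flipped.2 ⟨h.abd_subset, Or.inr ⟨h0, Q, hQ, hsubQ⟩⟩
    rw [he] at hm
    obtain ⟨-, h1 | ⟨-, Q', hQF, hs⟩⟩ := mem_flipped.1 hm
    · exact absurd h1.1 h0
    · have e1 := eq_union_of_mem_flipQuads hP hQ' hsubQ h.abd_subset.2 h0
      have e2 := eq_union_of_mem_flipQuads hP (Finset.mem_powerset.1 hF' hQF) hs h.abd_subset.2 h0
      rw [e1, ← e2]; exact hQF
  have hinj : Set.InjOn (flipped P) ((flipQuads P).powerset : Set _) := fun F hF F' hF' he =>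
    Finset.Subset.antisymm (hsub F hF F' hF' he) (hsub F' hF' F hF he.symm)
  rw [himage, hinj.encard_image, Set.encard_coe_eq_coe_finsetCard, Finset.card_powerset]
  norm_cast

end

/-! ### The number of flippable quadrilaterals -/

section

variable {P t : Finset Plane} {a b c x p q a' c' : Plane}
/-- The sign `1` or `-1`. -/
def sgn (β : Bool) : ℝ := if β then 1 else -1

theorem exists_sgn_mul_pos {r : ℝ} (h : r ≠ 0) : ∃ β, 0 < sgn β * r := by
  rcases lt_or_gt_of_ne h with h | h
  · exact ⟨false, by simp [sgn, h]⟩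
  · exact ⟨true, by simpa [sgn] using h⟩

/-- Two empty triangles of the same orientation `β` that overlap coincide. -/
theorem GeneralPosition.emptyTriangle_eq_of_sgn (hP : GeneralPosition P) {β : Bool}
    (hs : {a, b, c} ∈ emptyTriangles P) (ht : {a', b, c'} ∈ emptyTriangles P)
    (ho : 0 < sgn β * orient a b c) (ho' : 0 < sgn β * orient a' b c')
    (h1 : 0 < sgn β * orient a b x) (h2 : 0 < sgn β * orient b c x)
    (h3 : 0 < sgn β * orient c a x) (h1' : 0 < sgn β * orient a' b x)
    (h2' : 0 < sgn β * orient b c' x) (h3' : 0 < sgn β * orient c' a' x) :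
    ({a', b, c'} : Finset Plane) = {a, b, c} := by
  cases β
  · simp only [sgn, Bool.false_eq_true, if_false, neg_mul, one_mul] at *
    rw [← tri_swap a' b c', ← tri_swap a b c]
    rw [← tri_swap a b c] at hs
    rw [← tri_swap a' b c'] at ht
    have ho1 : 0 < orient b a' c' := by rw [orient_swap]; linarith
    refine hP.emptyTriangle_eq hs ht (x := x) (by rw [orient_swap]; linarith)
      (by rw [orient_swap]; linarith) (by rw [orient_swap]; linarith)
      (by rw [orient_swap]; linarith) ?_
    simpa using (mem_triangle_iff_orient ho1).2 ⟨by rw [orient_swap]; linarith,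
      by rw [orient_swap]; linarith, by rw [orient_swap]; linarith⟩
  · simp only [sgn, if_true, one_mul] at *
    refine hP.emptyTriangle_eq hs ht (x := x) h1 h2 h3 ho ?_
    simpa using (mem_triangle_iff_orient ho').2 ⟨h1'.le, h2'.le, h3'.le⟩

/-- The linear functional `x 0 + r * x 1`. -/
def tilt (r : ℝ) (x : Plane) : ℝ := x 0 + r * x 1

theorem exists_tilt_injOn (P : Finset Plane) :
    ∃ r : ℝ, ∀ p ∈ P, ∀ q ∈ P, tilt r p = tilt r q → p = q := by
  obtain ⟨r, hr⟩ := Infinite.exists_notMem_finset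
    ((P ×ˢ P).image fun pq => -(pq.1 0 - pq.2 0) / (pq.1 1 - pq.2 1))
  refine ⟨r, fun p hp q hq h => ?_⟩
  unfold tilt at h
  by_cases h1 : p 1 = q 1
  · rw [h1] at h
    exact plane_ext (by linarith) h1
  · refine absurd (Finset.mem_image.2 ⟨(p, q), Finset.mem_product.2 ⟨hp, hq⟩, ?_⟩) hr
    have : p 1 - q 1 ≠ 0 := sub_ne_zero.2 h1
    simp only
    field_simp
    linarith

/-- Sort the vertices of a triangle by a functional: the two triangles with the same middle vertex
`m` whose long edges pass `m` on the same side overlap near `m`, so they coincide if they are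
empty. -/
theorem GeneralPosition.eq_of_middle_eq (hP : GeneralPosition P) {β : Bool} {r : ℝ}
    (hs : {a, b, c} ∈ emptyTriangles P) (ht : {a', b, c'} ∈ emptyTriangles P)
    (hab : tilt r a < tilt r b) (hbc : tilt r b < tilt r c)
    (hab' : tilt r a' < tilt r b) (hbc' : tilt r b < tilt r c')
    (ho : 0 < sgn β * orient a b c) (ho' : 0 < sgn β * orient a' b c') :
    ({a', b, c'} : Finset Plane) = {a, b, c} := by
  have hβ : sgn β * sgn β = 1 := by cases β <;> simp [sgn]
  obtain ⟨τ, hτ, h1, h2⟩ : ∃ τ : ℝ, 0 < τ ∧ τ * (tilt r c - tilt r a) < sgn β * orient a b c ∧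
      τ * (tilt r c' - tilt r a') < sgn β * orient a' b c' := by
    refine ⟨min (sgn β * orient a b c / (tilt r c - tilt r a))
      (sgn β * orient a' b c' / (tilt r c' - tilt r a')) / 2, ?_, ?_, ?_⟩
    · have := div_pos ho (by linarith : 0 < tilt r c - tilt r a)
      have := div_pos ho' (by linarith : 0 < tilt r c' - tilt r a')
      positivity
    · rw [← lt_div_iff₀ (by linarith)]
      have := div_pos ho (by linarith : 0 < tilt r c - tilt r a)
      have := div_pos ho' (by linarith : 0 < tilt r c' - tilt r a')
      exact (half_lt_self (by positivity)).trans_le (min_le_left _ _)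
    · rw [← lt_div_iff₀ (by linarith)]
      have := div_pos ho (by linarith : 0 < tilt r c - tilt r a)
      have := div_pos ho' (by linarith : 0 < tilt r c' - tilt r a')
      exact (half_lt_self (by positivity)).trans_le (min_le_right _ _)
  -- move from `b` along the kernel of the functional, towards the long edge
  set x : Plane := !₂[b 0 - sgn β * τ * r, b 1 + sgn β * τ] with hx
  have x0 : x 0 = b 0 - sgn β * τ * r := by simp [hx]
  have x1 : x 1 = b 1 + sgn β * τ := by simp [hx]
  have e1 : ∀ v : Plane, sgn β * orient v b x = τ * (tilt r b - tilt r v) := by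
    intro v
    simp only [orient, tilt, x0, x1]
    linear_combination (τ * (b 0 + r * b 1 - v 0 - r * v 1)) * hβ
  have e2 : ∀ v : Plane, sgn β * orient b v x = τ * (tilt r v - tilt r b) := by
    intro v
    rw [orient_swap, mul_neg, e1]; ring
  have e3 : ∀ v w : Plane, sgn β * orient w v x =
      sgn β * orient v b w - τ * (tilt r w - tilt r v) := by
    intro v w
    simp only [orient, tilt, x0, x1]
    linear_combination (-τ * (w 0 + r * w 1 - v 0 - r * v 1)) * hβ
  refine hP.emptyTriangle_eq_of_sgn hs ht ho ho' (x := x) ?_ ?_ ?_ ?_ ?_ ?_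
  · rw [e1]; exact mul_pos hτ (by linarith)
  · rw [e2]; exact mul_pos hτ (by linarith)
  · rw [e3]; linarith
  · rw [e1]; exact mul_pos hτ (by linarith)
  · rw [e2]; exact mul_pos hτ (by linarith)
  · rw [e3]; linarith

theorem exists_sorted {r : ℝ} (hr : ∀ p ∈ P, ∀ q ∈ P, tilt r p = tilt r q → p = q) (ht : t ⊆ P)
    (h3 : t.card = 3) : ∃ a b c, t = {a, b, c} ∧ tilt r a < tilt r b ∧ tilt r b < tilt r c := by
  obtain ⟨a, b, c, hab, hac, hbc, rfl⟩ := Finset.card_eq_three.1 h3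
  have ha : a ∈ P := ht (by simp)
  have hb : b ∈ P := ht (by simp)
  have hc : c ∈ P := ht (by simp)
  rcases lt_or_gt_of_ne fun h => hab (hr a ha b hb h) with h1 | h1 <;>
  rcases lt_or_gt_of_ne fun h => hac (hr a ha c hc h) with h2 | h2 <;>
  rcases lt_or_gt_of_ne fun h => hbc (hr b hb c hc h) with h3 | h3
  · exact ⟨a, b, c, rfl, h1, h3⟩
  · exact ⟨a, c, b, by ext; simp; tauto, h2, h3⟩
  · exact ⟨c, a, b, by ext; simp; tauto, by linarith, by linarith⟩
  · exact ⟨c, a, b, by ext; simp; tauto, by linarith, by linarith⟩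
  · exact ⟨b, a, c, by ext; simp; tauto, by linarith, by linarith⟩
  · exact ⟨b, a, c, by ext; simp; tauto, by linarith, by linarith⟩
  · exact ⟨b, c, a, by ext; simp; tauto, by linarith, by linarith⟩
  · exact ⟨c, b, a, by ext; simp; tauto, by linarith, by linarith⟩

/-- There are at most `2 n - 5` empty triangles. Each is determined by its middle vertex in a
generic direction and by the side on which its long edge passes that vertex. The first and the last
point are never in the middle, and no edge passes beyond a point at maximal distance from the line
through the first and the last point. -/
theorem GeneralPosition.card_emptyTriangles_le (hP : GeneralPosition P) (hn : 3 ≤ P.card) :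
    (emptyTriangles P).card + 5 ≤ 2 * P.card := by
  obtain ⟨r, hr⟩ := exists_tilt_injOn P
  have hne : P.Nonempty := Finset.card_pos.1 (by omega)
  obtain ⟨u, hu, humin⟩ := Finset.exists_min_image P (tilt r) hne
  obtain ⟨w, hw, hwmax⟩ := Finset.exists_max_image P (tilt r) hne
  have huw : u ≠ w := by
    rintro rfl
    have : P.card ≤ 1 := Finset.card_le_one.2 fun p hp q hq => hr p hp q hq
      (le_antisymm ((hwmax p hp).trans (humin q hq)) ((hwmax q hq).trans (humin p hp)))
    omega
  have hφ : tilt r u < tilt r w := lt_of_le_of_ne (humin w hw) fun h => huw (hr u hu w hw h)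
  have hcard : ((P.erase u).erase w).card = P.card - 2 := by
    rw [Finset.card_erase_of_mem (Finset.mem_erase.2 ⟨huw.symm, hw⟩), Finset.card_erase_of_mem hu]
    omega
  obtain ⟨z, hz, hzmax⟩ := Finset.exists_max_image ((P.erase u).erase w)
    (fun v => |orient u w v|) (Finset.card_pos.1 (by omega))
  have hzw : z ≠ w := (Finset.mem_erase.1 hz).1
  have hzu : z ≠ u := (Finset.mem_erase.1 (Finset.mem_erase.1 hz).2).1
  have hzP : z ∈ P := (Finset.mem_erase.1 (Finset.mem_erase.1 hz).2).2
  obtain ⟨β₀, hβ₀⟩ := exists_sgn_mul_pos (hP.orient_ne hu hw hzP huw hzu.symm hzw.symm)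
  have habs : ∀ y : ℝ, sgn β₀ * y ≤ |y| := by
    intro y
    cases β₀
    · simpa [sgn] using neg_le_abs y
    · simpa [sgn] using le_abs_self y
  have hzabs : |orient u w z| = sgn β₀ * orient u w z := by
    rw [← abs_of_pos hβ₀, abs_mul]
    cases β₀ <;> simp [sgn]
  have hgmax : ∀ v ∈ P, sgn β₀ * orient u w v ≤ sgn β₀ * orient u w z := by
    intro v hv
    by_cases h1 : v = u
    · subst h1; rw [orient_self_mid]; linarith
    by_cases h2 : v = w
    · subst h2; rw [orient_self_right]; linarith
    · rw [← hzabs]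
      exact (habs _).trans (hzmax v (Finset.mem_erase.2 ⟨h2, Finset.mem_erase.2 ⟨h1, hv⟩⟩))
  have hsort : ∀ t ∈ emptyTriangles P, ∃ a b c, ∃ β : Bool, t = {a, b, c} ∧
      (a ∈ P ∧ b ∈ P ∧ c ∈ P) ∧ tilt r a < tilt r b ∧ tilt r b < tilt r c ∧
      0 < sgn β * orient a b c := by
    intro t ht
    obtain ⟨⟨htP, ht3⟩, -⟩ := mem_emptyTriangles.1 ht
    obtain ⟨a, b, c, rfl, hab, hbc⟩ := exists_sorted hr htP ht3
    have ha : a ∈ P := htP (by simp)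
    have hb : b ∈ P := htP (by simp)
    have hc : c ∈ P := htP (by simp)
    obtain ⟨β, hβ⟩ := exists_sgn_mul_pos (hP.orient_ne ha hb hc (fun h => hab.ne (h ▸ rfl))
      (fun h => (hab.trans hbc).ne (h ▸ rfl)) (fun h => hbc.ne (h ▸ rfl)))
    exact ⟨a, b, c, β, rfl, ⟨ha, hb, hc⟩, hab, hbc, hβ⟩
  choose! lo mid hi β heq hmem hlo hhi hor using hsort
  have hmaps : ∀ t ∈ emptyTriangles P, (mid t, β t) ∈
      ((((P.erase u).erase w) ×ˢ (Finset.univ : Finset Bool)).erase (z, β₀)) := by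
    intro t ht
    refine Finset.mem_erase.2 ⟨fun h => ?_, Finset.mem_product.2 ⟨Finset.mem_erase.2 ⟨fun h => ?_,
      Finset.mem_erase.2 ⟨fun h => ?_, (hmem t ht).2.1⟩⟩, Finset.mem_univ _⟩⟩
    · obtain ⟨h1, h2⟩ := Prod.mk.inj h
      have l1 := hlo t ht
      have l2 := hhi t ht
      have o := hor t ht
      rw [h1] at l1 l2 o
      rw [h2] at o
      have g1 := hgmax _ (hmem t ht).1
      have g2 := hgmax _ (hmem t ht).2.2
      -- the height over `uw` on the long edge at the position of `z` exceeds that of `z`, but it is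
      -- a weighted mean of the heights of the ends of the edge
      have key : (tilt r (hi t) - tilt r z) * (sgn β₀ * orient u w (lo t))
          + (tilt r z - tilt r (lo t)) * (sgn β₀ * orient u w (hi t))
          - (tilt r (hi t) - tilt r (lo t)) * (sgn β₀ * orient u w z)
          = sgn β₀ * orient (lo t) z (hi t) * (tilt r w - tilt r u) := by
        unfold tilt orient; ring
      have k1 := mul_le_mul_of_nonneg_left g1 (by linarith : 0 ≤ tilt r (hi t) - tilt r z)
      have k2 := mul_le_mul_of_nonneg_left g2 (by linarith : 0 ≤ tilt r z - tilt r (lo t))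
      have k3 := mul_pos o (sub_pos.2 hφ)
      nlinarith
    · have := hhi t ht
      rw [show mid t = w from h] at this
      exact absurd (hwmax _ (hmem t ht).2.2) (not_le.2 this)
    · have := hlo t ht
      rw [show mid t = u from h] at this
      exact absurd (humin _ (hmem t ht).1) (not_le.2 this)
  have hinj : Set.InjOn (fun t => (mid t, β t)) (emptyTriangles P : Set (Finset Plane)) := by
    intro s hs t ht h
    obtain ⟨h1, h2⟩ := Prod.mk.inj h
    have hs' := Finset.mem_coe.1 hs
    have ht' := Finset.mem_coe.1 ht
    have l1 := hlo t ht'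
    have l2 := hhi t ht'
    have o := hor t ht'
    have e := heq t ht'
    have m := ht'
    rw [← h1] at l1 l2 o e
    rw [← h2] at o
    rw [e] at m
    have m' := hs'
    rw [heq s hs'] at m'
    exact (heq s hs').trans
      ((hP.eq_of_middle_eq m m' l1 l2 (hlo s hs') (hhi s hs') o (hor s hs')).trans e.symm)
  have hle := Finset.card_le_card_of_injOn _ hmaps hinj
  rw [Finset.card_erase_of_mem (Finset.mem_product.2 ⟨hz, Finset.mem_univ _⟩), Finset.card_product,
    hcard, Finset.card_univ, Fintype.card_bool] at hle
  omega

/-- Distinct flippable quadrilaterals consist of distinct pairs of empty triangles. -/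
theorem GeneralPosition.card_flipQuads_le (hP : GeneralPosition P) (hn : 3 ≤ P.card) :
    (flipQuads P).card ≤ P.card - 3 := by
  have h1 : ∑ Q ∈ flipQuads P, ((emptyTriangles P).filter (· ⊆ Q)).card ≤
      (emptyTriangles P).card := by
    rw [← Finset.card_biUnion]
    · exact Finset.card_le_card (Finset.biUnion_subset.2 fun Q _ => Finset.filter_subset _ _)
    · intro Q hQ Q' hQ' hne
      refine Finset.disjoint_left.2 fun t ht ht' => hne ?_
      obtain ⟨ht, hs⟩ := Finset.mem_filter.1 ht
      exact eq_of_mem_flipQuads hP hQ hQ' ht hs (Finset.mem_filter.1 ht').2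
  have h2 : ∀ Q ∈ flipQuads P, 2 ≤ ((emptyTriangles P).filter (· ⊆ Q)).card := by
    intro Q hQ
    obtain ⟨a, b, c, d, h, rfl⟩ := mem_flipQuads.1 hQ
    refine Finset.one_lt_card.2 ⟨{a, b, c}, Finset.mem_filter.2 ⟨h.abc_mem hP, FlipQuad.abc_sub⟩,
      {a, c, d}, Finset.mem_filter.2 ⟨h.acd_mem hP, FlipQuad.acd_sub⟩, fun he => ?_⟩
    have : b ∈ ({a, c, d} : Finset Plane) := by rw [← he]; simp
    simp only [Finset.mem_insert, Finset.mem_singleton] at this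
    obtain ⟨n1, n2, n3⟩ := ne_of_orient_ne h.abc.ne'
    obtain ⟨n4, n5, n6⟩ := ne_of_orient_ne h.bcd.ne'
    rcases this with h | h | h
    · exact n1 h.symm
    · exact n3 h
    · exact n5 h
  have h3 := Finset.card_nsmul_le_sum _ _ 2 h2
  have h4 := hP.card_emptyTriangles_le hn
  rw [smul_eq_mul] at h3
  omega

end

/-! ### Faces of the subdivision formed by the fixed edges -/

section

variable {P Q : Finset Plane} {T : Finset (Finset Plane)} {a b c d x y u v : Plane}
theorem GeneralPosition.emptyTriangles_mem_orderDelaunay (hP : GeneralPosition P)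
    (hn : 3 ≤ P.card) (k : ℕ) : emptyTriangles P ∈ orderDelaunay k P := by
  refine ⟨hP.isTriangulation_emptyTriangles hn, fun t ht => ?_⟩
  obtain ⟨⟨h1, h3⟩, h0⟩ := mem_emptyTriangles.1 ht
  rw [hP.isOrderTriangle_iff h1 h3, h0]
  simp

theorem IsEdge.symm (h : IsEdge T u v) : IsEdge T v u :=
  ⟨h.1.symm, let ⟨t, ht, h1, h2⟩ := h.2; ⟨t, ht, h2, h1⟩⟩

theorem IsFixedEdge.symm {k : ℕ} (h : IsFixedEdge k P u v) : IsFixedEdge k P v u :=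
  ⟨let ⟨T, hT, he⟩ := h.1; ⟨T, hT, he.symm⟩, fun T hT => (h.2 T hT).symm⟩

theorem convex_halfPlane (a b : Plane) : Convex ℝ {x | 0 ≤ orient a b x} := by
  intro x hx y hy r s hr hs hrs
  have : orient a b (r • x + s • y) = r * orient a b x + s * orient a b y := by
    have := orient_combo a b x y a (α := r) (β := s) (γ := 0) (by linarith)
    simpa using this
  simp only [Set.mem_ofPred_eq] at *
  rw [this]; positivity

/-- A point on the boundary line of a half-plane containing a set is not interior to the hull of
the set. -/
theorem notMem_interior_of_orient_eq_zero {S : Set Plane} (h : ∀ v ∈ S, 0 ≤ orient a b v)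
    (hc : 0 < orient a b c) (hx : orient a b x = 0) : x ∉ interior (convexHull ℝ S) := by
  intro hint
  have hcont : Continuous fun ε : ℝ => x + ε • (x - c) := by fun_prop
  obtain ⟨δ, hδ, hball⟩ := Metric.isOpen_iff.1 (isOpen_interior.preimage hcont) 0 (by simpa)
  have hmem : x + (δ / 2) • (x - c) ∈ convexHull ℝ S := interior_subset (hball (by
    rw [Metric.mem_ball, Real.dist_eq, sub_zero, abs_of_pos (by linarith)]; linarith))
  have h0 : 0 ≤ orient a b (x + (δ / 2) • (x - c)) :=
    convexHull_min (fun v hv => h v hv) (convex_halfPlane a b) hmem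
  have e : orient a b (x + (δ / 2) • (x - c)) =
      (1 + δ / 2) * orient a b x - δ / 2 * orient a b c := by
    simp [orient]; ring
  rw [e, hx] at h0
  nlinarith

namespace FlipQuad

/-- Each side of a convex quadrilateral lies on the boundary. -/
theorem notMem_interior_of_mem_side (h : FlipQuad P a b c d)
    (hx : x ∈ convexHull ℝ ({a, b} : Set Plane) ∨ x ∈ convexHull ℝ ({b, c} : Set Plane) ∨
      x ∈ convexHull ℝ ({c, d} : Set Plane) ∨ x ∈ convexHull ℝ ({d, a} : Set Plane)) :
    x ∉ interior (convexHull ℝ ({a, b, c, d} : Set Plane)) := by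
  have abd := h.abd
  have bca : 0 < orient b c a := by rw [orient_rotate]; exact h.abc
  have cdb : 0 < orient c d b := by rw [orient_rotate]; exact h.bcd
  have dac : 0 < orient d a c := by rw [orient_rotate c d a]; exact h.cda
  have o1 := h.abc
  have o2 := h.bcd
  have o3 := h.cda
  have o4 := h.dab
  rcases hx with hx | hx | hx | hx
  · refine notMem_interior_of_orient_eq_zero ?_ h.abc (orient_eq_zero_of_mem_segment hx)
    simp [orient_self_mid, orient_self_right, o1.le, abd.le]
  · refine notMem_interior_of_orient_eq_zero ?_ h.bcd (orient_eq_zero_of_mem_segment hx)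
    simp [orient_self_mid, orient_self_right, o2.le, bca.le]
  · refine notMem_interior_of_orient_eq_zero ?_ h.cda (orient_eq_zero_of_mem_segment hx)
    simp [orient_self_mid, orient_self_right, o3.le, cdb.le]
  · refine notMem_interior_of_orient_eq_zero ?_ h.dab (orient_eq_zero_of_mem_segment hx)
    simp [orient_self_mid, orient_self_right, o4.le, dac.le]

theorem mem_halves (h : FlipQuad P a b c d)
    (hx : x ∈ convexHull ℝ ({a, b, c, d} : Set Plane)) :
    x ∈ convexHull ℝ (({a, b, c} : Finset Plane) : Set Plane) ∨
      x ∈ convexHull ℝ (({a, c, d} : Finset Plane) : Set Plane) := by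
  have abd := h.abd
  have bca : 0 < orient b c a := by rw [orient_rotate]; exact h.abc
  have cdb : 0 < orient c d b := by rw [orient_rotate]; exact h.bcd
  have dac : 0 < orient d a c := by rw [orient_rotate c d a]; exact h.cda
  have o1 := h.abc
  have o2 := h.bcd
  have o3 := h.cda
  have o4 := h.dab
  have half : ∀ u v : Plane, (∀ w ∈ ({a, b, c, d} : Set Plane), 0 ≤ orient u v w) →
      0 ≤ orient u v x := fun u v huv =>
    convexHull_min (fun w hw => huv w hw) (convex_halfPlane u v) hx
  have i1 : 0 ≤ orient a b x := half a b (by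
    simp [orient_self_mid, orient_self_right, o1.le, abd.le])
  have i2 : 0 ≤ orient b c x := half b c (by
    simp [orient_self_mid, orient_self_right, o2.le, bca.le])
  have i3 : 0 ≤ orient c d x := half c d (by
    simp [orient_self_mid, orient_self_right, o3.le, cdb.le])
  have i4 : 0 ≤ orient d a x := half d a (by
    simp [orient_self_mid, orient_self_right, o4.le, dac.le])
  simp only [Finset.coe_insert, Finset.coe_singleton]
  rw [mem_triangle_iff_orient h.abc, mem_triangle_iff_orient h.acd]
  rcases le_total 0 (orient c a x) with h' | h'
  · exact Or.inl ⟨i1, i2, h'⟩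
  · refine Or.inr ⟨?_, i3, i4⟩
    rw [orient_swap] at h'
    linarith

/-- Every first-order Delaunay triangulation contains one of the two pairs of halves. -/
theorem halves_mem (hP : GeneralPosition P) (h : FlipQuad P a b c d)
    (hT : T ∈ orderDelaunay 1 P) :
    ({a, b, c} ∈ T ∧ {a, c, d} ∈ T) ∨ ({a, b, d} ∈ T ∧ {b, c, d} ∈ T) := by
  have hQ : {a, b, c, d} ∈ flipQuads P := mem_flipQuads.2 ⟨a, b, c, d, h, rfl⟩
  rw [hP.eq_flipped hT]
  set F := (flipQuads P).filter fun Q => ∃ t ∈ T, inner P t ≠ ∅ ∧ t ⊆ Q with hF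
  have hFs : F ⊆ flipQuads P := Finset.filter_subset _ _
  by_cases hm : {a, b, c, d} ∈ F
  · exact Or.inr ⟨mem_flipped.2 ⟨h.abd_subset, Or.inr ⟨by simp [h.inner_abd_eq], _, hm, abd_sub⟩⟩,
      mem_flipped.2 ⟨h.bcd_subset, Or.inr ⟨by simp [h.inner_bcd_eq], _, hm, bcd_sub⟩⟩⟩
  · exact Or.inl ⟨h.mem_flipped_of_notMem hP hFs hm (h.abc_mem hP) abc_sub,
      h.mem_flipped_of_notMem hP hFs hm (h.acd_mem hP) acd_sub⟩

/-- The sides `ab` and `bc` are fixed; by `rotate`, so are the other two. -/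
theorem isFixedEdge_ab_bc (hP : GeneralPosition P) (hn : 3 ≤ P.card) (h : FlipQuad P a b c d) :
    IsFixedEdge 1 P a b ∧ IsFixedEdge 1 P b c := by
  obtain ⟨hab, hac, hbc⟩ := ne_of_orient_ne h.abc.ne'
  have h0 := hP.emptyTriangles_mem_orderDelaunay hn 0
  refine ⟨⟨⟨_, h0, hab, _, h.abc_mem hP, by simp, by simp⟩, fun T hT => ?_⟩,
    ⟨⟨_, h0, hbc, _, h.abc_mem hP, by simp, by simp⟩, fun T hT => ?_⟩⟩
  · rcases h.halves_mem hP hT with h' | h'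
    · exact ⟨hab, _, h'.1, by simp, by simp⟩
    · exact ⟨hab, _, h'.1, by simp, by simp⟩
  · rcases h.halves_mem hP hT with h' | h'
    · exact ⟨hbc, _, h'.1, by simp, by simp⟩
    · exact ⟨hbc, _, h'.2, by simp, by simp⟩

theorem flipped_singleton (hP : GeneralPosition P) (hn : 3 ≤ P.card) (h : FlipQuad P a b c d) :
    flipped P {{a, b, c, d}} ∈ orderDelaunay 1 P ∧ {a, b, d} ∈ flipped P {{a, b, c, d}} ∧
      {b, c, d} ∈ flipped P {{a, b, c, d}} := by
  refine ⟨hP.isOrderDelaunay_flipped hn (by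
      simpa using mem_flipQuads.2 ⟨a, b, c, d, h, rfl⟩),
    mem_flipped.2 ⟨h.abd_subset, Or.inr ⟨by simp [h.inner_abd_eq],
      {a, b, c, d}, Finset.mem_singleton_self _, abd_sub⟩⟩,
    mem_flipped.2 ⟨h.bcd_subset, Or.inr ⟨by simp [h.inner_bcd_eq],
      {a, b, c, d}, Finset.mem_singleton_self _, bcd_sub⟩⟩⟩

/-- No fixed edge meets the interior of a flippable quadrilateral: such an edge would belong both to
the Delaunay triangulation and to the triangulation obtained by flipping the quadrilateral. -/
theorem disjoint_fixedEdge (hP : GeneralPosition P) (hn : 3 ≤ P.card) (h : FlipQuad P a b c d)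
    (huv : IsFixedEdge 1 P u v) :
    Disjoint (segment ℝ u v) (interior (convexHull ℝ ({a, b, c, d} : Set Plane))) := by
  rw [Set.disjoint_left]
  intro x hx hint
  obtain ⟨hab, hac, hbc⟩ := ne_of_orient_ne h.abc.ne'
  obtain ⟨-, hbd, hcd⟩ := ne_of_orient_ne h.bcd.ne'
  obtain ⟨hda, -, -⟩ := ne_of_orient_ne h.dab.ne'
  obtain ⟨hF1, hF2, hF3⟩ := h.flipped_singleton hP hn
  have hD := hP.emptyTriangles_mem_orderDelaunay hn 1
  obtain ⟨-, s₀, hs₀, hu₀, hv₀⟩ := huv.2 _ hD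
  obtain ⟨-, s₁, hs₁, hu₁, hv₁⟩ := huv.2 _ hF1
  have hxA : x ∈ convexHull ℝ (({u, v} : Finset Plane) : Set Plane) := by
    rwa [Finset.coe_insert, Finset.coe_singleton, convexHull_pair]
  have sub₀ : ({u, v} : Finset Plane) ⊆ s₀ := by simp [Finset.insert_subset_iff, hu₀, hv₀]
  have sub₁ : ({u, v} : Finset Plane) ⊆ s₁ := by simp [Finset.insert_subset_iff, hu₁, hv₁]
  have key : ∀ t₀ ∈ emptyTriangles P, ∀ t₁ ∈ flipped P {{a, b, c, d}},
      x ∈ convexHull ℝ (t₀ : Set Plane) → x ∈ convexHull ℝ (t₁ : Set Plane) →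
      ∀ S : Set Plane, (∀ w, w ∈ t₀ → w ∈ t₁ → w ∈ S) → x ∈ convexHull ℝ S := by
    intro t₀ ht₀ t₁ ht₁ hx₀ hx₁ S hS
    have m₀ := hD.isTriangulation.face hs₀ ht₀ sub₀ subset_rfl hxA hx₀
    have m₁ := hF1.isTriangulation.face hs₁ ht₁ sub₁ subset_rfl hxA hx₁
    have m : x ∈ convexHull ℝ
        ((({u, v} ∩ t₀) ∩ ({u, v} ∩ t₁) : Finset Plane) : Set Plane) := by
      rw [← convexHull_inter_of_subset (hD.isTriangulation.affineIndependent _ hs₀)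
        (Finset.inter_subset_left.trans sub₀) (Finset.inter_subset_left.trans sub₀)]
      exact ⟨m₀, m₁⟩
    refine convexHull_mono (fun w hw => ?_) m
    simp only [Finset.coe_inter, Set.mem_inter_iff, Finset.mem_coe] at hw
    exact hS w hw.1.2 hw.2.2
  refine h.notMem_interior_of_mem_side ?_ hint
  rcases h.mem_halves (interior_subset hint) with i₀ | i₀
  · rcases half_quad_subset h.bcd h.cda h.dab h.abc (by rwa [tri_rotate a b c]) with i₁ | i₁
    · refine Or.inr (Or.inl (key _ (h.abc_mem hP) _ hF3 i₀ i₁ _ fun w hw hw' => ?_))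
      simp only [Finset.mem_insert, Finset.mem_singleton, Set.mem_insert_iff,
        Set.mem_singleton_iff] at hw hw' ⊢
      rcases hw with rfl | hw
      · rcases hw' with h' | h' | h'
        · exact absurd h' hab
        · exact absurd h' hac
        · exact absurd h'.symm hda
      · exact hw
    · rw [tri_rotate a b d] at i₁
      refine Or.inl (key _ (h.abc_mem hP) _ hF2 i₀ i₁ _ fun w hw hw' => ?_)
      simp only [Finset.mem_insert, Finset.mem_singleton, Set.mem_insert_iff,
        Set.mem_singleton_iff] at hw hw' ⊢
      rcases hw with hw | hw | rfl
      · exact Or.inl hw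
      · exact Or.inr hw
      · rcases hw' with h' | h' | h'
        · exact absurd h'.symm hac
        · exact absurd h'.symm hbc
        · exact absurd h' hcd
  · rcases half_quad_subset h.dab h.abc h.bcd h.cda (by rwa [← tri_rotate d a c]) with i₁ | i₁
    · rw [← tri_rotate d a b] at i₁
      refine Or.inr (Or.inr (Or.inr (key _ (h.acd_mem hP) _ hF2 i₀ i₁ _ fun w hw hw' => ?_)))
      simp only [Finset.mem_insert, Finset.mem_singleton, Set.mem_insert_iff,
        Set.mem_singleton_iff] at hw hw' ⊢
      rcases hw with hw | rfl | hw
      · exact Or.inr hw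
      · rcases hw' with h' | h' | h'
        · exact absurd h'.symm hac
        · exact absurd h'.symm hbc
        · exact absurd h' hcd
      · exact Or.inl hw
    · rw [← tri_rotate d b c] at i₁
      refine Or.inr (Or.inr (Or.inl (key _ (h.acd_mem hP) _ hF3 i₀ i₁ _ fun w hw hw' => ?_)))
      simp only [Finset.mem_insert, Finset.mem_singleton, Set.mem_insert_iff,
        Set.mem_singleton_iff] at hw hw' ⊢
      rcases hw with rfl | hw
      · rcases hw' with h' | h' | h'
        · exact absurd h' hab
        · exact absurd h' hac
        · exact absurd h'.symm hda
      · exact hw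

theorem diagonals_cross (h : FlipQuad P a b c d) :
    (openSegment ℝ a c ∩ openSegment ℝ b d).Nonempty := by
  have o1 := h.abc
  have o2 := h.bcd
  have o3 := h.acd
  have o4 := h.abd
  have e : orient b c d + orient a b d = orient a c d + orient a b c := by unfold orient; ring
  refine ⟨(orient b c d / (orient b c d + orient a b d)) • a
    + (orient a b d / (orient b c d + orient a b d)) • c,
    ⟨_, _, by positivity, by positivity, by field_simp, rfl⟩,
    ⟨orient a c d / (orient b c d + orient a b d), orient a b c / (orient b c d + orient a b d),
      by positivity, by positivity, by rw [← add_div, ← e]; field_simp, ?_⟩⟩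
  apply plane_ext
  · simp; field_simp; unfold orient; ring
  · simp; field_simp; unfold orient; ring

theorem isFlippableQuadrilateral (hP : GeneralPosition P) (hn : 3 ≤ P.card)
    (h : FlipQuad P a b c d) : IsFlippableQuadrilateral P {a, b, c, d} := by
  have hcoe : (({a, b, c, d} : Finset Plane) : Set Plane) = {a, b, c, d} := by simp
  have f1 := h.isFixedEdge_ab_bc hP hn
  have f2 := h.rotate.isFixedEdge_ab_bc hP hn
  obtain ⟨hab, hac, hbc⟩ := ne_of_orient_ne h.abc.ne'
  obtain ⟨-, hbd, hcd⟩ := ne_of_orient_ne h.bcd.ne'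
  obtain ⟨hF1, hF2, hF3⟩ := h.flipped_singleton hP hn
  refine ⟨a, b, c, d, hcoe, h.diagonals_cross, ⟨f1.1, f1.2, f2.1, f2.2⟩, ?_, ?_,
    ⟨_, hP.emptyTriangles_mem_orderDelaunay hn 1, hac, _, h.abc_mem hP, by simp, by simp⟩,
    ⟨_, hF1, hbd, _, hF2, by simp, by simp⟩⟩
  · intro p hp hint
    rw [hcoe] at hint
    have side : ∀ {u v : Plane}, u ∈ convexHull ℝ ({u, v} : Set Plane) := fun {u v} =>
      subset_convexHull ℝ _ (by simp)
    have : p = a ∨ p = b ∨ p = c ∨ p = d := by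
      rcases h.mem_halves (interior_subset hint) with i | i
      · have := hP.mem_of_mem_emptyTriangle (h.abc_mem hP) hp i
        simp at this; tauto
      · have := hP.mem_of_mem_emptyTriangle (h.acd_mem hP) hp i
        simp at this; tauto
    refine h.notMem_interior_of_mem_side ?_ hint
    rcases this with rfl | rfl | rfl | rfl
    · exact Or.inl side
    · exact Or.inr (Or.inl side)
    · exact Or.inr (Or.inr (Or.inl side))
    · exact Or.inr (Or.inr (Or.inr side))
  · intro u v huv
    rw [hcoe]
    exact h.disjoint_fixedEdge hP hn huv

end FlipQuad

/-- If the ray `ay` runs strictly inside the angle `cab`, the segment `ay` enters the interior of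
the triangle `acb`. -/
theorem exists_mem_segment_interior {α β : ℝ} (hα : 0 < α) (hβ : 0 < β)
    (hD : orient a c b ≠ 0) (hy : y = a + α • (c - a) + β • (b - a)) :
    ∃ x ∈ segment ℝ a y, x ∈ interior (convexHull ℝ ({a, c, b} : Set Plane)) := by
  have key : ∀ {c b : Plane} {α β : ℝ}, 0 < α → 0 < β → 0 < orient a c b →
      y = a + α • (c - a) + β • (b - a) →
      ∃ x ∈ segment ℝ a y, x ∈ interior (convexHull ℝ ({a, c, b} : Set Plane)) := by
    intro c b α β hα hβ hD hy
    refine ⟨a + (1 / (1 + α + β)) • (y - a), ⟨(α + β) / (1 + α + β), 1 / (1 + α + β),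
      by positivity, by positivity, by field_simp; ring, ?_⟩, ?_⟩
    · have : (α + β) / (1 + α + β) = 1 - 1 / (1 + α + β) := by field_simp; ring
      rw [this]; module
    · have e : ∀ u v : Plane, orient u v (a + (1 / (1 + α + β)) • (y - a)) =
          (orient u v a + α * orient u v c + β * orient u v b) / (1 + α + β) := by
        intro u v
        rw [hy, eq_div_iff (by positivity)]
        simp [orient]; field_simp; ring
      refine mem_interior_triangle hD ?_ ?_ ?_
      · rw [e, orient_self_mid, orient_self_right]
        exact div_pos (by nlinarith [mul_pos hβ hD]) (by positivity)
      · rw [e, orient_self_mid, orient_self_right, orient_rotate]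
        exact div_pos (by nlinarith) (by positivity)
      · rw [e, orient_self_mid, orient_self_right, orient_rotate, orient_rotate]
        exact div_pos (by nlinarith [mul_pos hα hD]) (by positivity)
  rcases lt_or_gt_of_ne hD with h | h
  · rw [show ({a, c, b} : Set Plane) = {a, b, c} by ext; simp; tauto]
    exact key hβ hα (by rw [orient_swap_right]; linarith) (by rw [hy]; abel)
  · exact key hα hβ h hy

/-- Two triangles on the same side of `ac` such that neither enters the other along its side at `a`
have the same apex. -/
theorem GeneralPosition.apex_eq (hP : GeneralPosition P) (ha : a ∈ P) (hb : b ∈ P)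
    (hy : y ∈ P) (hs : 0 < orient a c b * orient a c y)
    (hI : ∀ x ∈ segment ℝ a y, x ∉ interior (convexHull ℝ ({a, c, b} : Set Plane)))
    (hJ : ∀ x ∈ segment ℝ a b, x ∉ interior (convexHull ℝ ({a, c, y} : Set Plane))) : b = y := by
  by_contra hby
  have hb0 : orient a c b ≠ 0 := by rintro h0; simp [h0] at hs
  have hy0 : orient a c y ≠ 0 := by rintro h0; simp [h0] at hs
  have hne := hP.orient_ne ha hb hy (ne_of_orient_ne hb0).2.1 (ne_of_orient_ne hy0).2.1 hby
  have eq : ∀ {b y : Plane}, orient a c b ≠ 0 → y = a + (orient b a y / orient a c b) • (c - a)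
      + (orient a c y / orient a c b) • (b - a) := by
    intro b y h
    apply plane_ext
    · simp; field_simp; unfold orient; ring
    · simp; field_simp; unfold orient; ring
  have e1 : orient y a b = -orient b a y := by unfold orient; ring
  have e2 : orient b a y ≠ 0 := by rw [orient_swap]; exact neg_ne_zero.2 hne
  have pos1 : 0 < orient a c y / orient a c b := by
    rw [show orient a c y / orient a c b = orient a c b * orient a c y / orient a c b ^ 2 by
      field_simp]
    positivity
  have pos2 : 0 < orient a c b / orient a c y := by
    rw [← inv_div]; exact inv_pos.2 pos1
  have prod : orient y a b / orient a c y = -(orient b a y / orient a c b) *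
      (orient a c b / orient a c y) := by
    rw [e1]; field_simp
  rcases lt_or_gt_of_ne (div_ne_zero e2 hb0) with h | h
  · obtain ⟨x, h1, h2⟩ := exists_mem_segment_interior (α := orient y a b / orient a c y)
      (by rw [prod]; exact mul_pos (by linarith) pos2) pos2 hy0 (eq hy0)
    exact hJ x h1 h2
  · obtain ⟨x, h1, h2⟩ := exists_mem_segment_interior h pos1 hb0 (eq hb0)
    exact hI x h1 h2

/-- A convex quadrilateral with fixed sides, not entered by fixed edges, one of whose diagonals `ac`
is useful but not a Delaunay edge, is flippable in the sense of `FlipQuad`: the diagonal `ac` occurs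
in a triangle that is not empty, hence is the second diagonal of a `FlipQuad`, and on each side of
`ac` the two quadrilaterals have the same vertex because their sides are fixed edges. -/
theorem GeneralPosition.mem_flipQuads_of_useful (hP : GeneralPosition P) (hn : 3 ≤ P.card)
    (hQ : (Q : Set Plane) = {a, b, c, d})
    (hcross : (openSegment ℝ a c ∩ openSegment ℝ b d).Nonempty)
    (hab : IsFixedEdge 1 P a b) (hda : IsFixedEdge 1 P d a) (hbd : b ≠ d)
    (hdis : ∀ u v : Plane, IsFixedEdge 1 P u v →
      Disjoint (segment ℝ u v) (interior (convexHull ℝ (Q : Set Plane))))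
    (hac : IsUsefulEdge 1 P a c) (hnot : ¬ IsEdge (emptyTriangles P) a c)
    (hbc : IsFixedEdge 1 P b c) (hcd : IsFixedEdge 1 P c d) :
    Q ∈ flipQuads P := by
  have hcoe : ∀ a b c d : Plane, (({a, b, c, d} : Finset Plane) : Set Plane) = {a, b, c, d} := by
    simp
  have perm1 : ∀ a b c d : Plane, ({a, b, c, d} : Set Plane) = {b, a, d, c} := by
    intro a b c d; ext; simp; tauto
  have perm2 : ∀ a b c d : Plane, ({a, b, c, d} : Set Plane) = {d, a, b, c} := by
    intro a b c d; ext; simp; tauto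
  obtain ⟨T, hT, hac', s, hs, has, hcs⟩ := hac
  have hsP := hT.isTriangulation.subset s hs
  have hs3 := hT.isTriangulation.card_eq_three s hs
  have hs0 : inner P s ≠ ∅ := fun h0 =>
    hnot ⟨hac', s, mem_emptyTriangles.2 ⟨⟨hsP, hs3⟩, h0⟩, has, hcs⟩
  obtain ⟨p, hp⟩ := Finset.nonempty_iff_ne_empty.2 hs0
  obtain ⟨a', b', d', hF, rfl, -⟩ := exists_flipQuad hP hT hs hp
  have ha : a ∈ P := hsP has
  have hc : c ∈ P := hsP hcs
  have hmemP : ∀ {u v : Plane}, IsFixedEdge 1 P u v → u ∈ P ∧ v ∈ P := by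
    intro u v h
    obtain ⟨-, t, ht, h1, h2⟩ := h.2 T hT
    exact ⟨hT.isTriangulation.subset t ht h1, hT.isTriangulation.subset t ht h2⟩
  have hb : b ∈ P := (hmemP hab).2
  have hd : d ∈ P := (hmemP hda).1
  -- `ac` is the diagonal of `a' b' p d'` that is not a Delaunay edge
  obtain ⟨y, y', hF⟩ : ∃ y y', FlipQuad P y a y' c := by
    have m1 := hF.abc_mem hP
    have m2 := hF.acd_mem hP
    simp only [Finset.mem_insert, Finset.mem_singleton] at has hcs
    rcases has with rfl | rfl | rfl <;> rcases hcs with rfl | rfl | rfl <;>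
      first | exact absurd rfl hac' | skip
    · exact absurd ⟨hac', _, m1, by simp, by simp⟩ hnot
    · exact absurd ⟨hac', _, m2, by simp, by simp⟩ hnot
    · exact absurd ⟨hac', _, m1, by simp, by simp⟩ hnot
    · exact ⟨_, _, hF⟩
    · exact absurd ⟨hac', _, m2, by simp, by simp⟩ hnot
    · exact ⟨_, _, hF.rotate⟩
  have oy : 0 < orient a c y := by rw [orient_rotate]; exact hF.abd
  have oy' : orient a c y' < 0 := by
    rw [orient_swap_right]; linarith [hF.bcd]
  have hab' : a ≠ b := (hab.2 T hT).1
  have hcb' : c ≠ b := (hbc.2 T hT).1.symm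
  have had' : a ≠ d := (hda.2 T hT).1.symm
  have hcd' : c ≠ d := (hcd.2 T hT).1
  have ob := hP.orient_ne ha hc hb hac' hab' hcb'
  have od := hP.orient_ne ha hc hd hac' had' hcd'
  have opp : orient a c b * orient a c d < 0 := by
    obtain ⟨x, ⟨r, s, hr, hs, hrs, h1⟩, ⟨k, l, hk, hl, hkl, h2⟩⟩ := hcross
    have e1 : orient a c x = 0 := by
      have := orient_combo a c a c c (α := r) (β := s) (γ := 0) (by linarith)
      rw [zero_smul, add_zero, h1] at this
      rw [this, orient_self_mid, orient_self_right]; ring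
    have e2 : orient a c x = k * orient a c b + l * orient a c d := by
      have := orient_combo a c b d d (α := k) (β := l) (γ := 0) (by linarith)
      rw [zero_smul, add_zero, h2] at this
      rw [this]; ring
    have e3 : l * (orient a c b * orient a c d) = -(k * orient a c b ^ 2) := by
      linear_combination orient a c b * (e1.symm.trans e2).symm
    have : 0 < k * orient a c b ^ 2 := by positivity
    by_contra hcon
    have := mul_nonneg hl.le (not_lt.1 hcon)
    linarith
  have hF1 := hF.isFixedEdge_ab_bc hP hn
  have subQ : ∀ w ∈ ({b, d} : Set Plane),
      interior (convexHull ℝ ({a, c, w} : Set Plane)) ⊆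
        interior (convexHull ℝ (Q : Set Plane)) := by
    intro w hw
    refine interior_mono (convexHull_mono ?_)
    rw [hQ]
    simp only [Set.mem_insert_iff, Set.mem_singleton_iff] at hw
    intro v hv
    simp only [Set.mem_insert_iff, Set.mem_singleton_iff] at hv ⊢
    rcases hw with rfl | rfl <;> tauto
  have subF : ∀ w ∈ ({y, y'} : Set Plane), interior (convexHull ℝ ({a, c, w} : Set Plane)) ⊆
      interior (convexHull ℝ ({y, a, y', c} : Set Plane)) := by
    intro w hw
    refine interior_mono (convexHull_mono ?_)
    simp only [Set.mem_insert_iff, Set.mem_singleton_iff] at hw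
    intro v hv
    simp only [Set.mem_insert_iff, Set.mem_singleton_iff] at hv ⊢
    rcases hw with rfl | rfl <;> tauto
  have apex : ∀ w ∈ ({b, d} : Set Plane), ∀ z ∈ ({y, y'} : Set Plane),
      0 < orient a c w * orient a c z → w = z := by
    intro w hw z hz hwz
    have hwf : IsFixedEdge 1 P a w := by
      simp only [Set.mem_insert_iff, Set.mem_singleton_iff] at hw
      rcases hw with rfl | rfl
      · exact hab
      · exact hda.symm
    have hzf : IsFixedEdge 1 P a z := by
      simp only [Set.mem_insert_iff, Set.mem_singleton_iff] at hz
      rcases hz with rfl | rfl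
      · exact hF1.1.symm
      · exact hF1.2
    exact hP.apex_eq ha (hmemP hwf).2 (hmemP hzf).2 hwz
      (fun x hx hx' => Set.disjoint_left.1 (hdis a z hzf) hx (subQ w hw hx'))
      (fun x hx hx' => Set.disjoint_left.1 (hF.disjoint_fixedEdge hP hn hwf) hx (subF z hz hx'))
  refine mem_flipQuads.2 ⟨_, _, _, _, hF, Finset.coe_injective ?_⟩
  rw [hQ]
  rcases lt_or_gt_of_ne ob with h | h
  · have h' : 0 < orient a c d := by nlinarith
    rw [apex b (by simp) y' (by simp) (mul_pos_of_neg_of_neg h oy'),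
      apex d (by simp) y (by simp) (mul_pos h' oy), perm2, ← hcoe]
  · have h' : orient a c d < 0 := by nlinarith
    rw [apex b (by simp) y (by simp) (mul_pos h oy),
      apex d (by simp) y' (by simp) (mul_pos_of_neg_of_neg h' oy'), perm1, ← hcoe]

/-- The faces of the subdivision formed by the fixed edges that count as flippable are precisely the
quadrilaterals of `FlipQuad`. -/
theorem GeneralPosition.flippableQuadrilaterals_eq (hP : GeneralPosition P) (hn : 3 ≤ P.card) :
    flippableQuadrilaterals P = (flipQuads P : Set (Finset Plane)) := by
  ext Q
  constructor
  · rintro ⟨a, b, c, d, hQ, hcross, ⟨hab, hbc, hcd, hda⟩, -, hdis, hac, hbd⟩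
    have hac' : a ≠ c := by obtain ⟨T, -, h, -⟩ := hac; exact h
    have hbd' : b ≠ d := by obtain ⟨T, -, h, -⟩ := hbd; exact h
    by_cases h1 : IsEdge (emptyTriangles P) a c
    · by_cases h2 : IsEdge (emptyTriangles P) b d
      · -- two edges of one triangulation do not cross
        exfalso
        obtain ⟨-, s, hs, has, hcs⟩ := h1
        obtain ⟨-, t, ht, hbt, hdt⟩ := h2
        obtain ⟨x, hx1, hx2⟩ := hcross
        have := (hP.isTriangulation_emptyTriangles hn).face hs ht (A := {a, c}) (B := {b, d})
          (by simp [Finset.insert_subset_iff, has, hcs])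
          (by simp [Finset.insert_subset_iff, hbt, hdt])
          (by simpa [convexHull_pair] using openSegment_subset_segment ℝ _ _ hx1)
          (by simpa [convexHull_pair] using openSegment_subset_segment ℝ _ _ hx2)
        have hT := hP.emptyTriangles_mem_orderDelaunay hn 1
        have n1 := (hab.2 _ hT).1
        have n2 := (hbc.2 _ hT).1
        have n3 := (hcd.2 _ hT).1
        have n4 := (hda.2 _ hT).1
        have he : ({a, c} ∩ {b, d} : Finset Plane) = ∅ := by
          refine Finset.eq_empty_of_forall_notMem fun w hw => ?_
          simp only [Finset.mem_inter, Finset.mem_insert, Finset.mem_singleton] at hw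
          rcases hw with ⟨rfl | rfl, rfl | rfl⟩
          · exact n1 rfl
          · exact n4 rfl
          · exact n2 rfl
          · exact n3 rfl
        rw [he] at this
        simp at this
      · refine hP.mem_flipQuads_of_useful hn (a := b) (b := c) (c := d) (d := a) ?_ ?_ hbc hab
          hac'.symm hdis hbd h2 hcd hda
        · rw [hQ]; ext; simp; tauto
        · rw [openSegment_symm ℝ c a, Set.inter_comm]; exact hcross
    · exact hP.mem_flipQuads_of_useful hn hQ hcross hab hda hbd' hdis hac h1 hbc hcd
  · intro hQ
    obtain ⟨a, b, c, d, h, rfl⟩ := mem_flipQuads.1 (Finset.mem_coe.1 hQ)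
    exact h.isFlippableQuadrilateral hP hn

end

/-! ### Perturbations into general position -/

section

variable {P : Finset Plane} {a b c d x p v : Plane}
/-- A point of any given disc can be added to a set in general position: it only has to avoid
finitely many points, lines and circles. -/
theorem GeneralPosition.exists_insert (hP : GeneralPosition P) (v : Plane) {ε : ℝ} (hε : 0 < ε) :
    ∃ x, dist x v < ε ∧ x ∉ P ∧ GeneralPosition (insert x P) := by
  have hae : ∀ᵐ x ∂(MeasureTheory.volume : MeasureTheory.Measure Plane),
      x ∉ P ∧ (∀ p ∈ P, ∀ q ∈ P, p ≠ q → orient p q x ≠ 0) ∧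
      ∀ t ∈ P.powersetCard 3, x ∉ Metric.sphere (circ t).center (circ t).radius := by
    refine Filter.Eventually.and ?_ (Filter.Eventually.and ?_ ?_)
    · exact MeasureTheory.compl_mem_ae_iff.2 (P.finite_toSet.measure_zero _)
    · rw [Filter.eventually_all_finset]
      intro p _
      rw [Filter.eventually_all_finset]
      intro q _
      by_cases hpq : p = q
      · simp [hpq]
      · filter_upwards [ae_orient_ne_zero hpq] with x hx _ using hx
    · rw [Filter.eventually_all_finset]
      intro t _
      exact MeasureTheory.compl_mem_ae_iff.2 (MeasureTheory.Measure.addHaar_sphere _ _ _)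
  obtain ⟨x, ⟨hxP, hline, hcirc⟩, hxball⟩ :=
    (MeasureTheory.Measure.dense_of_ae hae).exists_mem_open Metric.isOpen_ball
      ⟨v, Metric.mem_ball_self hε⟩
  refine ⟨x, Metric.mem_ball.1 hxball, hxP, ?_, ?_⟩
  · intro s hs h3 hcol
    by_cases hxs : x ∈ s
    · have h2 : (s.erase x).card = 2 := by rw [Finset.card_erase_of_mem hxs, h3]
      obtain ⟨p, q, hpq, he⟩ := Finset.card_eq_two.1 h2
      have hsub : s.erase x ⊆ P := fun w hw =>
        (Finset.mem_insert.1 (hs (Finset.mem_erase.1 hw).2)).resolve_left (Finset.mem_erase.1 hw).1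
      rw [he] at hsub
      refine hline p (hsub (by simp)) q (hsub (by simp)) hpq (orient_eq_zero_of_collinear
        (hcol.subset ?_))
      have hp : p ∈ s := (Finset.mem_erase.1 (he ▸ (by simp) : p ∈ s.erase x)).2
      have hq : q ∈ s := (Finset.mem_erase.1 (he ▸ (by simp) : q ∈ s.erase x)).2
      rintro w (rfl | rfl | rfl) <;> assumption
    · exact hP.not_collinear s (fun w hw => (Finset.mem_insert.1 (hs hw)).resolve_left
        fun h => hxs (h ▸ hw)) h3 hcol
  · intro s hs h4 hcosph
    by_cases hxs : x ∈ s
    · have h3 : (s.erase x).card = 3 := by rw [Finset.card_erase_of_mem hxs, h4]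
      have hsub : s.erase x ⊆ P := fun w hw =>
        (Finset.mem_insert.1 (hs (Finset.mem_erase.1 hw).2)).resolve_left (Finset.mem_erase.1 hw).1
      refine hcirc _ (Finset.mem_powersetCard.2 ⟨hsub, h3⟩) ?_
      have hrad := hP.radius_nonneg hsub h3
      obtain ⟨o, r, hor⟩ := hcosph
      have hS : ∀ w ∈ s.erase x, w ∈ (⟨o, r⟩ : Sphere Plane) := fun w hw =>
        mem_sphere.2 (hor w (Finset.mem_coe.2 (Finset.mem_erase.1 hw).2))
      have hx : x ∈ (⟨o, r⟩ : Sphere Plane) := mem_sphere.2 (hor x (Finset.mem_coe.2 hxs))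
      obtain ⟨a, b, c, he, -, -, -, h⟩ := hP.exists_ccw hsub h3
      rw [he] at hS hrad ⊢
      have h0 := power_eq_pow h.ne' hS x
      rw [power_eq_zero hx, pow, Sphere.power, eq_comm, sub_eq_zero] at h0
      exact (pow_left_inj₀ dist_nonneg hrad two_ne_zero).1 h0
    · exact hP.not_cocircular s (fun w hw => (Finset.mem_insert.1 (hs hw)).resolve_left
        fun h => hxs (h ▸ hw)) h4 hcosph

theorem exists_generalPosition {ι : Type*} [Fintype ι] (v : ι → Plane) {ε : ℝ} (hε : 0 < ε) :
    ∃ p : ι → Plane, Function.Injective p ∧ (∀ i, dist (p i) (v i) < ε) ∧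
      GeneralPosition (Finset.univ.image p) := by
  have key : ∀ S : Finset ι, ∃ p : ι → Plane, Set.InjOn p S ∧ (∀ i ∈ S, dist (p i) (v i) < ε) ∧
      GeneralPosition (S.image p) := by
    intro S
    induction S using Finset.induction_on with
    | empty =>
      refine ⟨v, by simp, by simp, ⟨fun s hs h3 => ?_, fun s hs h4 => ?_⟩⟩
      · rw [Finset.image_empty, Finset.subset_empty] at hs
        simp [hs] at h3
      · rw [Finset.image_empty, Finset.subset_empty] at hs
        simp [hs] at h4
    | insert i S hi ih =>
      obtain ⟨p, hinj, hdist, hgp⟩ := ih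
      obtain ⟨x, hx, hxP, hgp'⟩ := hgp.exists_insert (v i) hε
      have hne : ∀ j ∈ S, Function.update p i x j = p j := fun j hj =>
        Function.update_of_ne (by rintro rfl; exact hi hj) _ _
      have himg : S.image (Function.update p i x) = S.image p :=
        Finset.image_congr fun j hj => hne j hj
      refine ⟨Function.update p i x, ?_, ?_, ?_⟩
      · rw [Finset.coe_insert, Set.injOn_insert (by simpa using hi)]
        refine ⟨fun j hj k hk h => ?_, ?_⟩
        · rw [hne j hj, hne k hk] at h
          exact hinj hj hk h
        · rw [← Finset.coe_image, himg]
          simpa using hxP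
      · intro j hj
        rcases Finset.mem_insert.1 hj with rfl | hj
        · simpa using hx
        · rw [hne j hj]; exact hdist j hj
      · rw [Finset.image_insert, himg]
        simpa using hgp'
  obtain ⟨p, h1, h2, h3⟩ := key Finset.univ
  exact ⟨p, by simpa using h1, fun i => h2 i (Finset.mem_univ i), h3⟩

/-! ### Quadrilaterals with a common empty circle -/

variable {ι : Type*}

/-- The points `p i`, `p j`, `p k`, `p l` form a convex quadrilateral in counterclockwise order, and
all the other points lie outside the circles through three of its vertices. -/
def NearlyCocircular (p : ι → Plane) (i j k l : ι) : Prop :=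
  0 < orient (p i) (p j) (p k) ∧ 0 < orient (p j) (p k) (p l) ∧ 0 < orient (p k) (p l) (p i) ∧
    0 < orient (p l) (p i) (p j) ∧ ∀ x, x ≠ i → x ≠ j → x ≠ k → x ≠ l →
      0 < incirc (p i) (p j) (p k) (p x) ∧ 0 < incirc (p j) (p k) (p l) (p x) ∧
      0 < incirc (p k) (p l) (p i) (p x) ∧ 0 < incirc (p l) (p i) (p j) (p x)

/-- A convex quadrilateral on a circle that contains no other point, neither inside nor on it, stays
nearly cocircular under small perturbations. -/
theorem eventually_nearlyCocircular [Finite ι] {p₀ : ι → Plane} {i j k l : ι} (S : Sphere Plane)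
    (h1 : 0 < orient (p₀ i) (p₀ j) (p₀ k)) (h2 : 0 < orient (p₀ j) (p₀ k) (p₀ l))
    (h3 : 0 < orient (p₀ k) (p₀ l) (p₀ i)) (h4 : 0 < orient (p₀ l) (p₀ i) (p₀ j))
    (hi : S.power (p₀ i) = 0) (hj : S.power (p₀ j) = 0) (hk : S.power (p₀ k) = 0)
    (hl : S.power (p₀ l) = 0)
    (hS : ∀ x, x ≠ i → x ≠ j → x ≠ k → x ≠ l → 0 < S.power (p₀ x)) :
    ∀ᶠ p in nhds p₀, NearlyCocircular p i j k l := by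
  have co : ∀ i j k : ι, Continuous fun p : ι → Plane => orient (p i) (p j) (p k) := by
    intro i j k; unfold orient; fun_prop
  have ci : ∀ i j k l : ι, Continuous fun p : ι → Plane => incirc (p i) (p j) (p k) (p l) := by
    intro i j k l; unfold incirc orient; fun_prop
  have pos : ∀ {a b c x : Plane}, 0 < orient a b c → S.power a = 0 → S.power b = 0 →
      S.power c = 0 → 0 < S.power x → 0 < incirc a b c x := by
    intro a b c x h ha hb hc hx
    have := orient_mul_power S a b c x
    rw [ha, hb, hc] at this
    have h' := mul_pos h hx
    linarith
  refine ((co i j k).continuousAt.eventually_const_lt h1).and <|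
    ((co j k l).continuousAt.eventually_const_lt h2).and <|
    ((co k l i).continuousAt.eventually_const_lt h3).and <|
    ((co l i j).continuousAt.eventually_const_lt h4).and ?_
  rw [Filter.eventually_all]
  intro x
  by_cases hx : x ≠ i ∧ x ≠ j ∧ x ≠ k ∧ x ≠ l
  · have hp := hS x hx.1 hx.2.1 hx.2.2.1 hx.2.2.2
    filter_upwards [(ci i j k x).continuousAt.eventually_const_lt (pos h1 hi hj hk hp),
      (ci j k l x).continuousAt.eventually_const_lt (pos h2 hj hk hl hp),
      (ci k l i x).continuousAt.eventually_const_lt (pos h3 hk hl hi hp),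
      (ci l i j x).continuousAt.eventually_const_lt (pos h4 hl hi hj hp)] with p e1 e2 e3 e4
    exact fun _ _ _ _ => ⟨e1, e2, e3, e4⟩
  · exact Filter.Eventually.of_forall fun p n1 n2 n3 n4 => absurd ⟨n1, n2, n3, n4⟩ hx

theorem quad_rotate (a b c d : Plane) : ({b, c, d, a} : Finset Plane) = {a, b, c, d} := by
  ext; simp; tauto

/-- In general position, a nearly cocircular quadrilateral is flippable; the side of the circle
`ijl` on which `p k` lies decides which of the diagonals is the Delaunay one. -/
theorem NearlyCocircular.quad_mem [Fintype ι] {p : ι → Plane}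
    (hP : GeneralPosition (Finset.univ.image p)) {i j k l : ι} (h : NearlyCocircular p i j k l) :
    {p i, p j, p k, p l} ∈ flipQuads (Finset.univ.image p) := by
  obtain ⟨abc, bcd, cda, dab, hinc⟩ := h
  have hm : ∀ i, p i ∈ Finset.univ.image p := fun i => by simp
  have abd : 0 < orient (p i) (p j) (p l) := by rwa [orient_rotate (p l) (p i) (p j)]
  have inner_sub : ∀ i j k l : ι, 0 < orient (p i) (p j) (p k) →
      (∀ x, x ≠ i → x ≠ j → x ≠ k → x ≠ l → 0 < incirc (p i) (p j) (p k) (p x)) →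
      inner (Finset.univ.image p) {p i, p j, p k} ⊆ {p l} := by
    intro i j k l ho hx q hq
    have hn := hP.notMem_of_mem_inner (triple_subset (hm i) (hm j) (hm k)) (card_triple ho.ne') hq
    obtain ⟨hqP, hneg⟩ := mem_inner.1 hq
    obtain ⟨x, -, rfl⟩ := Finset.mem_image.1 hqP
    simp only [Finset.mem_insert, Finset.mem_singleton, not_or] at hn ⊢
    by_contra hxl
    have := hx x (fun e => hn.1 (e ▸ rfl)) (fun e => hn.2.1 (e ▸ rfl)) (fun e => hn.2.2 (e ▸ rfl))
      (fun e => hxl (e ▸ rfl))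
    rw [← orient_mul_pow ho.ne'] at this
    nlinarith
  have i1 := inner_sub i j k l abc fun x n1 n2 n3 n4 => (hinc x n1 n2 n3 n4).1
  have i2 := inner_sub j k l i bcd fun x n1 n2 n3 n4 => (hinc x n4 n1 n2 n3).2.1
  have i3 := inner_sub k l i j cda fun x n1 n2 n3 n4 => (hinc x n3 n4 n1 n2).2.2.1
  have i4 := inner_sub l i j k dab fun x n1 n2 n3 n4 => (hinc x n2 n3 n4 n1).2.2.2
  rw [← tri_rotate (p l) (p i) (p j)] at i4
  obtain ⟨-, hil, hjl⟩ := ne_of_orient_ne abd.ne'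
  obtain ⟨-, hjk, hik⟩ : p i ≠ p j ∧ p j ≠ p k ∧ p i ≠ p k :=
    let h := ne_of_orient_ne abc.ne'; ⟨h.1, h.2.2, h.2.1⟩
  obtain ⟨-, -, hkl⟩ := ne_of_orient_ne bcd.ne'
  have h0 : pow {p i, p j, p l} (p k) ≠ 0 :=
    hP.pow_ne_zero (triple_subset (hm i) (hm j) (hm l)) (card_triple abd.ne') (hm k)
      (by simp [hik.symm, hjk.symm, hkl])
  rcases lt_or_gt_of_ne h0 with h | h
  · exact mem_flipQuads.2 ⟨p i, p j, p k, p l,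
      ⟨hm i, hm j, hm k, hm l, abc, bcd, cda, dab, h, i4, i2⟩, rfl⟩
  · have hneg : pow {p i, p j, p k} (p l) < 0 := (pow_neg_iff_of_same (mul_pos abc abd)).2 h
    rw [← tri_rotate] at hneg i1
    exact mem_flipQuads.2 ⟨p j, p k, p l, p i,
      ⟨hm j, hm k, hm l, hm i, bcd, cda, dab, abc, hneg, i1, i3⟩, (quad_rotate _ _ _ _).symm⟩

end

/-! ### Concentric squares -/

section

variable {k : ℕ}
/-- The vertices of the concentric squares with half side lengths `r i`. -/
noncomputable def squares {m : ℕ} (r : Fin m → ℝ) (ij : Fin m × Fin 4) : Plane :=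
  squareVertex (r ij.1) ij.2

/-- The vertex indices, in counterclockwise order, of the innermost square (`none`) and of the
isosceles trapezoids cut by the diagonals out of the annuli between consecutive squares. -/
def cell : Option (Fin k × Fin 4) → Fin 4 → Fin (k + 1) × Fin 4
  | none => fun j => (0, j)
  | some (i, j) => ![(i.castSucc, j + 1), (i.castSucc, j), (i.succ, j), (i.succ, j + 1)]

theorem cell_image_injective : Function.Injective fun κ : Option (Fin k × Fin 4) =>
    ({cell κ 0, cell κ 1, cell κ 2, cell κ 3} : Finset (Fin (k + 1) × Fin 4)) := by
  have hnone : ∀ ij : Fin k × Fin 4,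
      ({cell none 0, cell none 1, cell none 2, cell none 3} : Finset (Fin (k + 1) × Fin 4)) ≠
      {cell (some ij) 0, cell (some ij) 1, cell (some ij) 2, cell (some ij) 3} := by
    rintro ⟨i, j⟩ h
    have : (i.succ, j) ∈ ({cell none 0, cell none 1, cell none 2, cell none 3} :
        Finset (Fin (k + 1) × Fin 4)) := by rw [h]; simp [cell]
    simp [cell, Fin.succ_ne_zero] at this
  have key : ∀ j j' : Fin 4, (j = j' + 1 ∨ j = j') → (j + 1 = j' + 1 ∨ j + 1 = j') → j = j' := by
    decide
  rintro (_ | ⟨i, j⟩) (_ | ⟨i', j'⟩) h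
  · rfl
  · exact absurd h (hnone _)
  · exact absurd h.symm (hnone _)
  · have h := Finset.ext_iff.1 h
    simp only [cell, Finset.mem_insert, Finset.mem_singleton, Matrix.cons_val, Prod.forall,
      Prod.mk.injEq] at h
    have m1 := (h i.castSucc j).1 (by simp)
    have m2 := (h i'.castSucc j').2 (by simp)
    have m3 := (h i.castSucc (j + 1)).1 (by simp)
    simp only [Fin.ext_iff, Fin.val_castSucc, Fin.val_succ] at m1 m2 m3
    have hi : i = i' := by
      rw [Fin.ext_iff]
      omega
    subst hi
    have hj : j = j' := by
      have e1 : j = j' + 1 ∨ j = j' := by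
        rw [Fin.ext_iff, Fin.ext_iff]; omega
      have e2 : j + 1 = j' + 1 ∨ j + 1 = j' := by
        rw [Fin.ext_iff, Fin.ext_iff]; omega
      exact key j j' e1 e2
    rw [hj]

/-- The circle through the vertices of a cell. For a trapezoid between the squares with half side
lengths `r` and `R`, its centre is the point at distance `r + R` from the origin on the axis of the
trapezoid: a vertex `(±ρ, ρ)` then has the power `2 * (ρ - r) * (ρ - R)` with respect to it. -/
noncomputable def cellCircle (r : Fin (k + 1) → ℝ) : Option (Fin k × Fin 4) → Sphere Plane
  | none => ⟨0, √(r 0 ^ 2 + r 0 ^ 2)⟩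
  | some (i, j) => ⟨![!₂[0, r i.castSucc + r i.succ], !₂[-(r i.castSucc + r i.succ), 0],
      !₂[0, -(r i.castSucc + r i.succ)], !₂[r i.castSucc + r i.succ, 0]] j,
      √(r i.castSucc ^ 2 + r i.succ ^ 2)⟩

/-- All cells stay nearly cocircular under small perturbations, because their circles have the
other vertices of the squares strictly outside. -/
theorem eventually_cell (r : Fin (k + 1) → ℝ) (hr : ∀ i, 0 < r i) (hmono : StrictMono r)
    (κ : Option (Fin k × Fin 4)) : ∀ᶠ p in nhds (squares r),
      NearlyCocircular p (cell κ 0) (cell κ 1) (cell κ 2) (cell κ 3) := by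
  rcases κ with _ | ⟨i, j⟩
  · have h0 := hr 0
    have hrad : √(r 0 ^ 2 + r 0 ^ 2) ^ 2 = r 0 ^ 2 + r 0 ^ 2 := Real.sq_sqrt (by positivity)
    have hS : ∀ x, x ≠ cell none 0 → x ≠ cell none 1 → x ≠ cell none 2 → x ≠ cell none 3 →
        0 < (cellCircle r none).power (squares r x) := by
      rintro ⟨i', j'⟩ n1 n2 n3 n4
      have hlt : r 0 < r i' := by
        apply hmono
        rw [Fin.pos_iff_ne_zero]
        rintro rfl
        fin_cases j' <;> simp [cell] at n1 n2 n3 n4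
      have := mul_pos (sub_pos.2 hlt) (add_pos h0 (h0.trans hlt))
      fin_cases j' <;> simp [squares, squareVertex, power_eq, cellCircle, hrad] <;> nlinarith
    refine eventually_nearlyCocircular (cellCircle r none) ?_ ?_ ?_ ?_ ?_ ?_ ?_ ?_ hS
    iterate 4
      · simp [cell, squares, squareVertex, orient]
        nlinarith
    all_goals simp [cell, squares, squareVertex, power_eq, cellCircle, hrad]
  · have h0 := hr i.castSucc
    have h1 : r i.castSucc < r i.succ := hmono Fin.castSucc_lt_succ
    have hrad : √(r i.castSucc ^ 2 + r i.succ ^ 2) ^ 2 = r i.castSucc ^ 2 + r i.succ ^ 2 :=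
      Real.sq_sqrt (by positivity)
    -- no other half side length lies between two consecutive ones
    have hother : ∀ i' : Fin (k + 1), i' ≠ i.castSucc → i' ≠ i.succ →
        0 < (r i' - r i.castSucc) * (r i' - r i.succ) := by
      intro i' n1 n2
      rcases lt_or_gt_of_ne n1 with h | h
      · have := hmono h
        exact mul_pos_of_neg_of_neg (by linarith) (by linarith)
      · have h' : i.succ < i' := lt_of_le_of_ne (Fin.castSucc_lt_iff_succ_le.1 h) n2.symm
        have := hmono h'
        exact mul_pos (by linarith) (by linarith)
    have hpos := mul_pos h0 (h0.trans h1)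
    have hpos' := mul_pos (h0.trans h1) (sub_pos.2 h1)
    have hpos'' := mul_pos h0 (sub_pos.2 h1)
    have hS : ∀ x, x ≠ cell (some (i, j)) 0 → x ≠ cell (some (i, j)) 1 →
        x ≠ cell (some (i, j)) 2 → x ≠ cell (some (i, j)) 3 →
        0 < (cellCircle r (some (i, j))).power (squares r x) := by
      rintro ⟨i', j'⟩ n1 n2 n3 n4
      have hi' := hr i'
      have hm1 := mul_pos hi' h0
      have hm2 := mul_pos hi' (h0.trans h1)
      -- the power of a vertex whose height along the axis of the trapezoid is `-r i'`
      have hfar : 0 < r i' ^ 2 + (r i' + (r i.castSucc + r i.succ)) ^ 2 -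
          (r i.castSucc ^ 2 + r i.succ ^ 2) := by nlinarith
      -- the power of a vertex whose height along the axis of the trapezoid is `r i'`
      have hnear : (j' = j ∨ j' = j + 1) → 0 < r i' ^ 2 + (r i' - (r i.castSucc + r i.succ)) ^ 2 -
          (r i.castSucc ^ 2 + r i.succ ^ 2) := by
        intro hj
        have := hother i' (by
            rintro rfl
            rcases hj with rfl | rfl
            · exact n2 rfl
            · exact n1 rfl) (by
            rintro rfl
            rcases hj with rfl | rfl
            · exact n3 rfl
            · exact n4 rfl)
        nlinarith
      clear n1 n2 n3 n4
      fin_cases j <;> fin_cases j' <;>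
        simp [squares, squareVertex, power_eq, cellCircle, hrad] at hnear ⊢ <;> nlinarith
    refine eventually_nearlyCocircular (cellCircle r (some (i, j))) ?_ ?_ ?_ ?_ ?_ ?_ ?_ ?_ hS
    iterate 4
      · fin_cases j <;> simp [cell, squares, squareVertex, orient] <;> nlinarith
    all_goals
      fin_cases j <;> simp [cell, squares, squareVertex, power_eq, cellCircle, hrad] <;> ring

/-- Near concentric squares there are exactly `n - 3` flippable quadrilaterals. -/
theorem card_flipQuads_of_nearlyCocircular {p : Fin (k + 1) × Fin 4 → Plane}
    (hinj : Function.Injective p) (hP : GeneralPosition (Finset.univ.image p))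
    (h : ∀ κ : Option (Fin k × Fin 4),
      NearlyCocircular p (cell κ 0) (cell κ 1) (cell κ 2) (cell κ 3)) :
    (flipQuads (Finset.univ.image p)).card = 4 * (k + 1) - 3 := by
  have hcard : (Finset.univ.image p).card = 4 * (k + 1) := by
    rw [Finset.card_image_of_injective _ hinj]
    simp; ring
  refine le_antisymm ((hP.card_flipQuads_le (by omega)).trans_eq (by rw [hcard])) ?_
  have hle := Finset.card_le_card_of_injOn (s := Finset.univ) (t := flipQuads (Finset.univ.image p))
    (fun κ : Option (Fin k × Fin 4) =>
      ({cell κ 0, cell κ 1, cell κ 2, cell κ 3} : Finset (Fin (k + 1) × Fin 4)).image p)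
    (fun κ _ => by
      simp only [Finset.image_insert, Finset.image_singleton]
      exact (h κ).quad_mem hP)
    (fun κ _ κ' _ he => cell_image_injective (Finset.image_injective hinj he))
  rw [Finset.card_univ, Fintype.card_option, Fintype.card_prod, Fintype.card_fin,
    Fintype.card_fin] at hle
  omega

end

end DelaunayOrder

theorem mainTheorem3 :
    -- the upper bound
    (∀ P : Finset DelaunayOrder.Plane, 3 ≤ P.card → DelaunayOrder.GeneralPosition P →
      (DelaunayOrder.orderDelaunay 1 P).encard ≤ 2 ^ (P.card - 3)) ∧
    -- the bound is attained whenever `n` is a positive multiple of four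
    (∀ n : ℕ, 0 < n → 4 ∣ n →
      ∃ P : Finset DelaunayOrder.Plane, P.card = n ∧ DelaunayOrder.GeneralPosition P ∧
        (DelaunayOrder.orderDelaunay 1 P).encard = 2 ^ (n - 3)) ∧
    -- namely by every sufficiently small perturbation, into general position, of the vertices of
    -- concentric squares, and there are such perturbations of every size
    (∀ m : ℕ, 0 < m → ∀ r : Fin m → ℝ, (∀ i, 0 < r i) → StrictMono r →
      (∃ δ : ℝ, 0 < δ ∧ ∀ P : Finset DelaunayOrder.Plane,
        DelaunayOrder.IsPerturbedSquares r δ P → DelaunayOrder.GeneralPosition P →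
          P.card = 4 * m ∧
          (DelaunayOrder.flippableQuadrilaterals P).encard = ((4 * m - 3 : ℕ) : ℕ∞) ∧
          (DelaunayOrder.orderDelaunay 1 P).encard = 2 ^ (4 * m - 3)) ∧
      (∀ ε : ℝ, 0 < ε → ∃ P : Finset DelaunayOrder.Plane,
        DelaunayOrder.IsPerturbedSquares r ε P ∧ DelaunayOrder.GeneralPosition P)) := by
  classical
  have squares_case : ∀ m : ℕ, 0 < m → ∀ r : Fin m → ℝ, (∀ i, 0 < r i) → StrictMono r →
      (∃ δ : ℝ, 0 < δ ∧ ∀ P : Finset DelaunayOrder.Plane,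
        DelaunayOrder.IsPerturbedSquares r δ P → DelaunayOrder.GeneralPosition P →
          P.card = 4 * m ∧
          (DelaunayOrder.flippableQuadrilaterals P).encard = ((4 * m - 3 : ℕ) : ℕ∞) ∧
          (DelaunayOrder.orderDelaunay 1 P).encard = 2 ^ (4 * m - 3)) ∧
      (∀ ε : ℝ, 0 < ε → ∃ P : Finset DelaunayOrder.Plane,
        DelaunayOrder.IsPerturbedSquares r ε P ∧ DelaunayOrder.GeneralPosition P) := by
    intro m hm r hr hmono
    obtain ⟨k, rfl⟩ : ∃ k, m = k + 1 := ⟨m - 1, by omega⟩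
    constructor
    · obtain ⟨δ, hδ, hball⟩ := Metric.eventually_nhds_iff.1
        (Filter.eventually_all.2 (DelaunayOrder.eventually_cell r hr hmono))
      refine ⟨δ, hδ, fun P ⟨p, hinj, hrange, hdist⟩ hP => ?_⟩
      obtain rfl : P = Finset.univ.image p := by
        apply Finset.coe_injective
        rw [← hrange]; simp
      have hcell := hball (y := p) ((dist_pi_lt_iff hδ).2 fun ij => hdist ij.1 ij.2)
      have hcard : (Finset.univ.image p).card = 4 * (k + 1) := by
        rw [Finset.card_image_of_injective _ hinj]
        simp; ring
      have hM := DelaunayOrder.card_flipQuads_of_nearlyCocircular hinj hP hcell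
      refine ⟨hcard, ?_, ?_⟩
      · rw [hP.flippableQuadrilaterals_eq (by omega), Set.encard_coe_eq_coe_finsetCard, hM]
      · rw [hP.encard_orderDelaunay_one (by omega), hM]
    · intro ε hε
      obtain ⟨p, hinj, hdist, hP⟩ :=
        DelaunayOrder.exists_generalPosition (DelaunayOrder.squares r) hε
      exact ⟨Finset.univ.image p, ⟨p, hinj, by simp, fun i j => hdist (i, j)⟩, hP⟩
  refine ⟨fun P hn hP => ?_, fun n hn hdvd => ?_, squares_case⟩
  · rw [hP.encard_orderDelaunay_one hn]
    exact pow_le_pow_right₀ one_le_two (hP.card_flipQuads_le hn)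
  · obtain ⟨m, rfl⟩ := hdvd
    obtain ⟨⟨δ, hδ, h1⟩, h2⟩ := squares_case m (by omega) (fun i => (i : ℝ) + 1)
      (fun i => by positivity) fun i j hij => by simpa using hij
    obtain ⟨P, hpert, hP⟩ := h2 δ hδ
    obtain ⟨hcard, -, h3⟩ := h1 P hpert hP
    exact ⟨P, hcard, hP, h3⟩
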